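/- Let $k$ be a field and $(A=\bigoplus_{i\in\mathbb Z}A^i,d)$ a unital dg $k$-algebra ($d$ of degree $+1$) with finite-dimensional cohomology, and let $e_1,\dots,e_n\in A$ be homogeneous cocycles such that $[1],[e_1],\dots,[e_n]$ is a basis of $H(A)$. Let $x_i$ be a variable of degree $1-|e_i|$, let $k\langle\langle X\rangle\rangle$ be the graded algebra of formal power series in the non-commuting variables $x_1,\dots,x_n$, and let $I$ be its ideal of series without constant term. For a graded vector space $M$ let $M\otimes k\langle\langle X\rangle\rangle$ denote the completed tensor product, whose degree $p$ part consists of all formal sums $\sum_w m_w\otimes w$ over the words $w$ in the $x_i$ with $m_w\in M^{p-|w|}$; products are formed with the Koszul sign rule, $(a\otimes u)(b\otimes v)=(-1)^{|u||b|}ab\otimes uv$. A formal power series connection consists of a degree one derivation $\eth$ of $k\langle\langle X\rangle\rangle$ with $\eth^2=0$ and $\eth I\subset I^2$, and a degree one element $\omega=\sum_w\omega_w\otimes w$ of $A\otimes k\langle\langle X\rangle\rangle$ with $\omega\equiv\sum_i e_i\otimes x_i$ modulo $A\otimes I^2$ and $d\omega+\eth\omega+\omega\omega=0$, where $\eth(a\otimes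 u)=(-1)^{|a|}a\otimes\eth u$. For a dg $A$-bimodule $M$ put $d^M_\omega m=dm+\eth m+\omega m-(-1)^{|m|}m\,\omega$ on $M\otimes k\langle\langle X\rangle\rangle$; this is a differential, and for $M=A$ (where it is written $d_\omega$) it makes $A\otimes k\langle\langle X\rangle\rangle$ a dg algebra. Let $C^\bullet(A,M)$ be the Hochschild complex, whose degree $p$ part consists of the families $f=(f_m)_{m\ge0}$ of $k$-multilinear maps $f_m:A^m\to M$ with $|f_m(a_1,\dots,a_m)|=p+\sum_i(|a_i|-1)$ for homogeneous $a_i$, with differential $$\delta f=d\circ f-(-1)^pf\circ Q+\tau\cup f-(-1)^pf\cup\tau .$$ Here $Q$ is the differential of the bar construction, $$Q[a_1|\cdots|a_m]=-\sum_{i=1}^m(-1)^{\sum_{j<i}(|a_j|-1)}[a_1|\cdots|da_i|\cdots|a_m]-\sum_{i=1}^{m-1}(-1)^{\sum_{j\le i}(|a_j|-1)}[a_1|\cdots|a_ia_{i+1}|\cdots|a_m],$$ $\tau[a]=a$ (and $\tau=0$ on words of length $\ne1$), and the cup product is $$(f\cup g)[a_1|\cdots|a_m]=\sum_{i=0}^m(-1)^{|g|\sum_{j\le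 i}(|a_j|-1)}f[a_1|\cdots|a_i]\,g[a_{i+1}|\cdots|a_m].$$ Then $C^\bullet(A,A)$ is a dg algebra under $\cup$. Write $\mathrm{Hoch}^\bullet(A,M)=H^\bullet(C^\bullet(A,M),\delta)$, and let $$\omega^*f=f(\omega,\dots,\omega)=\sum_w\Big(\sum_{w=w_1\cdots w_m}(-1)^{\sum_{i<j}|w_i||w_j|}f[\omega_{w_1}|\cdots|\omega_{w_m}]\Big)\otimes w,$$ the inner sum being over all ways to cut $w$ into non-empty words. Theorem 3.1. (i) The map $f\mapsto\omega^*f$ sends cocycles to cocycles and induces an isomorphism of graded associative unital algebras $$\mathrm{Hoch}^\bullet(A,A)\;\cong\;H^\bullet(A\otimes k\langle\langle X\rangle\rangle,d_\omega).$$ (ii) For every dg $A$-bimodule $M$, the map $f\mapsto\omega^*f$ sends cocycles to cocycles and induces, in every degree $p$, an isomorphism of vector spaces $$\mathrm{Hoch}^p(A,M)\;\cong\;H^p(M\otimes k\langle\langle X\rangle\rangle,d^M_\omega).$$ -/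

import Mathlib

open scoped DirectSum RightActions

noncomputable section

namespace ChenHoch

/-! ### Complexes, dg algebras given degree by degree, and their cohomology -/

/-- A `ℤ`-graded cochain complex over `k`.  The degree `p` part is a subspace `obj p` of a fixed
vector space `X`, and `d p` is the differential on it (only its values on `obj p` matter). -/
structure CochainCx (k X : Type*) [Field k] [AddCommGroup X] [Module k X] where
  obj : ℤ → Submodule k X
  d : ℤ → X →ₗ[k] X
  d_mem : ∀ {p x}, x ∈ obj p → d p x ∈ obj (p + 1)
  d_d : ∀ {p x}, x ∈ obj p → d (p + 1) (d p x) = 0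

namespace CochainCx

variable {k X : Type*} [Field k] [AddCommGroup X] [Module k X] (C : CochainCx k X)

/-- Cocycles of degree `p`. -/
def cocycle (p : ℤ) : Submodule k X := C.obj p ⊓ LinearMap.ker (C.d p)

/-- Coboundaries of degree `p`. -/
def coboundary (p : ℤ) : Submodule k X := (C.obj (p - 1)).map (C.d (p - 1))

/-- The cohomology in degree `p`. -/
abbrev H (p : ℤ) : Type _ := C.cocycle p ⧸ (C.coboundary p).submoduleOf (C.cocycle p)

/-- The class of a cocycle. -/
def cls (p : ℤ) (x : X) (hx : x ∈ C.cocycle p) : C.H p :=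
  Submodule.Quotient.mk ⟨x, hx⟩

theorem cls_surj {p : ℤ} (a : C.H p) : ∃ x, ∃ hx : x ∈ C.cocycle p, a = C.cls p x hx := by
  obtain ⟨⟨x, hx⟩, rfl⟩ := Submodule.Quotient.mk_surjective _ a
  exact ⟨x, hx, rfl⟩

theorem cls_sigma {p q : ℤ} (h : p = q) {x y : X} (e : x = y) (hx : x ∈ C.cocycle p)
    (hy : y ∈ C.cocycle q) :
    (⟨p, C.cls p x hx⟩ : Σ i, C.H i) = ⟨q, C.cls q y hy⟩ := by
  subst h; subst e; rfl

end CochainCx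

/-- A dg algebra whose degree `p` part is a subspace `obj p` of a fixed vector space `X`;
`mul p q` is the product of an element of degree `p` with an element of degree `q`. -/
structure CochainAlg (k X : Type*) [Field k] [AddCommGroup X] [Module k X]
    extends CochainCx k X where
  mul : ℤ → ℤ → X →ₗ[k] X →ₗ[k] X
  one : X
  one_mem : one ∈ obj 0
  mul_mem : ∀ {p q x y}, x ∈ obj p → y ∈ obj q → mul p q x y ∈ obj (p + q)
  one_mul : ∀ {p x}, x ∈ obj p → mul 0 p one x = x
  mul_one : ∀ {p x}, x ∈ obj p → mul p 0 x one = x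
  mul_assoc : ∀ {p q r x y z}, x ∈ obj p → y ∈ obj q → z ∈ obj r →
    mul (p + q) r (mul p q x y) z = mul p (q + r) x (mul q r y z)
  leibniz : ∀ {p q x y}, x ∈ obj p → y ∈ obj q →
    d (p + q) (mul p q x y) =
      mul (p + 1) q (d p x) y + (-1 : k) ^ p • mul p (q + 1) x (d q y)

namespace CochainAlg

variable {k X : Type*} [Field k] [AddCommGroup X] [Module k X] (C : CochainAlg k X)

theorem d_one : C.d 0 C.one = 0 := by
  have h := C.leibniz C.one_mem C.one_mem
  have h1 := C.d_mem C.one_mem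
  have e1 := C.mul_one h1
  have e2 := C.one_mul h1
  have e3 := C.one_mul C.one_mem
  simp only [add_zero, zero_add, zpow_zero, one_smul] at *
  rw [e1, e2, e3] at h
  simpa using h

theorem one_cocycle : C.one ∈ C.cocycle 0 := ⟨C.one_mem, C.d_one⟩

theorem mul_cocycle {p q : ℤ} {x y : X} (hx : x ∈ C.cocycle p) (hy : y ∈ C.cocycle q) :
    C.mul p q x y ∈ C.cocycle (p + q) := by
  have h1 : C.d p x = 0 := hx.2
  have h2 : C.d q y = 0 := hy.2
  refine ⟨C.mul_mem hx.1 hy.1, ?_⟩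
  change C.d (p + q) (C.mul p q x y) = 0
  rw [C.leibniz hx.1 hy.1, h1, h2]
  simp

theorem mul_coboundary {p q : ℤ} {x y : X} (hx : x ∈ C.cocycle p) (hy : y ∈ C.coboundary q) :
    C.mul p q x y ∈ C.coboundary (p + q) := by
  obtain ⟨z, hz, rfl⟩ := hy
  have h1 : C.d p x = 0 := hx.2
  have e : p + q - 1 = p + (q - 1) := by ring
  refine ⟨(-1 : k) ^ p • C.mul p (q - 1) x z, ?_, ?_⟩
  · rw [e]
    exact Submodule.smul_mem _ _ (C.mul_mem hx.1 hz)
  · rw [e, map_smul, C.leibniz hx.1 hz, h1, sub_add_cancel, map_zero, LinearMap.zero_apply,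
      zero_add, smul_smul, ← mul_zpow]
    simp

theorem coboundary_mul {p q : ℤ} {x y : X} (hx : x ∈ C.coboundary p) (hy : y ∈ C.cocycle q) :
    C.mul p q x y ∈ C.coboundary (p + q) := by
  obtain ⟨z, hz, rfl⟩ := hx
  have h1 : C.d q y = 0 := hy.2
  have e : p + q - 1 = (p - 1) + q := by ring
  refine ⟨C.mul (p - 1) q z y, ?_, ?_⟩
  · rw [e]
    exact C.mul_mem hz hy.1
  · rw [e, C.leibniz hz hy.1, h1, sub_add_cancel]
    simp

/-- The product of two cocycles, as a cohomology class. -/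
def mulCls (p q : ℤ) : C.cocycle p →ₗ[k] C.cocycle q →ₗ[k] C.H (p + q) :=
  LinearMap.mk₂ k (fun x y => C.cls (p + q) (C.mul p q x y) (C.mul_cocycle x.2 y.2))
    (fun x x' y => by
      simp only [CochainCx.cls, ← Submodule.Quotient.mk_add]
      congr 1; ext; simp)
    (fun c x y => by
      simp only [CochainCx.cls, ← Submodule.Quotient.mk_smul]
      congr 1; ext; simp)
    (fun x y y' => by
      simp only [CochainCx.cls, ← Submodule.Quotient.mk_add]
      congr 1; ext; simp)
    (fun c x y => by
      simp only [CochainCx.cls, ← Submodule.Quotient.mk_smul]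
      congr 1; ext; simp)

/-- The product induced on cohomology. -/
def mulH (p q : ℤ) : C.H p →ₗ[k] C.H q →ₗ[k] C.H (p + q) :=
  Submodule.liftQ _
    { toFun := fun x => Submodule.liftQ _ (C.mulCls p q x) (fun y hy =>
        (Submodule.Quotient.mk_eq_zero _).2 (C.mul_coboundary x.2 hy))
      map_add' := fun x x' => by
        refine LinearMap.ext fun y => ?_
        obtain ⟨y, rfl⟩ := Submodule.Quotient.mk_surjective _ y
        simp only [Submodule.liftQ_apply, map_add, LinearMap.add_apply]
        rfl
      map_smul' := fun c x => by
        refine LinearMap.ext fun y => ?_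
        obtain ⟨y, rfl⟩ := Submodule.Quotient.mk_surjective _ y
        simp only [Submodule.liftQ_apply, map_smul, LinearMap.smul_apply, RingHom.id_apply]
        rfl }
    (fun x hx => by
      refine LinearMap.ext fun y => ?_
      obtain ⟨y, rfl⟩ := Submodule.Quotient.mk_surjective _ y
      exact (Submodule.Quotient.mk_eq_zero _).2 (C.coboundary_mul hx y.2))

theorem mulH_cls {p q : ℤ} {x y : X} (hx : x ∈ C.cocycle p) (hy : y ∈ C.cocycle q) :
    C.mulH p q (C.cls p x hx) (C.cls q y hy) =
      C.cls (p + q) (C.mul p q x y) (C.mul_cocycle hx hy) := rfl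

instance : GradedMonoid.GMul C.H := ⟨fun {p q} x y => C.mulH p q x y⟩

instance : GradedMonoid.GOne C.H := ⟨C.cls 0 C.one C.one_cocycle⟩

instance : GradedMonoid.GMonoid C.H where
  one_mul := fun ⟨p, a⟩ => by
    obtain ⟨x, hx, rfl⟩ := C.cls_surj a
    exact C.cls_sigma (zero_add p) (C.one_mul hx.1) (C.mul_cocycle C.one_cocycle hx) hx
  mul_one := fun ⟨p, a⟩ => by
    obtain ⟨x, hx, rfl⟩ := C.cls_surj a
    exact C.cls_sigma (add_zero p) (C.mul_one hx.1) (C.mul_cocycle hx C.one_cocycle) hx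
  mul_assoc := fun ⟨p, a⟩ ⟨q, b⟩ ⟨r, c⟩ => by
    obtain ⟨x, hx, rfl⟩ := C.cls_surj a
    obtain ⟨y, hy, rfl⟩ := C.cls_surj b
    obtain ⟨z, hz, rfl⟩ := C.cls_surj c
    exact C.cls_sigma (add_assoc p q r) (C.mul_assoc hx.1 hy.1 hz.1)
      (C.mul_cocycle (C.mul_cocycle hx hy) hz) (C.mul_cocycle hx (C.mul_cocycle hy hz))

instance : DirectSum.GRing C.H where
  mul_zero := fun a => map_zero (C.mulH _ _ a)
  zero_mul := fun b => by
    change C.mulH _ _ 0 b = 0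
    rw [map_zero, LinearMap.zero_apply]
  mul_add := fun a b c => map_add (C.mulH _ _ a) b c
  add_mul := fun a b c => by
    change C.mulH _ _ (a + b) c = C.mulH _ _ a c + C.mulH _ _ b c
    rw [map_add, LinearMap.add_apply]
  natCast := fun n => n • GradedMonoid.GOne.one
  natCast_zero := zero_smul _ _
  natCast_succ := fun n => succ_nsmul _ n
  intCast := fun n => n • GradedMonoid.GOne.one
  intCast_ofNat := fun n => natCast_zsmul _ n
  intCast_negSucc_ofNat := fun n => negSucc_zsmul _ n

instance : DirectSum.GAlgebra k C.H where
  toFun :=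
    { toFun := fun c => c • (GradedMonoid.GOne.one : C.H 0)
      map_zero' := zero_smul _ _
      map_add' := fun a b => add_smul a b _ }
  map_one := one_smul _ _
  map_mul := fun r s =>
    C.cls_sigma (add_zero 0).symm
      (by simp [C.one_mul C.one_mem, smul_smul, mul_comm])
      (Submodule.smul_mem _ (r * s) C.one_cocycle)
      (C.mul_cocycle (Submodule.smul_mem _ r C.one_cocycle)
        (Submodule.smul_mem _ s C.one_cocycle))
  commutes := fun r ⟨p, a⟩ => by
    obtain ⟨x, hx, rfl⟩ := C.cls_surj a
    exact C.cls_sigma (by ring) (by simp [C.one_mul hx.1, C.mul_one hx.1])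
      (C.mul_cocycle (Submodule.smul_mem _ r C.one_cocycle) hx)
      (C.mul_cocycle hx (Submodule.smul_mem _ r C.one_cocycle))
  smul_def := fun r ⟨p, a⟩ => by
    obtain ⟨x, hx, rfl⟩ := C.cls_surj a
    exact C.cls_sigma (zero_add p).symm (by simp [C.one_mul hx.1])
      (Submodule.smul_mem _ r hx)
      (C.mul_cocycle (Submodule.smul_mem _ r C.one_cocycle) hx)

/-- The cohomology algebra `⨁ p, H^p`, with the product induced by `mul`. -/
abbrev HAlg : Type _ := ⨁ p, C.H p

end CochainAlg

/-! ### Dg vector spaces, dg algebras and dg bimodules -/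

/-- A dg vector space: an internally `ℤ`-graded vector space `M = ⨁ i, deg i` with a differential
of degree one. -/
structure DGModule (k M : Type*) [Field k] [AddCommGroup M] [Module k M] where
  deg : ℤ → Submodule k M
  [dec : DirectSum.Decomposition deg]
  d : M →ₗ[k] M
  d_mem : ∀ {i m}, m ∈ deg i → d m ∈ deg (i + 1)
  d_d : ∀ m, d (d m) = 0

attribute [instance] DGModule.dec

/-- A unital dg algebra structure on the (associative, unital) `k`-algebra `A`. -/
structure DGAlgebra (k A : Type*) [Field k] [Ring A] [Algebra k A] extends DGModule k A where
  one_mem : (1 : A) ∈ deg 0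
  mul_mem : ∀ {i j a b}, a ∈ deg i → b ∈ deg j → a * b ∈ deg (i + j)
  leibniz : ∀ {i a}, a ∈ deg i → ∀ b, d (a * b) = d a * b + (-1 : k) ^ i • (a * d b)

/-- A dg bimodule over the dg algebra `𝔸`, on the `A`-bimodule `M`
(`a •> m` and `m <• a` are the left and the right action). -/
structure DGBimodule {k A : Type*} [Field k] [Ring A] [Algebra k A] (𝔸 : DGAlgebra k A)
    (M : Type*) [AddCommGroup M] [Module k M] [Module A M] [Module Aᵐᵒᵖ M]
    [SMulCommClass A Aᵐᵒᵖ M] [IsScalarTower k A M] [IsScalarTower k Aᵐᵒᵖ M]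
    extends DGModule k M where
  smul_mem : ∀ {i j a m}, a ∈ 𝔸.deg i → m ∈ deg j → a •> m ∈ deg (i + j)
  op_smul_mem : ∀ {i j m a}, m ∈ deg i → a ∈ 𝔸.deg j → m <• a ∈ deg (i + j)
  leibniz_left : ∀ {i a}, a ∈ 𝔸.deg i → ∀ m,
    d (a •> m) = 𝔸.d a •> m + (-1 : k) ^ i • (a •> d m)
  leibniz_right : ∀ {i m}, m ∈ deg i → ∀ a,
    d (m <• a) = d m <• a + (-1 : k) ^ i • (m <• 𝔸.d a)

/-- The sign `(-1) ^ p` in `k`. -/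
theorem sgn_add (k : Type*) [Field k] (p q : ℤ) :
    (-1 : k) ^ (p + q) = (-1 : k) ^ p * (-1 : k) ^ q :=
  zpow_add₀ (neg_ne_zero.2 one_ne_zero) p q

theorem sgn_mul_self (k : Type*) [Field k] (p : ℤ) : (-1 : k) ^ p * (-1 : k) ^ p = 1 := by
  rw [← mul_zpow]; simp

theorem sgn_neg (k : Type*) [Field k] (p : ℤ) : (-1 : k) ^ (-p) = (-1 : k) ^ p := by
  rw [zpow_neg, ← inv_zpow]; simp

theorem sgn_sub (k : Type*) [Field k] (p q : ℤ) :
    (-1 : k) ^ (p - q) = (-1 : k) ^ p * (-1 : k) ^ q := by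
  rw [sub_eq_add_neg, sgn_add, sgn_neg]

theorem sgn_succ (k : Type*) [Field k] (p : ℤ) : (-1 : k) ^ (p + 1) = -(-1 : k) ^ p := by
  rw [sgn_add]; simp

/-- Signs only depend on parities. -/
theorem sgn_congr (k : Type*) [Field k] {p q : ℤ} (h : Even (p - q)) :
    (-1 : k) ^ p = (-1 : k) ^ q := by
  have h1 : (-1 : k) ^ (p - q) = 1 := Even.neg_one_zpow h
  rw [sgn_sub] at h1
  calc (-1 : k) ^ p = (-1 : k) ^ p * ((-1 : k) ^ q * (-1 : k) ^ q) := by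
        rw [sgn_mul_self, mul_one]
    _ = (-1 : k) ^ q := by rw [← mul_assoc, h1, one_mul]

namespace DGModule

section

variable {k M : Type*} [Field k] [AddCommGroup M] [Module k M] (V : DGModule k M)

/-- The linear operator which multiplies homogeneous elements of degree `i` by `(-1) ^ (c i)`. -/
def signOp (c : ℤ → ℤ) : M →ₗ[k] M :=
  DirectSum.toModule k ℤ M (fun i => (-1 : k) ^ (c i) • (V.deg i).subtype) ∘ₗ
    (DirectSum.decomposeLinearEquiv V.deg).toLinearMap

/-- `m ↦ (-1) ^ (s * |m|) m`. -/
def koszul (s : ℤ) : M →ₗ[k] M := V.signOp fun i => s * i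

/-- `m ↦ (-1) ^ (s * (|m| - 1)) m`, the Koszul sign for the shifted degree `|m| - 1`. -/
def barSign (s : ℤ) : M →ₗ[k] M := V.signOp fun i => s * (i - 1)

theorem signOp_of_mem (c : ℤ → ℤ) {i : ℤ} {m : M} (h : m ∈ V.deg i) :
    V.signOp c m = (-1 : k) ^ (c i) • m := by
  lift m to V.deg i using h
  simp [signOp]

theorem koszul_of_mem (s : ℤ) {i : ℤ} {m : M} (h : m ∈ V.deg i) :
    V.koszul s m = (-1 : k) ^ (s * i) • m := V.signOp_of_mem _ h

theorem barSign_of_mem (s : ℤ) {i : ℤ} {m : M} (h : m ∈ V.deg i) :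
    V.barSign s m = (-1 : k) ^ (s * (i - 1)) • m := V.signOp_of_mem _ h

/-- Additive statements may be checked on homogeneous elements. -/
theorem hom_induction {P : M → Prop} (h0 : P 0) (hom : ∀ i, ∀ m ∈ V.deg i, P m)
    (add : ∀ a b, P a → P b → P (a + b)) (m : M) : P m :=
  DirectSum.Decomposition.inductionOn V.deg h0 (fun {i} m => hom i m.1 m.2) add m

theorem signOp_mem (c : ℤ → ℤ) {i : ℤ} {m : M} (h : m ∈ V.deg i) : V.signOp c m ∈ V.deg i := by
  rw [V.signOp_of_mem c h]
  exact Submodule.smul_mem _ _ h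

theorem signOp_signOp (c c' : ℤ → ℤ) (m : M) :
    V.signOp c (V.signOp c' m) = V.signOp (fun i => c i + c' i) m := by
  induction m using V.hom_induction with
  | h0 => simp
  | hom i m h =>
    rw [V.signOp_of_mem c' h, map_smul, V.signOp_of_mem c h, V.signOp_of_mem _ h, smul_smul,
      sgn_add, mul_comm]
  | add a b ha hb => simp only [map_add, ha, hb]

theorem signOp_congr {c c' : ℤ → ℤ} (h : ∀ i, Even (c i - c' i)) : V.signOp c = V.signOp c' := by
  ext m
  induction m using V.hom_induction with
  | h0 => simp
  | hom i m hm => rw [V.signOp_of_mem c hm, V.signOp_of_mem c' hm, sgn_congr k (h i)]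
  | add a b ha hb => simp only [map_add, ha, hb]

theorem signOp_zero (m : M) : V.signOp (fun _ => 0) m = m := by
  induction m using V.hom_induction with
  | h0 => simp
  | hom i m hm => rw [V.signOp_of_mem _ hm]; simp
  | add a b ha hb => simp only [map_add, ha, hb]

theorem koszul_mem (s : ℤ) {i : ℤ} {m : M} (h : m ∈ V.deg i) : V.koszul s m ∈ V.deg i :=
  V.signOp_mem _ h

theorem barSign_mem (s : ℤ) {i : ℤ} {m : M} (h : m ∈ V.deg i) : V.barSign s m ∈ V.deg i :=
  V.signOp_mem _ h

theorem koszul_koszul (s t : ℤ) (m : M) : V.koszul s (V.koszul t m) = V.koszul (s + t) m := by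
  rw [koszul, koszul, signOp_signOp, koszul]
  exact congrArg (fun c => V.signOp c m) (funext fun i => by ring)

theorem barSign_barSign (s t : ℤ) (m : M) : V.barSign s (V.barSign t m) = V.barSign (s + t) m := by
  rw [barSign, barSign, signOp_signOp, barSign]
  exact congrArg (fun c => V.signOp c m) (funext fun i => by ring)

theorem koszul_congr {s t : ℤ} (h : Even (s - t)) : V.koszul s = V.koszul t :=
  V.signOp_congr fun i => by rw [← sub_mul]; exact h.mul_right i

theorem barSign_congr {s t : ℤ} (h : Even (s - t)) : V.barSign s = V.barSign t :=
  V.signOp_congr fun i => by rw [← sub_mul]; exact h.mul_right _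

theorem koszul_zero (m : M) : V.koszul 0 m = m := by
  rw [koszul, V.signOp_congr (c' := fun _ => 0) (by simp), signOp_zero]

theorem barSign_zero (m : M) : V.barSign 0 m = m := by
  rw [barSign, V.signOp_congr (c' := fun _ => 0) (by simp), signOp_zero]

theorem d_koszul (s : ℤ) (m : M) : V.koszul s (V.d m) = (-1 : k) ^ s • V.d (V.koszul s m) := by
  induction m using V.hom_induction with
  | h0 => simp
  | hom i m hm =>
    rw [V.koszul_of_mem s hm, V.koszul_of_mem s (V.d_mem hm), map_smul, smul_smul, ← sgn_add]
    congr 2; ring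
  | add a b ha hb => simp only [map_add, ha, hb, smul_add]

theorem d_barSign (s : ℤ) (m : M) : V.barSign s (V.d m) = (-1 : k) ^ s • V.d (V.barSign s m) := by
  induction m using V.hom_induction with
  | h0 => simp
  | hom i m hm =>
    rw [V.barSign_of_mem s hm, V.barSign_of_mem s (V.d_mem hm), map_smul, smul_smul, ← sgn_add]
    congr 2; ring
  | add a b ha hb => simp only [map_add, ha, hb, smul_add]

theorem koszul_one (m : M) : V.koszul 1 m = - V.barSign 1 m := by
  induction m using V.hom_induction with
  | h0 => simp
  | hom i m hm =>
    rw [V.koszul_of_mem _ hm, V.barSign_of_mem _ hm, ← neg_smul, ← sgn_succ]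
    congr 2; ring
  | add a b ha hb => simp only [map_add, ha, hb]; abel

/-- A dg vector space as a cochain complex. -/
def toCx : CochainCx k M where
  obj := V.deg
  d := fun _ => V.d
  d_mem := V.d_mem
  d_d := fun {_ x} _ => V.d_d x

end

end DGModule

namespace DGAlgebra

variable {k A : Type*} [Field k] [Ring A] [Algebra k A] (𝔸 : DGAlgebra k A)

theorem d_one : 𝔸.d 1 = 0 := by
  have h := 𝔸.leibniz 𝔸.one_mem 1
  simpa using h

theorem one_cocycle : (1 : A) ∈ 𝔸.toCx.cocycle 0 := ⟨𝔸.one_mem, 𝔸.d_one⟩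

/-- A dg algebra as a dg bimodule over itself. -/
def self : DGBimodule 𝔸 A where
  toDGModule := 𝔸.toDGModule
  smul_mem := 𝔸.mul_mem
  op_smul_mem := 𝔸.mul_mem
  leibniz_left := 𝔸.leibniz
  leibniz_right := 𝔸.leibniz

end DGAlgebra

/-- A pairing `M ⊗ N → P` of dg vector spaces which is a morphism of complexes. -/
structure IsDGPairing {k M N P : Type*} [Field k] [AddCommGroup M] [Module k M]
    [AddCommGroup N] [Module k N] [AddCommGroup P] [Module k P]
    (U : DGModule k M) (V : DGModule k N) (W : DGModule k P) (B : M →ₗ[k] N →ₗ[k] P) : Prop where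
  mem : ∀ {i j m n}, m ∈ U.deg i → n ∈ V.deg j → B m n ∈ W.deg (i + j)
  leibniz : ∀ {i m}, m ∈ U.deg i → ∀ n, W.d (B m n) = B (U.d m) n + (-1 : k) ^ i • B m (V.d n)

namespace IsDGPairing

variable {k M N P : Type*} [Field k] [AddCommGroup M] [Module k M]
    [AddCommGroup N] [Module k N] [AddCommGroup P] [Module k P]
    {U : DGModule k M} {V : DGModule k N} {W : DGModule k P} {B : M →ₗ[k] N →ₗ[k] P}

theorem d_apply (h : IsDGPairing U V W B) (m : M) (n : N) :
    W.d (B m n) = B (U.d m) n + B (U.koszul 1 m) (V.d n) := by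
  induction m using U.hom_induction with
  | h0 => simp
  | hom i m hm => rw [h.leibniz hm, U.koszul_of_mem 1 hm]; simp
  | add a b ha hb => simp only [map_add, LinearMap.add_apply, ha, hb]; abel

theorem koszul_apply (h : IsDGPairing U V W B) (s : ℤ) (m : M) (n : N) :
    W.koszul s (B m n) = B (U.koszul s m) (V.koszul s n) := by
  induction m using U.hom_induction with
  | h0 => simp
  | hom i m hm =>
    induction n using V.hom_induction with
    | h0 => simp
    | hom j n hn =>
      rw [W.koszul_of_mem s (h.mem hm hn), U.koszul_of_mem s hm, V.koszul_of_mem s hn]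
      simp only [map_smul, LinearMap.smul_apply, smul_smul, ← sgn_add]
      congr 2; ring
    | add a b ha hb => simp only [map_add, ha, hb]
  | add a b ha hb => simp only [map_add, LinearMap.add_apply, ha, hb]

theorem barSign_apply (h : IsDGPairing U V W B) (m : M) (n : N) :
    W.barSign 1 (B m n) = - B (U.barSign 1 m) (V.barSign 1 n) := by
  have := h.koszul_apply 1 m n
  simp only [DGModule.koszul_one, map_neg, LinearMap.neg_apply, neg_neg] at this
  rw [← this, neg_neg]

end IsDGPairing

section Pairings

variable {k A : Type*} [Field k] [Ring A] [Algebra k A] {𝔸 : DGAlgebra k A}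
  {M : Type*} [AddCommGroup M] [Module k M] [Module A M] [Module Aᵐᵒᵖ M]
  [SMulCommClass A Aᵐᵒᵖ M] [IsScalarTower k A M] [IsScalarTower k Aᵐᵒᵖ M]

/-- The left action `A ⊗ M → M`. -/
def leftAct (k A M : Type*) [Field k] [Ring A] [Algebra k A] [AddCommGroup M] [Module k M]
    [Module A M] [IsScalarTower k A M] : A →ₗ[k] M →ₗ[k] M :=
  LinearMap.mk₂ k (fun a m => a •> m) (fun _ _ _ => add_smul _ _ _)
    (fun _ _ _ => smul_assoc _ _ _) (fun _ _ _ => smul_add _ _ _)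
    (fun c a m => by
      rw [← algebraMap_smul A c m, ← algebraMap_smul A c (a •> m), smul_smul, smul_smul,
        Algebra.commutes])

/-- The right action `M ⊗ A → M`. -/
def rightAct (k A M : Type*) [Field k] [Ring A] [Algebra k A] [AddCommGroup M] [Module k M]
    [Module Aᵐᵒᵖ M] [IsScalarTower k Aᵐᵒᵖ M] : M →ₗ[k] A →ₗ[k] M :=
  LinearMap.mk₂ k (fun m a => m <• a) (fun _ _ _ => smul_add _ _ _)
    (fun c m a => by
      rw [← algebraMap_smul Aᵐᵒᵖ c m, ← algebraMap_smul Aᵐᵒᵖ c (m <• a), smul_smul, smul_smul,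
        Algebra.commutes])
    (fun m a b => by rw [MulOpposite.op_add, add_smul])
    (fun c m a => by rw [MulOpposite.op_smul, smul_assoc])

theorem DGBimodule.leftPairing (𝔐 : DGBimodule 𝔸 M) :
    IsDGPairing 𝔸.toDGModule 𝔐.toDGModule 𝔐.toDGModule (leftAct k A M) :=
  ⟨𝔐.smul_mem, 𝔐.leibniz_left⟩

theorem DGBimodule.rightPairing (𝔐 : DGBimodule 𝔸 M) :
    IsDGPairing 𝔐.toDGModule 𝔸.toDGModule 𝔐.toDGModule (rightAct k A M) :=
  ⟨𝔐.op_smul_mem, 𝔐.leibniz_right⟩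

theorem DGAlgebra.pairing (𝔸 : DGAlgebra k A) :
    IsDGPairing 𝔸.toDGModule 𝔸.toDGModule 𝔸.toDGModule (LinearMap.mul k A) :=
  ⟨𝔸.mul_mem, 𝔸.leibniz⟩

end Pairings

/-! ### Deconcatenation of words -/

/-- The sum of `F u v` over all ways to write the word `w` as a concatenation `u ++ v`. -/
def deconc {L P : Type*} [AddCommMonoid P] (F : List L → List L → P) (w : List L) : P :=
  ∑ i ∈ Finset.range (w.length + 1), F (w.take i) (w.drop i)

section Deconc

variable {L P Q : Type*} [AddCommGroup P] [AddCommGroup Q]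

@[simp] theorem deconc_nil (F : List L → List L → P) : deconc F [] = F [] [] := by
  simp [deconc]

theorem deconc_cons (F : List L → List L → P) (a : L) (w : List L) :
    deconc F (a :: w) = F [] (a :: w) + deconc (fun u v => F (a :: u) v) w := by
  rw [deconc, List.length_cons, Finset.sum_range_succ', add_comm]
  rfl

theorem deconc_add (F G : List L → List L → P) (w : List L) :
    deconc (fun u v => F u v + G u v) w = deconc F w + deconc G w :=
  Finset.sum_add_distrib

theorem deconc_map (φ : P →+ Q) (F : List L → List L → P) (w : List L) :
    deconc (fun u v => φ (F u v)) w = φ (deconc F w) :=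
  (map_sum φ _ _).symm

theorem deconc_zero (w : List L) : deconc (fun _ _ => (0 : P)) w = 0 :=
  Finset.sum_const_zero

theorem deconc_congr {F G : List L → List L → P} {w : List L}
    (h : ∀ u v, u ++ v = w → F u v = G u v) : deconc F w = deconc G w :=
  Finset.sum_congr rfl fun i _ => h _ _ (List.take_append_drop i w)

theorem deconc_mem {S : Type*} [SetLike S P] [AddSubmonoidClass S P] (K : S)
    {F : List L → List L → P} {w : List L}
    (h : ∀ u v, u ++ v = w → F u v ∈ K) : deconc F w ∈ K :=
  sum_mem fun i _ => h _ _ (List.take_append_drop i w)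

theorem deconc_assoc (G : List L → List L → List L → P) (w : List L) :
    deconc (fun u z => deconc (fun x y => G x y z) u) w =
      deconc (fun x v => deconc (fun y z => G x y z) v) w := by
  induction w generalizing G with
  | nil => simp
  | cons a w ih =>
    simp only [deconc_cons, deconc_nil, deconc_add, ih, add_assoc]

end Deconc

section Conv

variable {k L M N P : Type*} [Field k] [AddCommGroup M] [Module k M]
    [AddCommGroup N] [Module k N] [AddCommGroup P] [Module k P]

/-- The convolution of two functions on words, `w ↦ ∑_{w = uv} B (f u) (g v)`. -/
def conv (B : M →ₗ[k] N →ₗ[k] P) : (List L → M) →ₗ[k] (List L → N) →ₗ[k] (List L → P) :=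
  LinearMap.mk₂ k (fun f g w => deconc (fun u v => B (f u) (g v)) w)
    (fun f f' g => by ext w; simp [deconc, Finset.sum_add_distrib])
    (fun c f g => by ext w; simp [deconc, Finset.smul_sum])
    (fun f g g' => by ext w; simp [deconc, Finset.sum_add_distrib])
    (fun c f g => by ext w; simp [deconc, Finset.smul_sum])

theorem conv_apply (B : M →ₗ[k] N →ₗ[k] P) (f : List L → M) (g : List L → N) (w : List L) :
    conv B f g w = deconc (fun u v => B (f u) (g v)) w := rfl

@[simp] theorem conv_nil (B : M →ₗ[k] N →ₗ[k] P) (f : List L → M) (g : List L → N) :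
    conv B f g [] = B (f []) (g []) := by simp [conv_apply]

theorem conv_cons (B : M →ₗ[k] N →ₗ[k] P) (f : List L → M) (g : List L → N) (a : L)
    (w : List L) :
    conv B f g (a :: w) = B (f []) (g (a :: w)) + conv B (fun u => f (a :: u)) g w := by
  rw [conv_apply, deconc_cons]; rfl

theorem conv_assoc {R S T : Type*} [AddCommGroup R] [Module k R] [AddCommGroup S] [Module k S]
    [AddCommGroup T] [Module k T]
    {B₁ : M →ₗ[k] N →ₗ[k] R} {B₂ : R →ₗ[k] P →ₗ[k] T} {B₃ : N →ₗ[k] P →ₗ[k] S}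
    {B₄ : M →ₗ[k] S →ₗ[k] T} (h : ∀ m n p, B₂ (B₁ m n) p = B₄ m (B₃ n p))
    (f : List L → M) (g : List L → N) (j : List L → P) :
    conv B₂ (conv B₁ f g) j = conv B₄ f (conv B₃ g j) := by
  ext w
  have := deconc_assoc (fun x y z => B₂ (B₁ (f x) (g y)) (j z)) w
  simp only [conv_apply]
  calc _ = _ := ?_
    _ = _ := this
    _ = _ := ?_
  · refine deconc_congr fun u v _ => ?_
    rw [deconc, deconc, map_sum, LinearMap.sum_apply]
  · refine deconc_congr fun u v _ => ?_
    simp only [h]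
    rw [deconc, deconc, map_sum]

end Conv

/-! ### The Hochschild complex -/

set_option linter.unusedSectionVars false

section Hochschild

variable {k A : Type*} [Field k] [Ring A] [Algebra k A] (𝔸 : DGAlgebra k A)

/-- `f : List A → M` is a family of multilinear maps `A ^ n → M`, `n ≥ 0`, i.e. an element of
`∏_{n ≥ 0} Hom (A^{⊗ n}, M)`: its value on the word `[a₁, …, aₙ]` is linear in each letter. -/
structure IsMultilin (k : Type*) {A M : Type*} [Field k] [AddCommGroup A] [Module k A]
    [AddCommGroup M] [Module k M] (f : List A → M) : Prop where
  add : ∀ u a b v, f (u ++ (a + b) :: v) = f (u ++ a :: v) + f (u ++ b :: v)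
  smul : ∀ u (c : k) a v, f (u ++ (c • a) :: v) = c • f (u ++ a :: v)

section
variable {M : Type*} [AddCommGroup M] [Module k M]

/-- The Hochschild cochains of degree `p` with values in `M`: the families of multilinear maps
`f [a₁, …, aₙ]`, with `|f [a₁, …, aₙ]| = p + ∑ (|aᵢ| - 1)` for homogeneous `aᵢ`. -/
def hochObj (V : DGModule k M) (p : ℤ) : Submodule k (List A → M) where
  carrier := {f | IsMultilin k f ∧ ∀ w : List (Σ i, 𝔸.deg i),
    f (w.map fun x => (x.2 : A)) ∈ V.deg (p + (w.map fun x => x.1 - 1).sum)}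
  zero_mem' := ⟨⟨by simp, by simp⟩, by simp⟩
  add_mem' := fun {f g} hf hg => ⟨⟨fun u a b v => by
      simp only [Pi.add_apply, hf.1.add, hg.1.add]; abel,
      fun u c a v => by simp only [Pi.add_apply, hf.1.smul, hg.1.smul, smul_add]⟩,
    fun w => add_mem (hf.2 w) (hg.2 w)⟩
  smul_mem' := fun c f hf => ⟨⟨fun u a b v => by
      simp only [Pi.smul_apply, hf.1.add, smul_add],
      fun u c' a v => by simp only [Pi.smul_apply, hf.1.smul, smul_comm c c']⟩,
    fun w => Submodule.smul_mem _ c (hf.2 w)⟩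

/-- `f ∘ Q` for the differential `Q` of the bar construction,
`Q [a₁|…|aₙ] = -∑ₖ ± [a₁|…|d aₖ|…|aₙ] - ∑ₖ ± (-1)^(|aₖ|-1) [a₁|…|aₖ aₖ₊₁|…|aₙ]`
where `± = (-1) ^ (∑_{i<k} (|aᵢ| - 1))`; by recursion on the word. -/
def barQ (f : List A → M) : List A → M
  | [] => 0
  | a :: w => -f (𝔸.d a :: w)
      - (match w with
        | [] => 0
        | b :: v => f (𝔸.barSign 1 a * b :: v))
      + barQ (fun u => f (𝔸.barSign 1 a :: u)) w

/-- `f ∘ (σ^s ⊗ ⋯ ⊗ σ^s)`, i.e. `f` multiplied by `(-1) ^ (s * ∑ (|aᵢ| - 1))`. -/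
def twistBar (s : ℤ) (f : List A → M) : List A → M := fun w => f (w.map (𝔸.barSign s))

/-- The merging term of `barQ`. -/
def mergeHead (a : A) (f : List A → M) : List A → M
  | [] => 0
  | b :: v => f (𝔸.barSign 1 a * b :: v)

theorem barQ_nil (f : List A → M) : barQ 𝔸 f [] = 0 := rfl

theorem barQ_cons (f : List A → M) (a : A) (w : List A) :
    barQ 𝔸 f (a :: w) = -f (𝔸.d a :: w) - mergeHead 𝔸 a f w
      + barQ 𝔸 (fun u => f (𝔸.barSign 1 a :: u)) w := by
  cases w <;> rfl

theorem barQ_cons' (f : List A → M) (a : A) :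
    (fun w => barQ 𝔸 f (a :: w)) = -(fun w => f (𝔸.d a :: w)) - mergeHead 𝔸 a f
      + barQ 𝔸 (fun u => f (𝔸.barSign 1 a :: u)) :=
  funext fun w => barQ_cons 𝔸 f a w

theorem barQ_add (f g : List A → M) : barQ 𝔸 (f + g) = barQ 𝔸 f + barQ 𝔸 g := by
  ext w
  induction w generalizing f g with
  | nil => simp [barQ_nil]
  | cons a w ih =>
    have := ih (fun u => f (𝔸.barSign 1 a :: u)) (fun u => g (𝔸.barSign 1 a :: u))
    simp only [Pi.add_apply] at this ⊢
    rw [barQ_cons, barQ_cons, barQ_cons]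
    have e : (fun u => (f + g) (𝔸.barSign 1 a :: u)) =
      (fun u => f (𝔸.barSign 1 a :: u)) + (fun u => g (𝔸.barSign 1 a :: u)) := rfl
    rw [e, this]
    cases w <;> simp [mergeHead] <;> abel

theorem barQ_comp {N : Type*} [AddCommGroup N] [Module k N] (φ : M →ₗ[k] N) (f : List A → M) :
    barQ 𝔸 (fun w => φ (f w)) = fun w => φ (barQ 𝔸 f w) := by
  ext w
  induction w generalizing f with
  | nil => simp [barQ_nil]
  | cons a w ih =>
    rw [barQ_cons, barQ_cons, ih (fun u => f (𝔸.barSign 1 a :: u))]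
    cases w <;> simp [mergeHead]

theorem barQ_smul (c : k) (f : List A → M) : barQ 𝔸 (c • f) = c • barQ 𝔸 f :=
  barQ_comp 𝔸 (LinearMap.lsmul k M c) f

theorem barQ_neg (f : List A → M) : barQ 𝔸 (-f) = -barQ 𝔸 f := by
  have := barQ_smul 𝔸 (-1) f
  simpa using this

theorem barQ_sub (f g : List A → M) : barQ 𝔸 (f - g) = barQ 𝔸 f - barQ 𝔸 g := by
  rw [sub_eq_add_neg, barQ_add, barQ_neg, sub_eq_add_neg]

/-- `barQ` as a linear map. -/
def barQL : (List A → M) →ₗ[k] (List A → M) where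
  toFun := barQ 𝔸
  map_add' := barQ_add 𝔸
  map_smul' := barQ_smul 𝔸

/-- `twistBar` as a linear map. -/
def twistBarL (s : ℤ) : (List A → M) →ₗ[k] (List A → M) where
  toFun := twistBar 𝔸 s
  map_add' := fun _ _ => rfl
  map_smul' := fun _ _ => rfl

end

/-! Multilinearity and degrees. -/

section
variable {M : Type*} [AddCommGroup M] [Module k M]

theorem IsMultilin.cons {f : List A → M} (hf : IsMultilin k f) (a : A) :
    IsMultilin k (fun w => f (a :: w)) :=
  ⟨fun u => hf.add (a :: u), fun u => hf.smul (a :: u)⟩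

theorem IsMultilin.head_add {f : List A → M} (hf : IsMultilin k f) (a b : A) (w : List A) :
    f ((a + b) :: w) = f (a :: w) + f (b :: w) := hf.add [] a b w

theorem IsMultilin.head_smul {f : List A → M} (hf : IsMultilin k f) (c : k) (a : A)
    (w : List A) : f ((c • a) :: w) = c • f (a :: w) := hf.smul [] c a w

theorem IsMultilin.head_zero {f : List A → M} (hf : IsMultilin k f) (w : List A) :
    f (0 :: w) = 0 := by simpa using hf.head_smul 0 0 w

theorem IsMultilin.head_neg {f : List A → M} (hf : IsMultilin k f) (a : A) (w : List A) :
    f ((-a) :: w) = - f (a :: w) := by simpa using hf.head_smul (-1) a w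

theorem IsMultilin.of_cons {f : List A → M}
    (h1 : ∀ a b w, f ((a + b) :: w) = f (a :: w) + f (b :: w))
    (h2 : ∀ (c : k) a w, f ((c • a) :: w) = c • f (a :: w))
    (h3 : ∀ a, IsMultilin k (fun w => f (a :: w))) : IsMultilin k f :=
  ⟨fun u => match u with
    | [] => h1
    | a :: u => (h3 a).add u, fun u => match u with
    | [] => h2
    | a :: u => (h3 a).smul u⟩

theorem IsMultilin.add' {f g : List A → M} (hf : IsMultilin k f) (hg : IsMultilin k g) :
    IsMultilin k (f + g) :=
  ⟨fun u a b v => by simp only [Pi.add_apply, hf.add, hg.add]; abel,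
      fun u c a v => by simp only [Pi.add_apply, hf.smul, hg.smul, smul_add]⟩

theorem IsMultilin.smul' {f : List A → M} (c : k) (hf : IsMultilin k f) :
    IsMultilin k (c • f) :=
  ⟨fun u a b v => by simp only [Pi.smul_apply, hf.add, smul_add],
      fun u c' a v => by simp only [Pi.smul_apply, hf.smul, smul_comm c c']⟩

theorem IsMultilin.neg' {f : List A → M} (hf : IsMultilin k f) : IsMultilin k (-f) := by
  simpa using hf.smul' (-1)

theorem IsMultilin.sub' {f g : List A → M} (hf : IsMultilin k f) (hg : IsMultilin k g) :
    IsMultilin k (f - g) := by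
  rw [sub_eq_add_neg]; exact hf.add' hg.neg'

theorem IsMultilin.comp {N : Type*} [AddCommGroup N] [Module k N] (φ : M →ₗ[k] N)
    {f : List A → M} (hf : IsMultilin k f) : IsMultilin k (fun w => φ (f w)) :=
  ⟨fun u a b v => by rw [hf.add, map_add], fun u c a v => by rw [hf.smul, map_smul]⟩

theorem IsMultilin.twistBar {f : List A → M} (s : ℤ) (hf : IsMultilin k f) :
    IsMultilin k (twistBar 𝔸 s f) :=
  ⟨fun u a b v => by simp [ChenHoch.twistBar, hf.add],
    fun u c a v => by simp [ChenHoch.twistBar, hf.smul]⟩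

theorem IsMultilin.mergeHead {f : List A → M} (hf : IsMultilin k f) (a : A) :
    IsMultilin k (mergeHead 𝔸 a f) :=
  .of_cons (fun b b' w => by simp only [ChenHoch.mergeHead, mul_add, hf.head_add])
    (fun c b w => by simp only [ChenHoch.mergeHead, mul_smul_comm, hf.head_smul])
    (fun b => hf.cons _)

theorem mergeHead_add (a b : A) {f : List A → M} (hf : IsMultilin k f) :
    mergeHead 𝔸 (a + b) f = mergeHead 𝔸 a f + mergeHead 𝔸 b f := by
  ext w
  cases w <;> simp [mergeHead, add_mul, hf.head_add]

theorem mergeHead_smul (c : k) (a : A) {f : List A → M} (hf : IsMultilin k f) :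
    mergeHead 𝔸 (c • a) f = c • mergeHead 𝔸 a f := by
  ext w
  cases w <;> simp [mergeHead, hf.head_smul]

theorem cons_add {f : List A → M} (hf : IsMultilin k f) (a b : A) :
    (fun u => f ((a + b) :: u)) = (fun u => f (a :: u)) + (fun u => f (b :: u)) :=
  funext fun u => hf.head_add a b u

theorem cons_smul {f : List A → M} (hf : IsMultilin k f) (c : k) (a : A) :
    (fun u => f ((c • a) :: u)) = c • (fun u => f (a :: u)) :=
  funext fun u => hf.head_smul c a u

theorem IsMultilin.barQ {f : List A → M} (hf : IsMultilin k f) :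
    IsMultilin k (ChenHoch.barQ 𝔸 f) := by
  have key : ∀ (u : List A) (f : List A → M), IsMultilin k f →
      (∀ a b v, ChenHoch.barQ 𝔸 f (u ++ (a + b) :: v) =
        ChenHoch.barQ 𝔸 f (u ++ a :: v) + ChenHoch.barQ 𝔸 f (u ++ b :: v)) ∧
      (∀ (c : k) a v, ChenHoch.barQ 𝔸 f (u ++ (c • a) :: v) =
        c • ChenHoch.barQ 𝔸 f (u ++ a :: v)) := by
    intro u
    induction u with
    | nil =>
      intro f hf
      refine ⟨fun a b v => ?_, fun c a v => ?_⟩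
      · simp only [List.nil_append, barQ_cons, map_add]
        rw [cons_add hf, barQ_add, Pi.add_apply, hf.head_add, mergeHead_add 𝔸 a b hf,
          Pi.add_apply]
        abel
      · simp only [List.nil_append, barQ_cons, map_smul]
        rw [cons_smul hf, barQ_smul, Pi.smul_apply, hf.head_smul, mergeHead_smul 𝔸 c a hf,
          Pi.smul_apply, smul_add, smul_sub, smul_neg]
    | cons x u ih =>
      intro f hf
      obtain ⟨i1, i2⟩ := ih _ (hf.cons (𝔸.barSign 1 x))
      refine ⟨fun a b v => ?_, fun c a v => ?_⟩
      · simp only [List.cons_append, barQ_cons, i1, (hf.mergeHead 𝔸 x).add,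
          (hf.cons (𝔸.d x)).add]
        abel
      · simp only [List.cons_append, barQ_cons, i2, (hf.mergeHead 𝔸 x).smul,
          (hf.cons (𝔸.d x)).smul, smul_add, smul_sub, smul_neg]
  exact ⟨fun u => (key u f hf).1, fun u => (key u f hf).2⟩

theorem barSign_mul (a b : A) :
    𝔸.barSign 1 (a * b) = -(𝔸.barSign 1 a * 𝔸.barSign 1 b) :=
  𝔸.pairing.barSign_apply a b

theorem barSign_d (a : A) : 𝔸.barSign 1 (𝔸.d a) = - 𝔸.d (𝔸.barSign 1 a) := by
  simpa using 𝔸.d_barSign 1 a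

theorem barSign_barSign_one (a : A) : 𝔸.barSign 1 (𝔸.barSign 1 a) = a := by
  rw [𝔸.barSign_barSign, 𝔸.barSign_congr (t := 0) (by decide), 𝔸.barSign_zero]

theorem d_mul' (a b : A) : 𝔸.d (a * b) = 𝔸.d a * b - 𝔸.barSign 1 a * 𝔸.d b := by
  have := 𝔸.pairing.d_apply a b
  simp only [LinearMap.mul_apply', DGModule.koszul_one, neg_mul] at this
  rw [this, sub_eq_add_neg]

/-- The differential of the bar construction squares to zero. -/
theorem barQ_barQ {f : List A → M} (hf : IsMultilin k f) : barQ 𝔸 (barQ 𝔸 f) = 0 := by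
  ext w
  induction w generalizing f with
  | nil => rfl
  | cons a w ih =>
    have ih' := ih (f := fun u => f (a :: u)) (hf.cons a)
    rw [barQ_cons, barQ_cons 𝔸 f, barQ_cons' 𝔸 f, barQ_add, barQ_sub, barQ_neg]
    simp only [barSign_barSign_one, Pi.add_apply, Pi.sub_apply, Pi.neg_apply, 𝔸.d_d,
      hf.head_zero, ih', barSign_d]
    have e : (fun u => f (-(𝔸.d (𝔸.barSign 1 a)) :: u)) =
        -(fun u => f (𝔸.d (𝔸.barSign 1 a) :: u)) := funext fun u => hf.head_neg _ u
    rw [e, barQ_neg]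
    cases w with
    | nil => simp [mergeHead, barQ_nil]
    | cons b v =>
      simp only [mergeHead, barQ_cons, barSign_mul, barSign_d, barSign_barSign_one, d_mul',
        Pi.neg_apply, Pi.zero_apply]
      have e1 : (fun u => f (-(a * 𝔸.barSign 1 b) :: u)) =
        -(fun u => f (a * 𝔸.barSign 1 b :: u)) := funext fun u => hf.head_neg _ u
      have e2 := hf.head_add (𝔸.d (𝔸.barSign 1 a) * b) (-(a * 𝔸.d b)) v
      rw [hf.head_neg, ← sub_eq_add_neg] at e2
      have e3 : f (-𝔸.d (𝔸.barSign 1 a) * b :: v) = - f (𝔸.d (𝔸.barSign 1 a) * b :: v) := by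
        rw [neg_mul, hf.head_neg]
      rw [e1, barQ_neg, e2, e3]
      cases v with
      | nil => simp; abel
      | cons c v =>
        have e4 : f (-(a * 𝔸.barSign 1 b) * c :: v) = - f (a * (𝔸.barSign 1 b * c) :: v) := by
          rw [neg_mul, hf.head_neg, mul_assoc]
        simp only [e4, Pi.neg_apply]
        abel

theorem barQ_twist (s : ℤ) {f : List A → M} (hf : IsMultilin k f) :
    twistBar 𝔸 s (barQ 𝔸 f) = (-1 : k) ^ s • barQ 𝔸 (twistBar 𝔸 s f) := by
  have hmul : ∀ a b : A, 𝔸.barSign s (𝔸.barSign 1 a * b) =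
      (-1 : k) ^ s • (𝔸.barSign 1 (𝔸.barSign s a) * 𝔸.barSign s b) := by
    intro a b
    induction a using 𝔸.hom_induction with
    | h0 => simp
    | hom i a ha =>
      induction b using 𝔸.hom_induction with
      | h0 => simp
      | hom j b hb =>
        have h1 := 𝔸.mul_mem (𝔸.barSign_mem 1 ha) hb
        rw [𝔸.barSign_of_mem s h1, 𝔸.barSign_of_mem s ha, 𝔸.barSign_of_mem s hb, map_smul]
        simp only [smul_mul_assoc, mul_smul_comm, smul_smul, ← sgn_add]
        congr 1
        exact sgn_congr k ⟨0, by ring⟩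
      | add x y hx hy => simp only [mul_add, map_add, hx, hy, smul_add]
    | add x y hx hy => simp only [add_mul, map_add, hx, hy, smul_add]
  have hcomm : ∀ a, 𝔸.barSign s (𝔸.barSign 1 a) = 𝔸.barSign 1 (𝔸.barSign s a) := by
    intro a; rw [𝔸.barSign_barSign, 𝔸.barSign_barSign, add_comm]
  ext w
  induction w generalizing f with
  | nil => simp [twistBar, barQ_nil]
  | cons a w ih =>
    have ih' := ih (f := fun u => f (𝔸.barSign s (𝔸.barSign 1 a) :: u)) (hf.cons _)
    simp only [twistBar, Pi.smul_apply, List.map_cons, barQ_cons, 𝔸.d_barSign, hf.head_smul]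
      at ih' ⊢
    rw [← hcomm, ih']
    have e : (-1 : k) ^ s • (-1 : k) ^ s • f (𝔸.d (𝔸.barSign s a) :: w.map (𝔸.barSign s))
        = f (𝔸.d (𝔸.barSign s a) :: w.map (𝔸.barSign s)) := by
      rw [smul_smul, sgn_mul_self, one_smul]
    cases w with
    | nil =>
      simp only [mergeHead, List.map_nil, smul_add, smul_sub, smul_neg, smul_zero] at e ⊢
      rw [e]
      rfl
    | cons b v =>
      have e' : (-1 : k) ^ s • twistBar 𝔸 s f (𝔸.barSign 1 a * b :: v) =
          f (𝔸.barSign 1 (𝔸.barSign s a) * 𝔸.barSign s b :: v.map (𝔸.barSign s)) := by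
        simp only [twistBar, List.map_cons, hmul, hf.head_smul, smul_smul, sgn_mul_self, one_smul]
      simp only [mergeHead, List.map_cons, smul_add, smul_sub, smul_neg] at e ⊢
      rw [e]
      change _ = -_ - (-1 : k) ^ s • twistBar 𝔸 s f (𝔸.barSign 1 a * b :: v) + _
      rw [e']
      rfl

theorem twist_twist (s t : ℤ) (f : List A → M) :
    twistBar 𝔸 s (twistBar 𝔸 t f) = twistBar 𝔸 (t + s) f := by
  ext w
  simp only [twistBar, List.map_map]
  congr 2
  funext a
  exact 𝔸.barSign_barSign t s a

theorem twist_congr {s t : ℤ} (h : Even (s - t)) (f : List A → M) :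
    twistBar 𝔸 s f = twistBar 𝔸 t f := by
  ext w
  simp only [twistBar, 𝔸.barSign_congr h]

theorem twist_zero (f : List A → M) : twistBar 𝔸 0 f = f := by
  ext w
  have : (𝔸.barSign 0 : A → A) = id := funext 𝔸.barSign_zero
  simp [twistBar, this]

/-- Two multilinear families which agree on words of homogeneous letters are equal. -/
theorem IsMultilin.ext {f g : List A → M} (hf : IsMultilin k f) (hg : IsMultilin k g)
    (h : ∀ w : List (Σ i, 𝔸.deg i),
      f (w.map fun x => (x.2 : A)) = g (w.map fun x => (x.2 : A))) : f = g := by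
  ext w
  induction w generalizing f g with
  | nil => exact h []
  | cons a w ih =>
    induction a using 𝔸.hom_induction with
    | h0 => rw [hf.head_zero, hg.head_zero]
    | hom i a ha => exact ih (hf.cons a) (hg.cons a) fun w => h (⟨i, a, ha⟩ :: w)
    | add a b ha hb => rw [hf.head_add, hg.head_add, ha, hb]

/-- On a cochain of degree `p`, the total sign operator is multiplication by `(-1) ^ p`. -/
theorem koszul_hoch {V : DGModule k M} {p : ℤ} {f : List A → M} (hf : f ∈ hochObj 𝔸 V p)
    (w : List A) : V.koszul 1 (f w) = (-1 : k) ^ p • twistBar 𝔸 1 f w := by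
  refine congrFun (IsMultilin.ext 𝔸 (f := fun w => V.koszul 1 (f w))
    (g := (-1 : k) ^ p • twistBar 𝔸 1 f) (hf.1.comp _) ((hf.1.twistBar 𝔸 1).smul' _) ?_) w
  intro w
  rw [V.koszul_of_mem 1 (hf.2 w), one_mul, sgn_add, mul_smul]
  simp only [Pi.smul_apply, twistBar]
  have key : ∀ (w : List (Σ i, 𝔸.deg i)) (f : List A → M), IsMultilin k f →
      (-1 : k) ^ (w.map fun x => x.1 - 1).sum • f (w.map fun x => (x.2 : A)) =
        f ((w.map fun x => (x.2 : A)).map (𝔸.barSign 1)) := by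
    intro w
    induction w with
    | nil => intro f _; simp
    | cons x w ih =>
      intro f hf
      simp only [List.map_cons, List.sum_cons]
      rw [𝔸.barSign_of_mem 1 x.2.2, hf.head_smul, sgn_add, mul_smul, one_mul]
      exact congrArg _ (ih _ (hf.cons _))
  rw [key _ f hf.1]

end

/-! The convolution of cochains. -/

section
variable {M N P : Type*} [AddCommGroup M] [Module k M] [AddCommGroup N] [Module k N]
  [AddCommGroup P] [Module k P]

theorem IsMultilin.conv (B : M →ₗ[k] N →ₗ[k] P) {f : List A → M} {g : List A → N}
    (hf : IsMultilin k f) (hg : IsMultilin k g) : IsMultilin k (ChenHoch.conv B f g) := by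
  have key : ∀ (u : List A) (f : List A → M), IsMultilin k f →
      (∀ a b v, ChenHoch.conv B f g (u ++ (a + b) :: v) =
        ChenHoch.conv B f g (u ++ a :: v) + ChenHoch.conv B f g (u ++ b :: v)) ∧
      (∀ (c : k) a v, ChenHoch.conv B f g (u ++ (c • a) :: v) =
        c • ChenHoch.conv B f g (u ++ a :: v)) := by
    intro u
    induction u with
    | nil =>
      intro f hf
      refine ⟨fun a b v => ?_, fun c a v => ?_⟩
      · simp only [List.nil_append, conv_cons]
        rw [cons_add hf, map_add, LinearMap.add_apply, Pi.add_apply, hg.head_add, map_add]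
        abel
      · simp only [List.nil_append, conv_cons]
        rw [cons_smul hf, map_smul, LinearMap.smul_apply, Pi.smul_apply, hg.head_smul, map_smul,
          smul_add]
    | cons x u ih =>
      intro f hf
      obtain ⟨i1, i2⟩ := ih _ (hf.cons x)
      refine ⟨fun a b v => ?_, fun c a v => ?_⟩
      · simp only [List.cons_append, conv_cons, i1]
        have := hg.add (x :: u) a b v
        simp only [List.cons_append] at this
        rw [this, map_add]
        abel
      · simp only [List.cons_append, conv_cons, i2]
        have := hg.smul (x :: u) c a v
        simp only [List.cons_append] at this
        rw [this, map_smul, smul_add]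
  exact ⟨fun u => (key u f hf).1, fun u => (key u f hf).2⟩

theorem barQ_conv (B : M →ₗ[k] N →ₗ[k] P) (f : List A → M) (g : List A → N) :
    barQ 𝔸 (conv B f g) = conv B (barQ 𝔸 f) g + conv B (twistBar 𝔸 1 f) (barQ 𝔸 g) := by
  ext w
  induction w generalizing f with
  | nil => simp [barQ_nil]
  | cons a w ih =>
    have ih' := ih (fun u => f (𝔸.barSign 1 a :: u))
    have e1 : (fun u => conv B f g (𝔸.barSign 1 a :: u)) =
        (fun u => B (f []) (g (𝔸.barSign 1 a :: u))) +
          conv B (fun u => f (𝔸.barSign 1 a :: u)) g := funext fun u => conv_cons ..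
    have e2 : mergeHead 𝔸 a (conv B f g) w = B (f []) (mergeHead 𝔸 a g w) +
        conv B (mergeHead 𝔸 a f) g w := by
      cases w with
      | nil => simp [mergeHead]
      | cons b v =>
        simp only [mergeHead, conv_cons, map_zero, LinearMap.zero_apply, zero_add]
    have e3 : (fun u => twistBar 𝔸 1 f (a :: u)) =
        twistBar 𝔸 1 (fun u => f (𝔸.barSign 1 a :: u)) := rfl
    have e4 : twistBar 𝔸 1 f [] = f [] := rfl
    rw [barQ_cons, e1, barQ_add, barQ_comp, Pi.add_apply, ih', e2, Pi.add_apply, conv_cons,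
      Pi.add_apply, conv_cons, conv_cons, e3, e4, barQ_cons' 𝔸 f, barQ_cons 𝔸 g, barQ_nil]
    simp only [map_add, map_sub, map_neg, LinearMap.add_apply, LinearMap.sub_apply,
      LinearMap.neg_apply, Pi.add_apply, Pi.sub_apply, Pi.neg_apply, map_zero,
      LinearMap.zero_apply]
    abel

theorem twist_conv (B : M →ₗ[k] N →ₗ[k] P) (s : ℤ) (f : List A → M) (g : List A → N) :
    twistBar 𝔸 s (conv B f g) = conv B (twistBar 𝔸 s f) (twistBar 𝔸 s g) := by
  ext w
  induction w generalizing f with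
  | nil => simp [twistBar]
  | cons a w ih =>
    have ih' := ih (fun u => f (𝔸.barSign s a :: u))
    simp only [twistBar, List.map_cons, conv_cons] at ih' ⊢
    rw [ih']
    rfl

theorem conv_hoch_mem {U : DGModule k M} {V : DGModule k N} {W : DGModule k P}
    {B : M →ₗ[k] N →ₗ[k] P} (hB : IsDGPairing U V W B) {p q : ℤ} {f : List A → M}
    {g : List A → N} (hf : f ∈ hochObj 𝔸 U p) (hg : g ∈ hochObj 𝔸 V q) :
    conv B f g ∈ hochObj 𝔸 W (p + q) := by
  refine ⟨hf.1.conv B hg.1, fun w => ?_⟩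
  rw [conv_apply]
  refine deconc_mem _ fun u v h => ?_
  obtain ⟨w₁, w₂, rfl, rfl, rfl⟩ := List.map_eq_append_iff.1 h.symm
  have := hB.mem (hf.2 w₁) (hg.2 w₂)
  rw [List.map_append, List.sum_append]
  convert this using 2
  ring

theorem twist_hoch_mem {U : DGModule k M} {p : ℤ} {f : List A → M} (s : ℤ)
    (hf : f ∈ hochObj 𝔸 U p) : twistBar 𝔸 s f ∈ hochObj 𝔸 U p := by
  refine ⟨hf.1.twistBar 𝔸 s, fun w => ?_⟩
  have := hf.2 (w.map fun x => ⟨x.1, ⟨𝔸.barSign s x.2, 𝔸.barSign_mem s x.2.2⟩⟩)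
  simpa [twistBar, Function.comp_def] using this

theorem barQ_hoch_mem {U : DGModule k M} {p : ℤ} {f : List A → M}
    (hf : f ∈ hochObj 𝔸 U p) : barQ 𝔸 f ∈ hochObj 𝔸 U (p + 1) := by
  refine ⟨hf.1.barQ 𝔸, fun w => ?_⟩
  have hf2 := hf.2
  clear hf
  induction w generalizing f p with
  | nil => simp [barQ_nil]
  | cons x w ih =>
    obtain ⟨i, a⟩ := x
    simp only [List.map_cons, barQ_cons, List.sum_cons]
    refine add_mem (sub_mem (neg_mem ?_) ?_) ?_
    · have := hf2 (⟨i + 1, ⟨𝔸.d a, 𝔸.d_mem a.2⟩⟩ :: w)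
      simp only [List.map_cons, List.sum_cons] at this
      convert this using 2
      ring
    · cases w with
      | nil => simp [mergeHead]
      | cons y w =>
        obtain ⟨j, b⟩ := y
        have := hf2 (⟨i + j, ⟨𝔸.barSign 1 a * b,
          𝔸.mul_mem (𝔸.barSign_mem 1 a.2) b.2⟩⟩ :: w)
        simp only [List.map_cons, List.sum_cons] at this
        simp only [mergeHead, List.map_cons, List.sum_cons]
        convert this using 2
        ring
    · have := ih (f := fun u => f (𝔸.barSign 1 a :: u)) (p := p + (i - 1)) (fun w => by
        have := hf2 (⟨i, ⟨𝔸.barSign 1 a, 𝔸.barSign_mem 1 a.2⟩⟩ :: w)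
        simp only [List.map_cons, List.sum_cons] at this
        convert this using 2
        ring)
      convert this using 2
      ring

/-- The internal differential `D f = d ∘ f - (-1) ^ p f ∘ Q` of a degree `p` cochain. -/
def hochD0 (V : DGModule k M) (p : ℤ) : (List A → M) →ₗ[k] (List A → M) :=
  V.d.compLeft (List A) - (-1 : k) ^ p • barQL 𝔸

theorem hochD0_eq (V : DGModule k M) (p : ℤ) (f : List A → M) :
    hochD0 𝔸 V p f = (fun w => V.d (f w)) - (-1 : k) ^ p • barQ 𝔸 f := rfl

theorem hochD0_mem {V : DGModule k M} {p : ℤ} {f : List A → M} (hf : f ∈ hochObj 𝔸 V p) :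
    hochD0 𝔸 V p f ∈ hochObj 𝔸 V (p + 1) := by
  rw [hochD0_eq]
  refine sub_mem ⟨hf.1.comp _, fun w => ?_⟩ (Submodule.smul_mem _ _ (barQ_hoch_mem 𝔸 hf))
  have := V.d_mem (hf.2 w)
  convert this using 2
  ring

theorem hochD0_hochD0 {V : DGModule k M} {p : ℤ} {f : List A → M} (hf : f ∈ hochObj 𝔸 V p) :
    hochD0 𝔸 V (p + 1) (hochD0 𝔸 V p f) = 0 := by
  rw [hochD0_eq, hochD0_eq, barQ_sub, barQ_smul, barQ_barQ 𝔸 hf.1, barQ_comp 𝔸 V.d, sgn_succ]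
  ext w
  simp [V.d_d]

theorem hochD0_conv {U : DGModule k M} {V : DGModule k N} {W : DGModule k P}
    {B : M →ₗ[k] N →ₗ[k] P} (hB : IsDGPairing U V W B) {p q : ℤ} {f : List A → M}
    {g : List A → N} (hf : f ∈ hochObj 𝔸 U p) :
    hochD0 𝔸 W (p + q) (conv B (twistBar 𝔸 q f) g) =
      conv B (twistBar 𝔸 q (hochD0 𝔸 U p f)) g +
        (-1 : k) ^ p • conv B (twistBar 𝔸 (q + 1) f) (hochD0 𝔸 V q g) := by
  have h1 : (fun w => W.d (conv B (twistBar 𝔸 q f) g w)) =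
      conv B (fun w => U.d (twistBar 𝔸 q f w)) g +
        (-1 : k) ^ p • conv B (twistBar 𝔸 (q + 1) f) (fun w => V.d (g w)) := by
    ext w
    rw [conv_apply, Pi.add_apply, Pi.smul_apply, conv_apply, conv_apply]
    simp only [deconc, map_sum, Finset.smul_sum, ← Finset.sum_add_distrib]
    refine Finset.sum_congr rfl fun i _ => ?_
    rw [hB.d_apply, koszul_hoch 𝔸 (twist_hoch_mem 𝔸 q hf), twist_twist, map_smul,
      LinearMap.smul_apply]
  have h2 : twistBar 𝔸 q (hochD0 𝔸 U p f) = (fun w => U.d (twistBar 𝔸 q f w)) -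
      (-1 : k) ^ p • ((-1 : k) ^ q • barQ 𝔸 (twistBar 𝔸 q f)) := by
    rw [← barQ_twist 𝔸 q hf.1]
    rfl
  rw [h2, hochD0_eq, hochD0_eq, h1, barQ_conv, twist_twist]
  simp only [map_sub, map_smul, LinearMap.sub_apply, LinearMap.smul_apply, smul_sub, smul_add,
    smul_smul, sgn_add k p q]
  abel

end

/-- The universal twisting cochain `[a] ↦ a`, i.e. the identity of `A` as a degree one cochain. -/
def tau (A : Type*) [Ring A] : List A → A
  | [a] => a
  | _ => 0

theorem tau_mem : tau A ∈ hochObj 𝔸 𝔸.toDGModule 1 := by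
  refine ⟨.of_cons (fun a b w => ?_) (fun c a w => ?_) (fun a => ⟨fun u b c v => ?_,
    fun u b c v => ?_⟩), fun w => ?_⟩
  · cases w <;> simp [tau]
  · cases w <;> simp [tau]
  · cases u <;> simp [tau]
  · cases u <;> simp [tau]
  · match w with
    | [] => simp [tau]
    | [x] => simp [tau]
    | _ :: _ :: _ => simp [tau]

theorem tau_maurerCartan :
    hochD0 𝔸 𝔸.toDGModule 1 (tau A) +
      conv (LinearMap.mul k A) (twistBar 𝔸 1 (tau A)) (tau A) = 0 := by
  have hq : ∀ w : List A, barQ 𝔸 (fun _ => (0 : A)) w = 0 := by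
    intro w
    have := barQ_smul 𝔸 (0 : k) (0 : List A → A)
    rw [zero_smul, zero_smul] at this
    exact congrFun this w
  ext w
  rw [hochD0_eq]
  match w with
  | [] => simp [barQ_nil, tau]
  | [a] => simp [barQ_cons, barQ_nil, tau, mergeHead, conv_cons, twistBar]
  | [a, b] => simp [barQ_cons, barQ_nil, tau, mergeHead, conv_cons, twistBar]
  | a :: b :: c :: w =>
    have h3 : ∀ u : List A, conv (LinearMap.mul k A)
        (fun u => twistBar 𝔸 1 (tau A) (a :: b :: u)) (tau A) u = 0 := by
      intro u
      have : (fun u => twistBar 𝔸 1 (tau A) (a :: b :: u)) = 0 := by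
        ext u; simp [twistBar, tau]
      rw [this]; simp
    have h4 : barQ 𝔸 (fun u => tau A (𝔸.barSign 1 a :: 𝔸.barSign 1 b :: u)) (c :: w) = 0 := by
      have : (fun u => tau A (𝔸.barSign 1 a :: 𝔸.barSign 1 b :: u)) = fun _ => 0 := by
        ext u; simp [tau]
      rw [this]; exact hq _
    simp only [Pi.add_apply, Pi.sub_apply, Pi.smul_apply, conv_cons, h3, barQ_cons 𝔸 _ a,
      barQ_cons 𝔸 _ b, h4]
    simp [tau, mergeHead, twistBar]

section
variable {M : Type*} [AddCommGroup M] [Module k M] [Module A M] [Module Aᵐᵒᵖ M]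
  [SMulCommClass A Aᵐᵒᵖ M] [IsScalarTower k A M] [IsScalarTower k Aᵐᵒᵖ M]

/-- The cup product `τ ∪ f` for `f` of degree `p`:
`[a₁, …, aₙ] ↦ (-1) ^ (p * (|a₁| - 1)) a₁ • f [a₂, …, aₙ]`. -/
def tauCup (M : Type*) [AddCommGroup M] [Module k M] [Module A M] [IsScalarTower k A M] (p : ℤ) :
    (List A → M) →ₗ[k] (List A → M) :=
  conv (leftAct k A M) (twistBar 𝔸 p (tau A))

/-- The cup product `f ∪ τ`:
`[a₁, …, aₙ] ↦ (-1) ^ (|a₁| - 1 + ⋯ + |aₙ₋₁| - 1) f [a₁, …, aₙ₋₁] • aₙ`. -/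
def cupTau (M : Type*) [AddCommGroup M] [Module k M] [Module Aᵐᵒᵖ M] [IsScalarTower k Aᵐᵒᵖ M] :
    (List A → M) →ₗ[k] (List A → M) :=
  (conv (rightAct k A M)).flip (tau A) ∘ₗ twistBarL 𝔸 1

/-- The Hochschild differential on cochains of degree `p`,
`δ f = d ∘ f - (-1) ^ p f ∘ Q + τ ∪ f - (-1) ^ p f ∪ τ`. -/
def hochDiff (V : DGModule k M) (p : ℤ) : (List A → M) →ₗ[k] (List A → M) :=
  hochD0 𝔸 V p + tauCup 𝔸 M p - (-1 : k) ^ p • cupTau 𝔸 M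

theorem hochDiff_eq (V : DGModule k M) (p : ℤ) (f : List A → M) :
    hochDiff 𝔸 V p f = hochD0 𝔸 V p f + conv (leftAct k A M) (twistBar 𝔸 p (tau A)) f -
      (-1 : k) ^ p • conv (rightAct k A M) (twistBar 𝔸 1 f) (tau A) := rfl

variable {𝔸} in
theorem hochDiff_mem (𝔐 : DGBimodule 𝔸 M) {p : ℤ} {f : List A → M}
    (hf : f ∈ hochObj 𝔸 𝔐.toDGModule p) :
    hochDiff 𝔸 𝔐.toDGModule p f ∈ hochObj 𝔸 𝔐.toDGModule (p + 1) := by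
  rw [hochDiff_eq]
  refine sub_mem (add_mem (hochD0_mem 𝔸 hf) ?_) (Submodule.smul_mem _ _ ?_)
  · rw [add_comm]
    exact conv_hoch_mem 𝔸 𝔐.leftPairing (twist_hoch_mem 𝔸 p (tau_mem 𝔸)) hf
  · exact conv_hoch_mem 𝔸 𝔐.rightPairing (twist_hoch_mem 𝔸 1 hf) (tau_mem 𝔸)

variable {𝔸} in
theorem hochDiff_hochDiff (𝔐 : DGBimodule 𝔸 M) {p : ℤ} {f : List A → M}
    (hf : f ∈ hochObj 𝔸 𝔐.toDGModule p) :
    hochDiff 𝔸 𝔐.toDGModule (p + 1) (hochDiff 𝔸 𝔐.toDGModule p f) = 0 := by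
  have hmc : hochD0 𝔸 𝔸.toDGModule 1 (tau A) =
      - conv (LinearMap.mul k A) (twistBar 𝔸 1 (tau A)) (tau A) :=
    eq_neg_of_add_eq_zero_left (tau_maurerCartan 𝔸)
  have tneg : ∀ (s : ℤ) (g : List A → A), twistBar 𝔸 s (-g) = - twistBar 𝔸 s g :=
    fun _ _ => rfl
  -- `D` of `τ ∪ f` and of `f ∪ τ`
  have h1 := hochD0_conv 𝔸 𝔐.leftPairing (q := p) (g := f) (tau_mem 𝔸)
  have h2 := hochD0_conv 𝔸 𝔐.rightPairing (q := 1) (g := tau A) hf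
  rw [hmc, tneg, twist_conv, twist_twist, map_neg, LinearMap.neg_apply] at h1
  rw [hmc, twist_congr 𝔸 (s := 1 + 1) (t := 0) (by decide), twist_zero, map_neg] at h2
  rw [add_comm 1 p] at h1
  -- associativity
  have a1 := conv_assoc (k := k) (B₁ := LinearMap.mul k A) (B₂ := leftAct k A M)
    (B₃ := leftAct k A M) (B₄ := leftAct k A M) (fun a b m => mul_smul a b m)
    (twistBar 𝔸 (p + 1) (tau A)) (twistBar 𝔸 p (tau A)) f
  have a2 := conv_assoc (k := k) (B₁ := leftAct k A M) (B₂ := rightAct k A M)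
    (B₃ := rightAct k A M) (B₄ := leftAct k A M)
    (fun a m b => (smul_comm a (MulOpposite.op b) m).symm)
    (twistBar 𝔸 (p + 1) (tau A)) (twistBar 𝔸 1 f) (tau A)
  have a3 := conv_assoc (k := k) (B₁ := rightAct k A M) (B₂ := rightAct k A M)
    (B₃ := LinearMap.mul k A) (B₄ := rightAct k A M)
    (fun m a b => (mul_smul (MulOpposite.op b) (MulOpposite.op a) m).symm)
    f (twistBar 𝔸 1 (tau A)) (tau A)
  have t1 : twistBar 𝔸 1 (hochDiff 𝔸 𝔐.toDGModule p f) =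
      twistBar 𝔸 1 (hochD0 𝔸 𝔐.toDGModule p f) +
        conv (leftAct k A M) (twistBar 𝔸 (p + 1) (tau A)) (twistBar 𝔸 1 f) -
        (-1 : k) ^ p • conv (rightAct k A M) f (twistBar 𝔸 1 (tau A)) := by
    have e : twistBar 𝔸 1 (hochDiff 𝔸 𝔐.toDGModule p f) =
      twistBar 𝔸 1 (hochD0 𝔸 𝔐.toDGModule p f) +
        twistBar 𝔸 1 (conv (leftAct k A M) (twistBar 𝔸 p (tau A)) f) -
        (-1 : k) ^ p • twistBar 𝔸 1 (conv (rightAct k A M) (twistBar 𝔸 1 f) (tau A)) := rfl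
    rw [e, twist_conv, twist_conv, twist_twist, twist_twist,
      twist_congr 𝔸 (s := 1 + 1) (t := 0) (by decide) f, twist_zero]
  rw [hochDiff_eq 𝔸 _ (p + 1), t1, hochDiff_eq]
  simp only [map_add, map_sub, map_smul, hochD0_hochD0 𝔸 hf, h1, h2, LinearMap.add_apply,
    LinearMap.sub_apply, LinearMap.smul_apply, a1, a2, a3, sgn_succ]
  simp only [smul_add, smul_sub, smul_neg, neg_smul, smul_smul, neg_mul, sgn_mul_self,
    one_smul, zpow_one]
  abel

variable {𝔸} in
/-- The Hochschild cochain complex of `A` with coefficients in the dg bimodule `M`. -/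
def hochCx (𝔐 : DGBimodule 𝔸 M) : CochainCx k (List A → M) where
  obj := hochObj 𝔸 𝔐.toDGModule
  d := hochDiff 𝔸 𝔐.toDGModule
  d_mem := hochDiff_mem 𝔐
  d_d := hochDiff_hochDiff 𝔐

end

/-- The cup product of Hochschild cochains, `g` being of degree `q`:
`f ∪ g = μ ∘ (f ⊗ g) ∘ Δ`, with the Koszul sign `(-1) ^ (q * (|a₁| - 1 + ⋯ + |aᵢ| - 1))` for
moving `g` past `[a₁, …, aᵢ]`. -/
def hochMul (q : ℤ) : (List A → A) →ₗ[k] (List A → A) →ₗ[k] (List A → A) :=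
  conv (LinearMap.mul k A) ∘ₗ twistBarL 𝔸 q

theorem hochMul_eq (q : ℤ) (f g : List A → A) :
    hochMul 𝔸 q f g = conv (LinearMap.mul k A) (twistBar 𝔸 q f) g := rfl

/-- The unit `1 ∈ A` as a Hochschild cochain. -/
def hochOne (A : Type*) [Ring A] : List A → A
  | [] => 1
  | _ => 0

theorem hochOne_mem : hochOne A ∈ hochObj 𝔸 𝔸.toDGModule 0 := by
  refine ⟨⟨fun u a b v => ?_, fun u c a v => ?_⟩, fun w => ?_⟩
  · cases u <;> simp [hochOne]
  · cases u <;> simp [hochOne]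
  · cases w with
    | nil => simpa [hochOne] using 𝔸.one_mem
    | cons x w => simp [hochOne]

theorem hochOne_mul (q : ℤ) (f : List A → A) : hochMul 𝔸 q (hochOne A) f = f := by
  have h : twistBar 𝔸 q (hochOne A) = hochOne A := by
    ext w; cases w <;> rfl
  have h0 : ∀ a : A, (fun u => hochOne A (a :: u)) = 0 := fun a => rfl
  rw [hochMul_eq, h]
  ext w
  cases w with
  | nil => simp [hochOne]
  | cons a w => rw [conv_cons, h0]; simp [hochOne]

theorem mul_hochOne (f : List A → A) : hochMul 𝔸 0 f (hochOne A) = f := by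
  rw [hochMul_eq, twist_zero]
  ext w
  induction w generalizing f with
  | nil => simp [hochOne]
  | cons a w ih => rw [conv_cons, ih]; simp [hochOne]

theorem convMul_assoc {L : Type*} (x y z : List L → A) :
    conv (LinearMap.mul k A) (conv (LinearMap.mul k A) x y) z =
      conv (LinearMap.mul k A) x (conv (LinearMap.mul k A) y z) :=
  conv_assoc (fun a b c => mul_assoc a b c) x y z

theorem hochDiff_hochMul {p q : ℤ} {f g : List A → A}
    (hf : f ∈ hochObj 𝔸 𝔸.toDGModule p) :
    hochDiff 𝔸 𝔸.toDGModule (p + q) (hochMul 𝔸 q f g) =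
      hochMul 𝔸 q (hochDiff 𝔸 𝔸.toDGModule p f) g +
        (-1 : k) ^ p • hochMul 𝔸 (q + 1) f (hochDiff 𝔸 𝔸.toDGModule q g) := by
  have hL : leftAct k A A = LinearMap.mul k A := rfl
  have hR : rightAct k A A = LinearMap.mul k A := rfl
  have as := convMul_assoc (k := k) (A := A) (L := A)
  have t1 : twistBar 𝔸 q (hochDiff 𝔸 𝔸.toDGModule p f) =
      twistBar 𝔸 q (hochD0 𝔸 𝔸.toDGModule p f) +
        conv (LinearMap.mul k A) (twistBar 𝔸 (p + q) (tau A)) (twistBar 𝔸 q f) -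
        (-1 : k) ^ p • conv (LinearMap.mul k A) (twistBar 𝔸 (q + 1) f)
          (twistBar 𝔸 q (tau A)) := by
    have e : twistBar 𝔸 q (hochDiff 𝔸 𝔸.toDGModule p f) =
      twistBar 𝔸 q (hochD0 𝔸 𝔸.toDGModule p f) +
        twistBar 𝔸 q (conv (LinearMap.mul k A) (twistBar 𝔸 p (tau A)) f) -
        (-1 : k) ^ p • twistBar 𝔸 q (conv (LinearMap.mul k A) (twistBar 𝔸 1 f) (tau A)) := rfl
    rw [e, twist_conv, twist_conv, twist_twist, twist_twist, add_comm 1 q]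
  rw [hochMul_eq, hochMul_eq, hochMul_eq, t1, hochDiff_eq, hochDiff_eq,
    hochD0_conv 𝔸 𝔸.pairing hf, twist_conv, twist_twist, hL, hR]
  simp only [map_add, map_sub, map_smul, LinearMap.add_apply, LinearMap.sub_apply,
    LinearMap.smul_apply, as, smul_add, smul_sub, smul_smul, sgn_add k p q]
  abel

/-- The Hochschild dg algebra of `A` (cochains with values in `A`, cup product). -/
def hochAlg : CochainAlg k (List A → A) where
  toCochainCx := hochCx 𝔸.self
  mul := fun _ q => hochMul 𝔸 q
  one := hochOne A
  one_mem := hochOne_mem 𝔸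
  mul_mem := fun {_ q _ _} hf hg => conv_hoch_mem 𝔸 𝔸.pairing (twist_hoch_mem 𝔸 q hf) hg
  one_mul := fun {q f} _ => hochOne_mul 𝔸 q f
  mul_one := fun {_ f} _ => mul_hochOne 𝔸 f
  mul_assoc := fun {p q r f g h} _ _ _ => by
    rw [hochMul_eq, hochMul_eq, hochMul_eq, hochMul_eq, twist_conv, twist_twist,
      convMul_assoc]
  leibniz := fun {_ _ _ _} hf _ => hochDiff_hochMul 𝔸 hf

end Hochschild

/-! ### Formal power series in non-commuting graded variables -/

section Series

variable {k : Type*} [Field k] {n : ℕ}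

/-- The degree of the word `w` in variables of degrees `x i`. -/
def wdeg (x : Fin n → ℤ) (w : List (Fin n)) : ℤ := (w.map x).sum

@[simp] theorem wdeg_nil (x : Fin n → ℤ) : wdeg x [] = 0 := rfl

@[simp] theorem wdeg_append (x : Fin n → ℤ) (u v : List (Fin n)) :
    wdeg x (u ++ v) = wdeg x u + wdeg x v := by simp [wdeg]

/-- The words of length at most `N`. -/
def wordsLE (n N : ℕ) : Finset (List (Fin n)) := (List.finite_length_le (Fin n) N).toFinset

@[simp] theorem mem_wordsLE {N : ℕ} {w : List (Fin n)} : w ∈ wordsLE n N ↔ w.length ≤ N := by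
  simp [wordsLE]

/-- The series `w` consisting of a single word. -/
def word (k : Type*) [Field k] {n : ℕ} (w : List (Fin n)) : List (Fin n) → k := Pi.single w 1

theorem word_apply (w u : List (Fin n)) : word k w u = if u = w then 1 else 0 := by
  simp [word, Pi.single_apply]

/-- A differential `ð` on the algebra `k⟨⟨X⟩⟩` of formal power series in the non-commuting
variables `xᵢ` of degree `x i`.  A series is given by its coefficients `List (Fin n) → k`, and the
product is the convolution.  `ð` is a derivation of degree one, `ð ∘ ð = 0` and `ð I ⊆ I²`, where
`I` consists of the series without constant term and `I²` of those without terms of length less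
than two. -/
structure NCDifferential (k : Type*) [Field k] {n : ℕ} (x : Fin n → ℤ) where
  eth : (List (Fin n) → k) →ₗ[k] (List (Fin n) → k)
  degree_one : ∀ p h, (∀ w, wdeg x w ≠ p → h w = 0) → ∀ w, wdeg x w ≠ p + 1 → eth h w = 0
  leibniz : ∀ p h g, (∀ w, wdeg x w ≠ p → h w = 0) →
    eth (conv (LinearMap.mul k k) h g) =
      conv (LinearMap.mul k k) (eth h) g + (-1 : k) ^ p • conv (LinearMap.mul k k) h (eth g)
  eth_eth : ∀ h, eth (eth h) = 0
  eth_ideal : ∀ h, h [] = 0 → ∀ w, w.length < 2 → eth h w = 0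

theorem word_homog (x : Fin n → ℤ) (w u : List (Fin n)) (h : wdeg x u ≠ wdeg x w) :
    word k w u = 0 := by
  rw [word_apply, if_neg]
  rintro rfl
  exact h rfl

theorem word_nil_conv (h : List (Fin n) → k) :
    conv (LinearMap.mul k k) (word k []) h = h := by
  ext w
  cases w with
  | nil => simp [word_apply]
  | cons a w =>
    rw [conv_cons]
    have : (fun u => word k [] (a :: u)) = 0 := by ext u; simp [word_apply]
    rw [this]; simp [word_apply]

theorem word_cons_conv (a : Fin n) (u : List (Fin n)) (h : List (Fin n) → k) :
    conv (LinearMap.mul k k) (word k (a :: u)) h =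
      fun w => match w with
        | [] => 0
        | b :: v => if b = a then conv (LinearMap.mul k k) (word k u) h v else 0 := by
  ext w
  cases w with
  | nil => simp [word_apply]
  | cons b v =>
    rw [conv_cons]
    by_cases hb : b = a
    · subst hb
      have : (fun v => word k (b :: u) (b :: v)) = word k u := by ext v; simp [word_apply]
      rw [this]; simp [word_apply]
    · have : (fun v => word k (a :: u) (b :: v)) = 0 := by ext v; simp [word_apply, hb]
      rw [this]; simp [word_apply, hb]

theorem word_conv_word (u v : List (Fin n)) :
    conv (LinearMap.mul k k) (word k u) (word k v) = word k (u ++ v) := by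
  induction u with
  | nil => simp [word_nil_conv]
  | cons a u ih =>
    rw [word_cons_conv, ih]
    ext w
    cases w with
    | nil => simp [word_apply]
    | cons b w => by_cases hb : b = a <;> simp [word_apply, hb]

namespace NCDifferential

variable {x : Fin n → ℤ} (E : NCDifferential k x)

theorem eth_one : E.eth (word k []) = 0 := by
  have h := E.leibniz 0 (word k []) (word k []) (fun w hw => word_homog x [] w hw)
  have e : ∀ h : List (Fin n) → k, conv (LinearMap.mul k k) h (word k []) = h := by
    intro h
    ext w
    induction w generalizing h with
    | nil => simp [word_apply]
    | cons a w ih => rw [conv_cons, ih]; simp [word_apply]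
  rw [word_nil_conv, word_nil_conv, e] at h
  simpa using h

/-- `ð` raises the order of vanishing, hence is continuous. -/
theorem eth_order (r : ℕ) (h : List (Fin n) → k) (hr : ∀ w, w.length ≤ r → h w = 0) :
    ∀ w, w.length ≤ r + 1 → E.eth h w = 0 := by
  induction r generalizing h with
  | zero => exact fun w hw => E.eth_ideal h (hr [] le_rfl) w (by omega)
  | succ r ih =>
    intro w hw
    have e : h = ∑ i : Fin n, conv (LinearMap.mul k k) (word k [i]) (fun u => h (i :: u)) := by
      ext w
      rw [Finset.sum_apply]
      simp only [word_cons_conv, word_nil_conv]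
      cases w with
      | nil => simpa using hr [] (by simp)
      | cons b v => simp
    rw [e, map_sum, Finset.sum_apply]
    refine Finset.sum_eq_zero fun i _ => ?_
    rw [E.leibniz (wdeg x [i]) _ _ (fun w hw => word_homog x [i] w hw), Pi.add_apply,
      Pi.smul_apply]
    have h1 : conv (LinearMap.mul k k) (E.eth (word k [i])) (fun u => h (i :: u)) w = 0 := by
      rw [conv_apply]
      refine Finset.sum_eq_zero fun j hj => ?_
      beta_reduce
      by_cases hj2 : (w.take j).length < 2
      · rw [E.eth_ideal _ (by simp [word_apply]) _ hj2]; simp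
      · have : h (i :: w.drop j) = 0 := by
          refine hr _ ?_
          simp only [List.length_cons, List.length_drop, List.length_take] at hj2 ⊢
          omega
        rw [this, map_zero]
    have h2 : conv (LinearMap.mul k k) (word k [i]) (E.eth (fun u => h (i :: u))) w = 0 := by
      rw [word_cons_conv]
      cases w with
      | nil => rfl
      | cons b v =>
        simp only [word_nil_conv, ite_eq_right_iff]
        intro _
        refine ih _ (fun u hu => hr _ (by simpa using hu)) v ?_
        simpa using hw
    rw [h1, h2]; simp

theorem eth_word_eq_zero (w u : List (Fin n)) (h : u.length < w.length) :
    E.eth (word k w) u = 0 := by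
  refine E.eth_order u.length _ (fun v hv => ?_) u (by omega)
  rw [word_apply, if_neg]
  rintro rfl
  omega

theorem eth_word_degree (w u : List (Fin n)) (h : wdeg x u ≠ wdeg x w + 1) :
    E.eth (word k w) u = 0 :=
  E.degree_one _ _ (fun v hv => word_homog x w v hv) u h

theorem eth_apply (h : List (Fin n) → k) (u : List (Fin n)) {N : ℕ} (hN : u.length ≤ N) :
    E.eth h u = ∑ w ∈ wordsLE n N, h w * E.eth (word k w) u := by
  have e : h = (h - ∑ w ∈ wordsLE n N, h w • word k w) + ∑ w ∈ wordsLE n N, h w • word k w := by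
    simp
  have h0 : E.eth (h - ∑ w ∈ wordsLE n N, h w • word k w) u = 0 := by
    refine E.eth_order N _ (fun v hv => ?_) u (by omega)
    simp [Finset.sum_apply, word_apply, hv]
  conv_lhs => rw [e]
  rw [map_add, Pi.add_apply, h0, zero_add, map_sum, Finset.sum_apply]
  simp

theorem eth_append (u v : List (Fin n)) :
    E.eth (word k (u ++ v)) = conv (LinearMap.mul k k) (E.eth (word k u)) (word k v) +
      (-1 : k) ^ (wdeg x u) • conv (LinearMap.mul k k) (word k u) (E.eth (word k v)) := by
  rw [← word_conv_word, E.leibniz (wdeg x u) _ _ (fun w hw => word_homog x u w hw)]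

end NCDifferential

section
variable {M : Type*} [AddCommGroup M] [Module k M] {x : Fin n → ℤ}

/-- The degree `p` part of (the completion of) `M ⊗ k⟨⟨X⟩⟩`: the formal sums `∑_w m_w ⊗ w` over all
words, given by their coefficients `m : List (Fin n) → M`, with `|m_w| + |w| = p`. -/
def serObj (x : Fin n → ℤ) (V : DGModule k M) (p : ℤ) : Submodule k (List (Fin n) → M) where
  carrier := {f | ∀ w, f w ∈ V.deg (p - wdeg x w)}
  zero_mem' := fun _ => zero_mem _
  add_mem' := fun hf hg w => add_mem (hf w) (hg w)
  smul_mem' := fun c _ hf w => Submodule.smul_mem _ c (hf w)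

/-- `1 ⊗ ð` on `M ⊗ k⟨⟨X⟩⟩`: `∑ m_w ⊗ w ↦ ∑ (-1) ^ |m_w| m_w ⊗ ð w`.  Only words `w` no longer than
`u` contribute to the coefficient at `u`. -/
def ethExt (E : NCDifferential k x) (V : DGModule k M) :
    (List (Fin n) → M) →ₗ[k] (List (Fin n) → M) where
  toFun f u := ∑ w ∈ wordsLE n u.length, E.eth (word k w) u • V.koszul 1 (f w)
  map_add' f g := by ext u; simp [smul_add, Finset.sum_add_distrib]
  map_smul' c f := by ext u; simp [Finset.smul_sum, smul_comm c]

/-- The differential `d + ð` on `M ⊗ k⟨⟨X⟩⟩`. -/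
def serD (E : NCDifferential k x) (V : DGModule k M) :
    (List (Fin n) → M) →ₗ[k] (List (Fin n) → M) :=
  V.d.compLeft (List (Fin n)) + ethExt E V

theorem ethExt_apply (E : NCDifferential k x) (V : DGModule k M) (f : List (Fin n) → M)
    (u : List (Fin n)) {N : ℕ} (hN : u.length ≤ N) :
    ethExt E V f u = ∑ w ∈ wordsLE n N, E.eth (word k w) u • V.koszul 1 (f w) := by
  refine Finset.sum_subset (fun w hw => ?_) (fun w _ hw => ?_)
  · simp only [mem_wordsLE] at hw ⊢; omega
  · rw [E.eth_word_eq_zero, zero_smul]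
    simpa using hw

theorem serD_apply (E : NCDifferential k x) (V : DGModule k M) (f : List (Fin n) → M)
    (u : List (Fin n)) : serD E V f u = V.d (f u) + ethExt E V f u := rfl

theorem serD_mem (E : NCDifferential k x) (V : DGModule k M) {p : ℤ} {f : List (Fin n) → M}
    (hf : f ∈ serObj x V p) : serD E V f ∈ serObj x V (p + 1) := by
  intro u
  rw [serD_apply]
  refine add_mem ?_ (sum_mem fun w _ => ?_)
  · have := V.d_mem (hf u)
    convert this using 2
    ring
  · by_cases h : wdeg x u = wdeg x w + 1
    · refine Submodule.smul_mem _ _ ?_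
      have := V.koszul_mem 1 (hf w)
      convert this using 2
      rw [h]; ring
    · rw [E.eth_word_degree w u h, zero_smul]
      exact zero_mem _

theorem ethExt_ethExt (E : NCDifferential k x) (V : DGModule k M) (f : List (Fin n) → M) :
    ethExt E V (ethExt E V f) = 0 := by
  ext u
  rw [ethExt_apply E V _ u le_rfl]
  have : ∀ w ∈ wordsLE n u.length, E.eth (word k w) u • V.koszul 1 (ethExt E V f w) =
      ∑ v ∈ wordsLE n u.length, (E.eth (word k v) w * E.eth (word k w) u) • f v := by
    intro w hw
    rw [ethExt_apply E V f w (mem_wordsLE.1 hw), map_sum, Finset.smul_sum]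
    refine Finset.sum_congr rfl fun v _ => ?_
    rw [map_smul, V.koszul_koszul, V.koszul_congr (t := 0) (by decide), V.koszul_zero, smul_smul,
      mul_comm]
  rw [Finset.sum_congr rfl this, Finset.sum_comm]
  refine Finset.sum_eq_zero fun v _ => ?_
  rw [← Finset.sum_smul, ← E.eth_apply (E.eth (word k v)) u le_rfl, E.eth_eth]
  simp

theorem serD_serD (E : NCDifferential k x) (V : DGModule k M) (f : List (Fin n) → M) :
    serD E V (serD E V f) = 0 := by
  ext u
  have e : serD E V f = (fun w => V.d (f w)) + ethExt E V f := rfl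
  have h0 := congrFun (ethExt_ethExt E V f) u
  rw [serD_apply, e, map_add, Pi.add_apply, Pi.add_apply, h0, map_add, V.d_d, zero_add]
  rw [ethExt_apply E V f u le_rfl, ethExt_apply E V _ u le_rfl, map_sum]
  simp only [V.d_koszul, map_smul, zpow_one, neg_smul, one_smul, smul_neg]
  simp

/-- Reindexing a sum over pairs of words by their concatenation. -/
theorem sum_words_deconc {N : ℕ} (G : List (Fin n) → List (Fin n) → M)
    (hG : ∀ a b, N < (a ++ b).length → G a b = 0) :
    ∑ w ∈ wordsLE n N, deconc G w = ∑ a ∈ wordsLE n N, ∑ b ∈ wordsLE n N, G a b := by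
  rw [← Finset.sum_product']
  have h2 : ∑ z ∈ wordsLE n N ×ˢ wordsLE n N, G z.1 z.2 =
      ∑ z ∈ (wordsLE n N ×ˢ wordsLE n N).filter (fun z => (z.1 ++ z.2).length ≤ N),
        G z.1 z.2 := by
    refine (Finset.sum_filter_of_ne fun z _ hz => ?_).symm
    by_contra h
    exact hz (hG _ _ (not_le.1 h))
  rw [h2]
  simp only [deconc]
  rw [Finset.sum_sigma']
  refine Finset.sum_bij' (fun z _ => (z.1.take z.2, z.1.drop z.2))
    (fun z _ => ⟨z.1 ++ z.2, z.1.length⟩) ?_ ?_ ?_ ?_ ?_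
  · rintro ⟨w, i⟩ h
    simp at h ⊢
    omega
  · rintro ⟨a, b⟩ h
    simp at h ⊢
    omega
  · rintro ⟨w, i⟩ h
    simp at h ⊢
    omega
  · rintro ⟨a, b⟩ h
    simp
  · rintro ⟨w, i⟩ h
    rfl

end

section
variable {M N P : Type*} [AddCommGroup M] [Module k M] [AddCommGroup N] [Module k N]
  [AddCommGroup P] [Module k P] (x : Fin n → ℤ)

/-- The product of series induced by a pairing `B`, with the Koszul sign rule
`(m ⊗ u) (m' ⊗ v) = (-1) ^ (|u| |m'|) B (m, m') ⊗ uv`. -/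
def serMul (V : DGModule k N) (B : M →ₗ[k] N →ₗ[k] P) :
    (List (Fin n) → M) →ₗ[k] (List (Fin n) → N) →ₗ[k] (List (Fin n) → P) :=
  LinearMap.mk₂ k (fun f g w => deconc (fun u v => B (f u) (V.koszul (wdeg x u) (g v))) w)
    (fun f f' g => by ext w; simp [deconc, Finset.sum_add_distrib])
    (fun c f g => by ext w; simp [deconc, Finset.smul_sum])
    (fun f g g' => by ext w; simp [deconc, Finset.sum_add_distrib])
    (fun c f g => by ext w; simp [deconc, Finset.smul_sum])

theorem serMul_apply (V : DGModule k N) (B : M →ₗ[k] N →ₗ[k] P) (f : List (Fin n) → M)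
    (g : List (Fin n) → N) (w : List (Fin n)) :
    serMul x V B f g w = deconc (fun u v => B (f u) (V.koszul (wdeg x u) (g v))) w := rfl

theorem serMul_assoc {R S T : Type*} [AddCommGroup R] [Module k R] [AddCommGroup S] [Module k S]
    [AddCommGroup T] [Module k T] {V : DGModule k N} {W : DGModule k P} {Y : DGModule k S}
    {B₁ : M →ₗ[k] N →ₗ[k] R} {B₂ : R →ₗ[k] P →ₗ[k] T} {B₃ : N →ₗ[k] P →ₗ[k] S}
    {B₄ : M →ₗ[k] S →ₗ[k] T} (hB : IsDGPairing V W Y B₃)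
    (h : ∀ m n p, B₂ (B₁ m n) p = B₄ m (B₃ n p))
    (f : List (Fin n) → M) (g : List (Fin n) → N) (j : List (Fin n) → P) :
    serMul x W B₂ (serMul x V B₁ f g) j = serMul x Y B₄ f (serMul x W B₃ g j) := by
  ext w
  have := deconc_assoc (fun a b c => B₂ (B₁ (f a) (V.koszul (wdeg x a) (g b)))
    (W.koszul (wdeg x (a ++ b)) (j c))) w
  simp only [serMul_apply]
  calc _ = _ := ?_
    _ = _ := this
    _ = _ := ?_
  · refine deconc_congr fun u v _ => ?_
    have e : deconc (fun a b => B₂ (B₁ (f a) (V.koszul (wdeg x a) (g b)))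
        (W.koszul (wdeg x (a ++ b)) (j v))) u =
      deconc (fun a b => B₂ (B₁ (f a) (V.koszul (wdeg x a) (g b)))
        (W.koszul (wdeg x u) (j v))) u :=
      deconc_congr fun a b hab => by rw [hab]
    rw [e]
    simp only [deconc, map_sum, LinearMap.sum_apply]
  · refine deconc_congr fun u v _ => ?_
    simp only [deconc, map_sum]
    refine Finset.sum_congr rfl fun i _ => ?_
    rw [h, hB.koszul_apply, W.koszul_koszul, wdeg_append]

theorem serMul_mem {U : DGModule k M} {V : DGModule k N} {W : DGModule k P}
    {B : M →ₗ[k] N →ₗ[k] P} (hB : IsDGPairing U V W B) {p q : ℤ} {f : List (Fin n) → M}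
    {g : List (Fin n) → N} (hf : f ∈ serObj x U p) (hg : g ∈ serObj x V q) :
    serMul x V B f g ∈ serObj x W (p + q) := by
  intro w
  rw [serMul_apply]
  refine deconc_mem _ fun u v h => ?_
  have := hB.mem (hf u) (V.koszul_mem (wdeg x u) (hg v))
  rw [← h, wdeg_append]
  convert this using 2
  ring

variable {x}

theorem koszul_ser {V : DGModule k M} {p : ℤ} {f : List (Fin n) → M} (hf : f ∈ serObj x V p)
    (w : List (Fin n)) : V.koszul 1 (f w) = ((-1 : k) ^ p * (-1 : k) ^ (wdeg x w)) • f w := by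
  rw [V.koszul_of_mem 1 (hf w), one_mul, sgn_sub]

theorem ethExt_serMul (E : NCDifferential k x) {U : DGModule k M} {V : DGModule k N}
    {W : DGModule k P} {B : M →ₗ[k] N →ₗ[k] P} (hB : IsDGPairing U V W B) {p : ℤ}
    {f : List (Fin n) → M} {g : List (Fin n) → N} (hf : f ∈ serObj x U p) :
    ethExt E W (serMul x V B f g) =
      serMul x V B (ethExt E U f) g + (-1 : k) ^ p • serMul x V B f (ethExt E V g) := by
  ext u
  -- the common summand
  set T : List (Fin n) → List (Fin n) → P := fun a b =>
    B (U.koszul 1 (f a)) (V.koszul (wdeg x a + 1) (g b)) with hT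
  have hL : ethExt E W (serMul x V B f g) u =
      ∑ a ∈ wordsLE n u.length, ∑ b ∈ wordsLE n u.length, E.eth (word k (a ++ b)) u • T a b := by
    rw [← sum_words_deconc (fun a b => E.eth (word k (a ++ b)) u • T a b)
      (fun a b h => by rw [E.eth_word_eq_zero _ _ h, zero_smul])]
    rw [ethExt_apply E W _ u le_rfl]
    refine Finset.sum_congr rfl fun w _ => ?_
    rw [serMul_apply]
    simp only [deconc, map_sum, Finset.smul_sum]
    refine Finset.sum_congr rfl fun i _ => ?_
    rw [List.take_append_drop, hB.koszul_apply, V.koszul_koszul, hT, add_comm 1]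
  have h1 : serMul x V B (ethExt E U f) g u =
      ∑ a ∈ wordsLE n u.length, ∑ b ∈ wordsLE n u.length,
        conv (LinearMap.mul k k) (E.eth (word k a)) (word k b) u • T a b := by
    rw [serMul_apply]
    simp only [conv_apply, deconc, Finset.sum_smul]
    rw [Finset.sum_congr rfl (fun a _ => Finset.sum_comm), Finset.sum_comm]
    refine Finset.sum_congr rfl fun i _ => ?_
    rw [ethExt_apply E U f (u.take i) (N := u.length) (by simp), map_sum, LinearMap.sum_apply]
    refine Finset.sum_congr rfl fun a _ => ?_
    rw [Finset.sum_eq_single (u.drop i)]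
    · rw [map_smul, LinearMap.smul_apply, LinearMap.mul_apply', word_apply, if_pos rfl, mul_one]
      by_cases h : wdeg x (u.take i) = wdeg x a + 1
      · rw [h]
      · rw [E.eth_word_degree _ _ h, zero_smul, zero_smul]
    · intro b _ hb
      rw [LinearMap.mul_apply', word_apply, if_neg hb.symm, mul_zero, zero_smul]
    · intro h
      exact absurd (mem_wordsLE.2 (by simp)) h
  have h2 : (-1 : k) ^ p • serMul x V B f (ethExt E V g) u =
      ∑ a ∈ wordsLE n u.length, ∑ b ∈ wordsLE n u.length,
        ((-1 : k) ^ (wdeg x a) •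
          conv (LinearMap.mul k k) (word k a) (E.eth (word k b)) u) • T a b := by
    rw [serMul_apply]
    simp only [conv_apply, deconc, Finset.sum_smul, Finset.smul_sum]
    rw [Finset.sum_congr rfl (fun a _ => Finset.sum_comm), Finset.sum_comm]
    refine Finset.sum_congr rfl fun i _ => ?_
    rw [Finset.sum_eq_single (u.take i)]
    · rw [ethExt_apply E V g (u.drop i) (N := u.length) (by simp), map_sum, map_sum,
        Finset.smul_sum]
      refine Finset.sum_congr rfl fun b _ => ?_
      rw [hT]
      simp only [LinearMap.mul_apply', word_apply, if_true, one_mul, map_smul, koszul_ser hf,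
        V.koszul_koszul, LinearMap.smul_apply, smul_smul, smul_eq_mul]
      congr 1
      have := sgn_mul_self k (wdeg x (u.take i))
      linear_combination (-(-1 : k) ^ p * E.eth (word k b) (u.drop i)) * this
    · intro a _ ha
      refine Finset.sum_eq_zero fun b _ => ?_
      rw [LinearMap.mul_apply', word_apply, if_neg ha.symm, zero_mul, smul_zero, zero_smul]
    · intro h
      exact absurd (mem_wordsLE.2 (by simp)) h
  rw [Pi.add_apply, Pi.smul_apply, hL, h1, h2]
  simp only [← Finset.sum_add_distrib, ← add_smul]
  simp only [E.eth_append, Pi.add_apply, Pi.smul_apply]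

/-- `d + ð` is a graded derivation. -/
theorem serD_serMul (E : NCDifferential k x) {U : DGModule k M} {V : DGModule k N}
    {W : DGModule k P} {B : M →ₗ[k] N →ₗ[k] P} (hB : IsDGPairing U V W B) {p : ℤ}
    {f : List (Fin n) → M} {g : List (Fin n) → N} (hf : f ∈ serObj x U p) :
    serD E W (serMul x V B f g) =
      serMul x V B (serD E U f) g + (-1 : k) ^ p • serMul x V B f (serD E V g) := by
  have hd : (fun w => W.d (serMul x V B f g w)) = serMul x V B (fun w => U.d (f w)) g +
      (-1 : k) ^ p • serMul x V B f (fun w => V.d (g w)) := by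
    ext w
    rw [Pi.add_apply, Pi.smul_apply]
    simp only [serMul_apply, deconc, map_sum, Finset.smul_sum, ← Finset.sum_add_distrib]
    refine Finset.sum_congr rfl fun i _ => ?_
    rw [hB.d_apply, koszul_ser hf, V.d_koszul]
    simp only [map_smul, LinearMap.smul_apply, smul_smul]
  have eW : serD E W (serMul x V B f g) =
    (fun w => W.d (serMul x V B f g w)) + ethExt E W (serMul x V B f g) := rfl
  have eU : serD E U f = (fun w => U.d (f w)) + ethExt E U f := rfl
  have eV : serD E V g = (fun w => V.d (g w)) + ethExt E V g := rfl
  rw [eW, eU, eV, hd, ethExt_serMul E hB hf]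
  simp only [map_add, LinearMap.add_apply, smul_add]
  abel

end

end Series

/-! ### Formal power series connections and the twisted differential -/

section Chen

variable {k A : Type*} [Field k] [Ring A] [Algebra k A]

/-- The cohomology classes `[1], [e₁], …, [eₙ]` in `H(A) = ⨁ p, H^p(A)`. -/
def cohomFamily (𝔸 : DGAlgebra k A) {n : ℕ} (deg : Fin n → ℤ) (e : Fin n → A)
    (he : ∀ i, e i ∈ 𝔸.toCx.cocycle (deg i)) : Option (Fin n) → ⨁ p, 𝔸.toCx.H p
  | none => DirectSum.lof k ℤ 𝔸.toCx.H 0 (𝔸.toCx.cls 0 1 𝔸.one_cocycle)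
  | some i => DirectSum.lof k ℤ 𝔸.toCx.H (deg i) (𝔸.toCx.cls (deg i) (e i) (he i))

/-- A formal power series connection `(ð, ω)` on a dg algebra `A` with finite-dimensional
cohomology.  Here `e₁, …, eₙ` are homogeneous cocycles such that `[1], [e₁], …, [eₙ]` is a basis
of `H(A)`; the variable `xᵢ`, dual to `[eᵢ]`, has degree `1 - |eᵢ|`; `ð` is a differential of
`k⟨⟨x₁, …, xₙ⟩⟩` with `ð I ⊆ I²`; and `ω` is an element of degree one of (the completion of)
`A ⊗ k⟨⟨X⟩⟩` with `ω ≡ ∑ eᵢ ⊗ xᵢ` modulo `A ⊗ I²` and `dω + ðω + ωω = 0`. -/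
structure ChenConnection (𝔸 : DGAlgebra k A) (n : ℕ) where
  deg : Fin n → ℤ
  e : Fin n → A
  e_cocycle : ∀ i, e i ∈ 𝔸.toCx.cocycle (deg i)
  linearIndependent : LinearIndependent k (cohomFamily 𝔸 deg e e_cocycle)
  span_eq_top : Submodule.span k (Set.range (cohomFamily 𝔸 deg e e_cocycle)) = ⊤
  eth : NCDifferential k (fun i => 1 - deg i)
  ω : List (Fin n) → A
  ω_mem : ω ∈ serObj (fun i => 1 - deg i) 𝔸.toDGModule 1
  ω_nil : ω [] = 0
  ω_single : ∀ i, ω [i] = e i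
  maurerCartan : serD eth 𝔸.toDGModule ω +
    serMul (fun i => 1 - deg i) 𝔸.toDGModule (LinearMap.mul k A) ω ω = 0

namespace ChenConnection

variable {𝔸 : DGAlgebra k A} {n : ℕ} (Ω : ChenConnection 𝔸 n)

/-- The degrees `|xᵢ| = 1 - |eᵢ|` of the variables. -/
abbrev x : Fin n → ℤ := fun i => 1 - Ω.deg i

/-- The product of `A ⊗ k⟨⟨X⟩⟩`. -/
def mul : (List (Fin n) → A) →ₗ[k] (List (Fin n) → A) →ₗ[k] (List (Fin n) → A) :=
  serMul Ω.x 𝔸.toDGModule (LinearMap.mul k A)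

section
variable {M : Type*} [AddCommGroup M] [Module k M] [Module A M] [Module Aᵐᵒᵖ M]
  [SMulCommClass A Aᵐᵒᵖ M] [IsScalarTower k A M] [IsScalarTower k Aᵐᵒᵖ M]

/-- The differential `d_ω f = d f + ð f + [ω, f]` on the degree `p` part of `M ⊗ k⟨⟨X⟩⟩`, where
`[ω, f] = ω f - (-1) ^ p f ω`. -/
def diff (𝔐 : DGBimodule 𝔸 M) (p : ℤ) : (List (Fin n) → M) →ₗ[k] (List (Fin n) → M) :=
  serD Ω.eth 𝔐.toDGModule +
    (serMul Ω.x 𝔐.toDGModule (leftAct k A M) Ω.ω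
      - (-1 : k) ^ p • (serMul Ω.x 𝔸.toDGModule (rightAct k A M)).flip Ω.ω)

theorem diff_eq (𝔐 : DGBimodule 𝔸 M) (p : ℤ) (f : List (Fin n) → M) :
    Ω.diff 𝔐 p f = serD Ω.eth 𝔐.toDGModule f +
      (serMul Ω.x 𝔐.toDGModule (leftAct k A M) Ω.ω f
        - (-1 : k) ^ p • serMul Ω.x 𝔸.toDGModule (rightAct k A M) f Ω.ω) := rfl

theorem diff_mem (𝔐 : DGBimodule 𝔸 M) {p : ℤ} {f : List (Fin n) → M}
    (hf : f ∈ serObj Ω.x 𝔐.toDGModule p) : Ω.diff 𝔐 p f ∈ serObj Ω.x 𝔐.toDGModule (p + 1) := by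
  rw [diff_eq]
  refine add_mem (serD_mem _ _ hf) (sub_mem ?_ (Submodule.smul_mem _ _ ?_))
  · rw [add_comm]
    exact serMul_mem _ 𝔐.leftPairing Ω.ω_mem hf
  · exact serMul_mem _ 𝔐.rightPairing hf Ω.ω_mem

theorem diff_diff (𝔐 : DGBimodule 𝔸 M) {p : ℤ} {f : List (Fin n) → M}
    (hf : f ∈ serObj Ω.x 𝔐.toDGModule p) : Ω.diff 𝔐 (p + 1) (Ω.diff 𝔐 p f) = 0 := by
  have hmc : serD Ω.eth 𝔸.toDGModule Ω.ω =
      - serMul Ω.x 𝔸.toDGModule (LinearMap.mul k A) Ω.ω Ω.ω :=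
    eq_neg_of_add_eq_zero_left Ω.maurerCartan
  have h1 := serD_serMul Ω.eth 𝔐.leftPairing (g := f) Ω.ω_mem
  have h2 := serD_serMul Ω.eth 𝔐.rightPairing (g := Ω.ω) hf
  rw [hmc, map_neg] at h1 h2
  have a1 := serMul_assoc (k := k) Ω.x (B₁ := LinearMap.mul k A) (B₂ := leftAct k A M)
    (B₃ := leftAct k A M) (B₄ := leftAct k A M)
    (V := 𝔸.toDGModule) 𝔐.leftPairing (fun a b m => mul_smul a b m) Ω.ω Ω.ω f
  have a2 := serMul_assoc (k := k) Ω.x (B₁ := leftAct k A M) (B₂ := rightAct k A M)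
    (B₄ := leftAct k A M) 𝔐.rightPairing
    (fun a m b => (smul_comm a (MulOpposite.op b) m).symm) Ω.ω f Ω.ω
  have a3 := serMul_assoc (k := k) Ω.x (B₁ := rightAct k A M) (B₂ := rightAct k A M)
    (B₄ := rightAct k A M) 𝔸.pairing
    (fun m a b => (mul_smul (MulOpposite.op b) (MulOpposite.op a) m).symm) f Ω.ω Ω.ω
  rw [diff_eq Ω 𝔐 (p + 1), diff_eq]
  simp only [map_add, map_sub, map_smul, serD_serD, h1, h2, LinearMap.add_apply,
    LinearMap.sub_apply, LinearMap.smul_apply, LinearMap.neg_apply, a1, a2, a3, sgn_succ]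
  simp only [smul_add, smul_sub, smul_neg, neg_smul, smul_smul, neg_mul, sgn_mul_self,
    one_smul, zpow_one]
  abel

/-- The complex `(M ⊗ k⟨⟨X⟩⟩, d_ω)`. -/
def twistedCx (𝔐 : DGBimodule 𝔸 M) : CochainCx k (List (Fin n) → M) where
  obj := serObj Ω.x 𝔐.toDGModule
  d := Ω.diff 𝔐
  d_mem := Ω.diff_mem 𝔐
  d_d := Ω.diff_diff 𝔐

end

/-- The unit `1 ⊗ 1` of `A ⊗ k⟨⟨X⟩⟩`. -/
def one (A : Type*) [Ring A] (n : ℕ) : List (Fin n) → A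
  | [] => 1
  | _ => 0

theorem one_mem : one A n ∈ serObj Ω.x 𝔸.toDGModule 0 := by
  intro w
  cases w with
  | nil => simpa [one] using 𝔸.one_mem
  | cons a w => simp [one]

theorem mul_apply (f g : List (Fin n) → A) (w : List (Fin n)) :
    Ω.mul f g w = deconc (fun u v => f u * 𝔸.koszul (wdeg Ω.x u) (g v)) w := rfl

theorem one_mul (f : List (Fin n) → A) : Ω.mul (one A n) f = f := by
  ext w
  rw [mul_apply]
  cases w with
  | nil => simp [one, 𝔸.koszul_zero]
  | cons a w =>
    rw [deconc_cons]
    simp [one, 𝔸.koszul_zero, deconc_zero]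

theorem mul_one (f : List (Fin n) → A) : Ω.mul f (one A n) = f := by
  have h : ∀ s, 𝔸.koszul s 1 = 1 := fun s => by
    rw [𝔸.koszul_of_mem s 𝔸.one_mem]; simp
  have key : ∀ (w : List (Fin n)) (s : ℤ) (f : List (Fin n) → A),
      deconc (fun u v => f u * 𝔸.koszul (s + wdeg Ω.x u) (one A n v)) w = f w := by
    intro w
    induction w with
    | nil => intro s f; simp [one, h]
    | cons a w ih =>
      intro s f
      rw [deconc_cons]
      have := ih (s + Ω.x a) (fun u => f (a :: u))
      have e : ∀ u, s + wdeg Ω.x (a :: u) = s + Ω.x a + wdeg Ω.x u := fun u => by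
        simp only [wdeg, List.map_cons, List.sum_cons]; ring
      simp only [e, this]
      simp [one]
  ext w
  have := key w 0 f
  simp only [zero_add] at this
  exact this

theorem mul_assoc (f g h : List (Fin n) → A) :
    Ω.mul (Ω.mul f g) h = Ω.mul f (Ω.mul g h) :=
  serMul_assoc Ω.x 𝔸.pairing (fun a b c => _root_.mul_assoc a b c) f g h

theorem diff_mul {p q : ℤ} {f g : List (Fin n) → A} (hf : f ∈ serObj Ω.x 𝔸.toDGModule p) :
    Ω.diff 𝔸.self (p + q) (Ω.mul f g) =
      Ω.mul (Ω.diff 𝔸.self p f) g + (-1 : k) ^ p • Ω.mul f (Ω.diff 𝔸.self q g) := by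
  have e : ∀ (p : ℤ) (f : List (Fin n) → A), Ω.diff 𝔸.self p f =
    serD Ω.eth 𝔸.toDGModule f + (Ω.mul Ω.ω f - (-1 : k) ^ p • Ω.mul f Ω.ω) := fun _ _ => rfl
  have h1 : serD Ω.eth 𝔸.toDGModule (Ω.mul f g) = Ω.mul (serD Ω.eth 𝔸.toDGModule f) g +
      (-1 : k) ^ p • Ω.mul f (serD Ω.eth 𝔸.toDGModule g) := serD_serMul Ω.eth 𝔸.pairing hf
  rw [e, e, e, h1]
  simp only [map_add, map_sub, map_smul, LinearMap.add_apply, LinearMap.sub_apply,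
    LinearMap.smul_apply, mul_assoc, smul_add, smul_sub, smul_smul, sgn_add k p q]
  abel

/-- The dg algebra `(A ⊗ k⟨⟨X⟩⟩, d_ω)`. -/
def twistedAlg : CochainAlg k (List (Fin n) → A) where
  toCochainCx := Ω.twistedCx 𝔸.self
  mul := fun _ _ => Ω.mul
  one := one A n
  one_mem := Ω.one_mem
  mul_mem := serMul_mem Ω.x 𝔸.pairing
  one_mul := fun {_ f} _ => Ω.one_mul f
  mul_one := fun {_ f} _ => Ω.mul_one f
  mul_assoc := fun {_ _ _ f g h} _ _ _ => Ω.mul_assoc f g h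
  leibniz := fun {_ _ _ _} hf _ => Ω.diff_mul hf

/-- `∑_{i < j} aᵢ aⱼ`. -/
def pairSum : List ℤ → ℤ
  | [] => 0
  | a :: l => a * l.sum + pairSum l

/-- The map `ω^*`, `f ↦ f (ω, …, ω)`, from Hochschild cochains to `M ⊗ k⟨⟨X⟩⟩`.  The coefficient at
`w` is the sum of `(-1) ^ (∑_{i<j} |wᵢ| |wⱼ|) f [ω_{w₁}, …, ω_{w_m}]` over all ways to cut the word
`w` into non-empty pieces `w₁, …, w_m`; this is the extension of `f` by `k⟨⟨X⟩⟩`-linearity, with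
the Koszul signs for moving the variables to the right, evaluated at `[ω|⋯|ω]`. -/
def pullback {M : Type*} [AddCommGroup M] [Module k M] (f : List A → M) : List (Fin n) → M :=
  fun w => ∑ c : Composition w.length,
    (-1 : k) ^ pairSum ((w.splitWrtComposition c).map (wdeg Ω.x)) •
      f ((w.splitWrtComposition c).map Ω.ω)

end ChenConnection

end Chen

end ChenHoch

end

open ChenHoch
open scoped DirectSum RightActions

/-!
The map `ω^*` is a morphism of complexes and is multiplicative because of the Maurer-Cartan
equation: `ω` amounts to a morphism from the coalgebra dual to `k⟨⟨X⟩⟩` to the bar construction of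
`A`.  On cochains this is `pullback_hochDiff` and `pullback_hochMul`; both are proved by recursion
on the word, by splitting off the first piece of a cut (`pullback_cons`).

That `ω^*` induces an isomorphism is proved by showing that its cone is acyclic
(`exists_primitive`): if `δ f = 0` and `ω^* f = d_ω s`, then there is a cochain `g` with `δ g = f`
and `ω^* g = s`.  This gives injectivity in cohomology, and for `f = 0` it shows that every cocycle
of `M ⊗ k⟨⟨X⟩⟩` is of the form `ω^* g` with `δ g = 0`.  The primitive is found in
two stages, both by successive approximation (`exists_successive_approximation`), which converges
since cochains and series are products over the lengths of words.

* The cocycle `f` is made normalized, that is, zero on words with a letter `1`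
  (`exists_normalized`).  Inserting the letter `1` after the first `i` letters is a homotopy which
  makes a cochain, already zero when one of the first `i` letters is `1`, vanish when the next
  letter is `1`.
* Let a normalized `f`, and `s`, vanish on words of length less than `r`.  On words of length `r`,
  only the internal differential of `δ` matters, and `ω` may be replaced by `∑ eᵢ ⊗ xᵢ`.  Since
  `[1], [e₁], …, [eₙ]` is a basis of `H(A)`, there is a homotopy between the identity of `A` and a
  projection onto the span of `1, e₁, …, eₙ` (`nonempty_contraction`).  It extends to the tensor
  powers of `A` (`tensorHomotopy`), and on normalized cochains the extended projection only sees
  `e₁, …, eₙ`.  The sum of the resulting primitive of `f` and of the multilinear extension of `s`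
  (`spread`) is a primitive of the pair `(f, s)` in leading order (`exists_leading_primitive`).
-/

set_option linter.unusedSectionVars false

namespace ChenHoch

/-! ### Cutting words into pieces -/

section Cutting

variable {L M : Type*} [AddCommGroup M]

/-- A way to cut `a :: w` into non-empty pieces consists of a first piece `a :: u` and of a way to
cut the rest `v` of the word. -/
theorem sum_splitWrtComposition_cons (G : List (List L) → M) (a : L) (w : List L) :
    ∑ c : Composition (a :: w).length, G ((a :: w).splitWrtComposition c) =
      deconc (fun u v => ∑ c : Composition v.length,
        G ((a :: u) :: v.splitWrtComposition c)) w := by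
  rw [deconc, Finset.sum_sigma']
  symm
  refine Finset.sum_bij (fun z hz => ⟨(z.1 + 1) :: z.2.blocks, ?_, ?_⟩) ?_ ?_ ?_ ?_
  · intro i hi
    rcases List.mem_cons.1 hi with rfl | hi
    · omega
    · exact z.2.blocks_pos hi
  · have h1 := z.2.blocks_sum
    have h2 : z.1 < w.length + 1 := by simpa using hz
    rw [List.sum_cons, h1, List.length_drop, List.length_cons]
    omega
  · intro z _
    exact Finset.mem_univ _
  · rintro ⟨i, c⟩ h1 ⟨j, c'⟩ h2 h
    simp only [Composition.mk.injEq, List.cons.injEq, add_left_inj] at h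
    obtain ⟨rfl, h⟩ := h
    rw [Composition.ext h]
  · intro c _
    obtain ⟨b, hp, hs⟩ := c
    cases b with
    | nil => simp at hs
    | cons m t =>
      have hm : 0 < m := hp (by simp)
      simp only [List.sum_cons, List.length_cons] at hs
      refine ⟨⟨m - 1, ⟨t, fun hi => hp (List.mem_cons_of_mem _ hi), ?_⟩⟩, ?_, ?_⟩
      · rw [List.length_drop]; omega
      · simp; omega
      · refine Composition.ext ?_
        change (m - 1 + 1) :: t = m :: t
        rw [Nat.sub_add_cancel hm]
  · rintro ⟨i, c⟩ _
    simp only [List.splitWrtComposition, List.splitWrtCompositionAux_cons, List.take_succ_cons,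
      List.drop_succ_cons]

theorem sum_splitWrtComposition_nil (G : List (List L) → M) :
    ∑ c : Composition ([] : List L).length, G (([] : List L).splitWrtComposition c) = G [] := by
  have h : ∀ c : Composition ([] : List L).length, ([] : List L).splitWrtComposition c = [] := by
    intro c
    have := List.length_splitWrtComposition ([] : List L) c
    have h2 : c.length ≤ 0 := c.length_le
    exact List.length_eq_zero_iff.1 (by omega)
  simp only [h]
  rw [Finset.sum_const]
  have : (Finset.univ : Finset (Composition ([] : List L).length)).card = 1 := by
    rw [Finset.card_univ, composition_card]; rfl
  rw [this, one_smul]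

theorem deconc_smul {k : Type*} [Field k] [Module k M] (c : k) (F : List L → List L → M)
    (w : List L) : deconc (fun u v => c • F u v) w = c • deconc F w :=
  (Finset.smul_sum).symm

theorem deconc_neg (F : List L → List L → M) (w : List L) :
    deconc (fun u v => -F u v) w = -deconc F w :=
  Finset.sum_neg_distrib _

end Cutting

/-! ### The map `ω^*` by recursion on the word -/

theorem wdeg_cons {n : ℕ} (x : Fin n → ℤ) (a : Fin n) (w : List (Fin n)) :
    wdeg x (a :: w) = x a + wdeg x w := by simp [wdeg]

theorem sum_map_wdeg {n : ℕ} (x : Fin n → ℤ) (l : List (List (Fin n))) :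
    (l.map (wdeg x)).sum = wdeg x l.flatten := by
  induction l with
  | nil => rfl
  | cons u l ih => rw [List.map_cons, List.sum_cons, ih, List.flatten_cons, wdeg_append]

namespace ChenConnection

variable {k A : Type*} [Field k] [Ring A] [Algebra k A] {𝔸 : DGAlgebra k A} {n : ℕ}
  (Ω : ChenConnection 𝔸 n) {M : Type*} [AddCommGroup M] [Module k M]

theorem pullback_nil (f : List A → M) : Ω.pullback f [] = f [] := by
  have := sum_splitWrtComposition_nil (L := Fin n) (fun l =>
    (-1 : k) ^ pairSum (l.map (wdeg Ω.x)) • f (l.map Ω.ω))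
  rw [pullback, this]
  simp [pairSum]

theorem pullback_cons (f : List A → M) (a : Fin n) (w : List (Fin n)) :
    Ω.pullback f (a :: w) = deconc (fun u v => (-1 : k) ^ (wdeg Ω.x (a :: u) * wdeg Ω.x v) •
      Ω.pullback (fun z => f (Ω.ω (a :: u) :: z)) v) w := by
  rw [pullback, sum_splitWrtComposition_cons (fun l =>
    (-1 : k) ^ pairSum (l.map (wdeg Ω.x)) • f (l.map Ω.ω))]
  refine deconc_congr fun u v _ => ?_
  rw [pullback, Finset.smul_sum]
  refine Finset.sum_congr rfl fun c _ => ?_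
  simp only [List.map_cons, pairSum]
  rw [sum_map_wdeg, List.flatten_splitWrtComposition, sgn_add, mul_smul]

/-- The coefficient at the empty word being known, `ω^* f` is determined by splitting off the
first piece; the empty first piece contributes nothing since `ω` has no constant term. -/
theorem pullback_of_ne_nil {f : List A → M} (hf : IsMultilin k f) {w : List (Fin n)}
    (hw : w ≠ []) :
    Ω.pullback f w = deconc (fun u v => (-1 : k) ^ (wdeg Ω.x u * wdeg Ω.x v) •
      Ω.pullback (fun z => f (Ω.ω u :: z)) v) w := by
  cases w with
  | nil => exact absurd rfl hw
  | cons a w =>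
    have h0 : Ω.pullback (fun z => f (Ω.ω [] :: z)) (a :: w) = 0 := by
      simp [pullback, Ω.ω_nil, hf.head_zero]
    rw [pullback_cons, deconc_cons, h0, smul_zero, zero_add]

theorem pullback_add (f g : List A → M) : Ω.pullback (f + g) = Ω.pullback f + Ω.pullback g := by
  ext w
  simp [pullback, smul_add, Finset.sum_add_distrib]

theorem pullback_smul (c : k) (f : List A → M) : Ω.pullback (c • f) = c • Ω.pullback f := by
  ext w
  simp [pullback, Finset.smul_sum, smul_comm c]

/-- `ω^*` as a linear map. -/
def pullbackL : (List A → M) →ₗ[k] (List (Fin n) → M) where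
  toFun := Ω.pullback
  map_add' := Ω.pullback_add
  map_smul' := Ω.pullback_smul

theorem pullback_neg (f : List A → M) : Ω.pullback (-f) = -Ω.pullback f := map_neg Ω.pullbackL f

theorem pullback_sub (f g : List A → M) : Ω.pullback (f - g) = Ω.pullback f - Ω.pullback g :=
  map_sub Ω.pullbackL f g

theorem pullback_comp {N : Type*} [AddCommGroup N] [Module k N] (φ : M →ₗ[k] N)
    (f : List A → M) : Ω.pullback (fun z => φ (f z)) = fun w => φ (Ω.pullback f w) := by
  ext w
  simp [pullback, map_sum]

/-- The value of `ω^* f` at `w` only involves the values of `f` on words no longer than `w`. -/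
theorem pullback_congr {f g : List A → M} {w : List (Fin n)}
    (h : ∀ z : List A, z.length ≤ w.length → f z = g z) : Ω.pullback f w = Ω.pullback g w := by
  refine Finset.sum_congr rfl fun c _ => ?_
  rw [h]
  rw [List.length_map, List.length_splitWrtComposition]
  exact c.length_le

theorem pullback_mem {V : DGModule k M} {p : ℤ} {f : List A → M} (hf : f ∈ hochObj 𝔸 V p) :
    Ω.pullback f ∈ serObj Ω.x V p := by
  intro w
  refine sum_mem fun c _ => Submodule.smul_mem _ _ ?_
  have h := hf.2 ((w.splitWrtComposition c).map fun u => ⟨1 - wdeg Ω.x u, Ω.ω u, Ω.ω_mem u⟩)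
  simp only [List.map_map, Function.comp_def] at h
  have e : ((w.splitWrtComposition c).map fun u => 1 - wdeg Ω.x u - 1).sum = - wdeg Ω.x w := by
    conv_rhs => rw [← List.flatten_splitWrtComposition w c]
    generalize w.splitWrtComposition c = l
    induction l with
    | nil => simp
    | cons u l ih =>
      rw [List.map_cons, List.sum_cons, ih, List.flatten_cons, wdeg_append]; ring
  rw [e, ← sub_eq_add_neg] at h
  exact h

end ChenConnection

/-! ### `ω^*` commutes with products and with the bar differential -/

section Words

variable {k M : Type*} [Field k] [AddCommGroup M] [Module k M] {n : ℕ}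

theorem deconc_eq_last {L : Type*} {F : List L → List L → M} {w : List L}
    (h : ∀ u v, v ≠ [] → F u v = 0) : deconc F w = F w [] := by
  rw [deconc, Finset.sum_eq_single w.length]
  · simp
  · intro i hi hne
    refine h _ _ fun h0 => hne ?_
    have := congrArg List.length h0
    simp only [List.length_drop, List.length_nil, Finset.mem_range] at this hi
    omega
  · simp

theorem sum_conv_word (h : List (Fin n) → List (Fin n) → k) (T : List (Fin n) → List (Fin n) → M)
    (u : List (Fin n)) :
    ∑ a ∈ wordsLE n u.length, ∑ b ∈ wordsLE n u.length,
      conv (LinearMap.mul k k) (h a) (word k b) u • T a b =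
    deconc (fun v z => ∑ a ∈ wordsLE n u.length, h a v • T a z) u := by
  simp only [conv_apply, deconc, Finset.sum_smul]
  rw [Finset.sum_congr rfl (fun a _ => Finset.sum_comm), Finset.sum_comm]
  refine Finset.sum_congr rfl fun i _ => Finset.sum_congr rfl fun a _ => ?_
  rw [Finset.sum_eq_single (u.drop i)]
  · simp [word_apply]
  · intro b _ hb
    simp [word_apply, hb.symm]
  · intro h
    exact absurd (mem_wordsLE.2 (by simp)) h

theorem sum_word_conv (h : List (Fin n) → List (Fin n) → k) (T : List (Fin n) → List (Fin n) → M)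
    (u : List (Fin n)) :
    ∑ a ∈ wordsLE n u.length, ∑ b ∈ wordsLE n u.length,
      conv (LinearMap.mul k k) (word k a) (h b) u • T a b =
    deconc (fun v z => ∑ b ∈ wordsLE n u.length, h b z • T v b) u := by
  simp only [conv_apply, deconc, Finset.sum_smul]
  rw [Finset.sum_congr rfl (fun a _ => Finset.sum_comm), Finset.sum_comm]
  refine Finset.sum_congr rfl fun i _ => ?_
  rw [Finset.sum_eq_single (u.take i)]
  · refine Finset.sum_congr rfl fun b _ => ?_
    simp [word_apply]
  · intro a _ ha
    refine Finset.sum_eq_zero fun b _ => ?_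
    simp [word_apply, ha.symm]
  · intro h
    exact absurd (mem_wordsLE.2 (by simp)) h

end Words

/-- The cochains `w ↦ f (a :: w)`, as a linear function of `a`. -/
def IsMultilin.headL {k A M : Type*} [Field k] [Ring A] [Algebra k A] [AddCommGroup M]
    [Module k M] {f : List A → M} (hf : IsMultilin k f) : A →ₗ[k] (List A → M) where
  toFun a := fun w => f (a :: w)
  map_add' := cons_add hf
  map_smul' := cons_smul hf

namespace ChenConnection

variable {k A : Type*} [Field k] [Ring A] [Algebra k A] {𝔸 : DGAlgebra k A} {n : ℕ}
  (Ω : ChenConnection 𝔸 n) {M : Type*} [AddCommGroup M] [Module k M]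

theorem barSign_ω (s : ℤ) (u : List (Fin n)) :
    𝔸.barSign s (Ω.ω u) = (-1 : k) ^ (s * wdeg Ω.x u) • Ω.ω u := by
  rw [𝔸.barSign_of_mem s (Ω.ω_mem u), ← sgn_neg]
  congr 2; ring

theorem pullback_twistBar {f : List A → M} (hf : IsMultilin k f) (s : ℤ) (w : List (Fin n)) :
    Ω.pullback (twistBar 𝔸 s f) w = (-1 : k) ^ (s * wdeg Ω.x w) • Ω.pullback f w := by
  have key : ∀ (l : List (List (Fin n))) (f : List A → M), IsMultilin k f →
      twistBar 𝔸 s f (l.map Ω.ω) = (-1 : k) ^ (s * wdeg Ω.x l.flatten) • f (l.map Ω.ω) := by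
    intro l
    induction l with
    | nil => intro f _; simp [twistBar]
    | cons u l ih =>
      intro f hf
      have := ih _ (hf.cons (𝔸.barSign s (Ω.ω u)))
      simp only [twistBar, List.map_cons, List.flatten_cons, wdeg_append, mul_add, sgn_add] at this ⊢
      rw [this, barSign_ω, hf.head_smul, smul_smul, mul_comm]
  rw [pullback, pullback, Finset.smul_sum]
  refine Finset.sum_congr rfl fun c _ => ?_
  rw [key _ f hf, List.flatten_splitWrtComposition, smul_comm]

theorem pullback_zero : Ω.pullback (0 : List A → M) = 0 := map_zero Ω.pullbackL

theorem pullback_tau : Ω.pullback (tau A) = Ω.ω := by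
  have h0 : ∀ b c : A, (fun z => tau A (b :: c :: z)) = 0 := fun b c => rfl
  ext w
  cases w with
  | nil => rw [pullback_nil, Ω.ω_nil]; rfl
  | cons a w =>
    rw [pullback_cons, deconc_eq_last]
    · rw [pullback_nil]; simp [tau]
    · intro u v hv
      cases v with
      | nil => exact absurd rfl hv
      | cons b v =>
        rw [pullback_cons]
        simp only [h0, pullback_zero, Pi.zero_apply, smul_zero, deconc_zero]

/-- `ω^*` turns the convolution of cochains into the product of series. -/
theorem pullback_conv {N P : Type*} [AddCommGroup N] [Module k N] [AddCommGroup P] [Module k P]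
    (B : M →ₗ[k] N →ₗ[k] P) {f : List A → M} {g : List A → N} (hf : IsMultilin k f)
    (w : List (Fin n)) :
    Ω.pullback (conv B f g) w = deconc (fun u v => (-1 : k) ^ (wdeg Ω.x u * wdeg Ω.x v) •
      B (Ω.pullback f u) (Ω.pullback g v)) w := by
  induction hN : w.length using Nat.strong_induction_on generalizing f w with
  | _ N ih =>
    subst hN
    cases w with
    | nil => simp [pullback_nil]
    | cons a w =>
      -- split off the first piece on the left, and use induction for the remaining pieces
      have e1 : ∀ b : A, (fun z => conv B f g (b :: z)) =
          (fun z => B (f []) (g (b :: z))) + conv B (fun z => f (b :: z)) g :=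
        fun b => funext fun z => conv_cons ..
      have e2 : ∀ u v : List (Fin n), u ++ v = w →
          (-1 : k) ^ (wdeg Ω.x (a :: u) * wdeg Ω.x v) •
            Ω.pullback (fun z => conv B f g (Ω.ω (a :: u) :: z)) v =
          B (f []) ((-1 : k) ^ (wdeg Ω.x (a :: u) * wdeg Ω.x v) •
            Ω.pullback (fun z => g (Ω.ω (a :: u) :: z)) v) +
          deconc (fun y z => (-1 : k) ^ (wdeg Ω.x (a :: u) * wdeg Ω.x (y ++ z)) •
            (-1 : k) ^ (wdeg Ω.x y * wdeg Ω.x z) •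
            B (Ω.pullback (fun z => f (Ω.ω (a :: u) :: z)) y) (Ω.pullback g z)) v := by
        intro u v huv
        rw [e1, pullback_add, Pi.add_apply, smul_add, pullback_comp, map_smul,
          ih v.length (by rw [← huv]; simp) (hf.cons _) v rfl, ← deconc_smul]
        congr 1
        exact deconc_congr fun y z hyz => by rw [hyz]
      have e3 : deconc (fun u v => B (f []) ((-1 : k) ^ (wdeg Ω.x (a :: u) * wdeg Ω.x v) •
            Ω.pullback (fun z => g (Ω.ω (a :: u) :: z)) v)) w =
          B (f []) (Ω.pullback g (a :: w)) := by
        rw [Ω.pullback_cons g]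
        exact deconc_map (B (f [])).toAddMonoidHom _ w
      rw [pullback_cons, deconc_congr e2, deconc_add, e3, ← deconc_assoc (fun u y z =>
        (-1 : k) ^ (wdeg Ω.x (a :: u) * wdeg Ω.x (y ++ z)) •
            (-1 : k) ^ (wdeg Ω.x y * wdeg Ω.x z) •
            B (Ω.pullback (fun z => f (Ω.ω (a :: u) :: z)) y) (Ω.pullback g z)),
        deconc_cons, pullback_nil]
      congr 1
      · simp
      · refine deconc_congr fun u v _ => ?_
        rw [pullback_cons, ← LinearMap.flip_apply]
        simp only [deconc, map_sum, Finset.smul_sum]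
        refine Finset.sum_congr rfl fun i _ => ?_
        simp only [map_smul, LinearMap.flip_apply, smul_smul, ← sgn_add, wdeg_append]
        congr 2
        have : wdeg Ω.x u = wdeg Ω.x (u.take i) + wdeg Ω.x (u.drop i) := by
          rw [← wdeg_append, List.take_append_drop]
        rw [wdeg_cons, wdeg_cons, this]
        ring_nf

/-- The Koszul sign of `f ∪ g` becomes the one of the product of series. -/
theorem pullback_conv_twistBar {N P : Type*} [AddCommGroup N] [Module k N] [AddCommGroup P]
    [Module k P] (B : M →ₗ[k] N →ₗ[k] P) {V : DGModule k N} {f : List A → M} {g : List A → N}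
    {q : ℤ} (hf : IsMultilin k f) (hg : g ∈ hochObj 𝔸 V q) :
    Ω.pullback (conv B (twistBar 𝔸 q f) g) =
      serMul Ω.x V B (Ω.pullback f) (Ω.pullback g) := by
  ext w
  rw [pullback_conv Ω B (hf.twistBar 𝔸 q), serMul_apply]
  refine deconc_congr fun u v _ => ?_
  rw [pullback_twistBar Ω hf, V.koszul_of_mem _ (Ω.pullback_mem hg v)]
  simp only [map_smul, LinearMap.smul_apply, smul_smul, ← sgn_add]
  congr 1
  refine sgn_congr k ⟨wdeg Ω.x u * wdeg Ω.x v, by ring⟩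

/-- The Maurer-Cartan equation, coefficient by coefficient. -/
theorem sum_eth_smul_ω (u : List (Fin n)) {N : ℕ} (hN : u.length ≤ N) :
    ∑ a ∈ wordsLE n N, (Ω.eth.eth (word k a) u * (-1 : k) ^ wdeg Ω.x a) • Ω.ω a =
      𝔸.d (Ω.ω u) + deconc (fun c d => (-1 : k) ^ (wdeg Ω.x c + wdeg Ω.x c * wdeg Ω.x d) •
        (Ω.ω c * Ω.ω d)) u := by
  have h := congrFun Ω.maurerCartan u
  rw [Pi.add_apply, serD_apply, ethExt_apply _ _ _ u hN, serMul_apply] at h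
  have e1 : ∀ a, Ω.eth.eth (word k a) u • 𝔸.koszul 1 (Ω.ω a) =
      -((Ω.eth.eth (word k a) u * (-1 : k) ^ wdeg Ω.x a) • Ω.ω a) := by
    intro a
    rw [𝔸.koszul_of_mem 1 (Ω.ω_mem a), _root_.one_mul, sgn_sub, smul_smul, ← neg_smul]
    congr 1; simp
  have e2 : ∀ c d, LinearMap.mul k A (Ω.ω c) (𝔸.koszul (wdeg Ω.x c) (Ω.ω d)) =
      (-1 : k) ^ (wdeg Ω.x c + wdeg Ω.x c * wdeg Ω.x d) • (Ω.ω c * Ω.ω d) := by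
    intro c d
    rw [𝔸.koszul_of_mem _ (Ω.ω_mem d), map_smul, LinearMap.mul_apply']
    congr 1
    exact sgn_congr k ⟨-(wdeg Ω.x c * wdeg Ω.x d), by ring⟩
  simp only [e1, e2, Finset.sum_neg_distrib, Pi.zero_apply] at h
  rw [← sub_eq_zero, ← neg_eq_zero, ← h]
  abel

theorem pullback_mergeHead {f : List A → M} (hf : IsMultilin k f) (a : A) (u : List (Fin n)) :
    Ω.pullback (mergeHead 𝔸 a f) u = deconc (fun c d => (-1 : k) ^ (wdeg Ω.x c * wdeg Ω.x d) •
      Ω.pullback (hf.headL (𝔸.barSign 1 a * Ω.ω c)) d) u := by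
  cases u with
  | nil => simp [pullback_nil, mergeHead, Ω.ω_nil]
  | cons b u => exact Ω.pullback_of_ne_nil (hf.mergeHead 𝔸 a) (by simp)

/-- `ω^*` intertwines the differential `Q` of the bar construction with `ð`: both are
determined by the first piece, where this is the Maurer-Cartan equation. -/
theorem sum_eth_smul_pullback {f : List A → M} (hf : IsMultilin k f) (u : List (Fin n)) {N : ℕ}
    (hN : u.length ≤ N) :
    ∑ w ∈ wordsLE n N, (Ω.eth.eth (word k w) u * (-1 : k) ^ wdeg Ω.x w) • Ω.pullback f w =
      -Ω.pullback (barQ 𝔸 f) u := by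
  have hshrink : ∀ (f : List A → M) (u : List (Fin n)) (N : ℕ), u.length ≤ N →
      ∑ w ∈ wordsLE n N, (Ω.eth.eth (word k w) u * (-1 : k) ^ wdeg Ω.x w) • Ω.pullback f w =
      ∑ w ∈ wordsLE n u.length, (Ω.eth.eth (word k w) u * (-1 : k) ^ wdeg Ω.x w) •
        Ω.pullback f w := by
    intro f u N hN
    symm
    refine Finset.sum_subset (fun w hw => ?_) (fun w _ hw => ?_)
    · simp only [mem_wordsLE] at hw ⊢; omega
    · rw [Ω.eth.eth_word_eq_zero, zero_mul, zero_smul]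
      simpa using hw
  rw [hshrink f u N hN]
  clear hN N
  induction hN : u.length using Nat.strong_induction_on generalizing f u with
  | _ N ih =>
    subst hN
    by_cases hu : u = []
    · subst hu
      rw [pullback_nil, barQ_nil, neg_zero]
      refine Finset.sum_eq_zero fun w hw => ?_
      have hw : w = [] := by simpa using hw
      rw [hw, Ω.eth.eth_one]; simp
    set T : List (Fin n) → List (Fin n) → M := fun a b =>
      (-1 : k) ^ (wdeg Ω.x a + wdeg Ω.x b + wdeg Ω.x a * wdeg Ω.x b) •
        Ω.pullback (hf.headL (Ω.ω a)) b with hT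
    have hT0 : ∀ b, T [] b = 0 := fun b => by
      simp only [hT, Ω.ω_nil, map_zero, pullback_zero, Pi.zero_apply, smul_zero]
    have hL : ∑ w ∈ wordsLE n u.length, (Ω.eth.eth (word k w) u * (-1 : k) ^ wdeg Ω.x w) •
        Ω.pullback f w = ∑ a ∈ wordsLE n u.length, ∑ b ∈ wordsLE n u.length,
          Ω.eth.eth (word k (a ++ b)) u • T a b := by
      rw [← sum_words_deconc (fun a b => Ω.eth.eth (word k (a ++ b)) u • T a b)
        (fun a b h => by rw [Ω.eth.eth_word_eq_zero _ _ h, zero_smul])]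
      refine Finset.sum_congr rfl fun w _ => ?_
      by_cases hw : w = []
      · subst hw
        rw [deconc_nil, List.nil_append, Ω.eth.eth_one]; simp
      rw [Ω.pullback_of_ne_nil hf hw, ← deconc_smul]
      refine deconc_congr fun a b hab => ?_
      have hs : (-1 : k) ^ (wdeg Ω.x a + wdeg Ω.x b + wdeg Ω.x a * wdeg Ω.x b) =
          (-1 : k) ^ wdeg Ω.x w * (-1 : k) ^ (wdeg Ω.x a * wdeg Ω.x b) := by
        rw [← hab, wdeg_append, ← sgn_add]
      simp only [hT, smul_smul, hab, hs, _root_.mul_assoc]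
      rfl
    simp only [Ω.eth.eth_append, Pi.add_apply, Pi.smul_apply, add_smul, Finset.sum_add_distrib]
      at hL
    have hR : ∀ a b, ((-1 : k) ^ wdeg Ω.x a •
        conv (LinearMap.mul k k) (word k a) (Ω.eth.eth (word k b)) u) • T a b =
        conv (LinearMap.mul k k) (word k a) (Ω.eth.eth (word k b)) u •
          ((-1 : k) ^ wdeg Ω.x a • T a b) := by
      intro a b
      rw [smul_eq_mul, mul_comm ((-1 : k) ^ wdeg Ω.x a), mul_smul]
    simp only [hR] at hL
    rw [sum_conv_word (fun a => Ω.eth.eth (word k a)) T,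
      sum_word_conv (fun b => Ω.eth.eth (word k b)) (fun a b => (-1 : k) ^ wdeg Ω.x a • T a b)]
      at hL
    -- the terms where `ð` hits the first piece
    have h1 : ∀ v z, v ++ z = u →
        ∑ a ∈ wordsLE n u.length, Ω.eth.eth (word k a) v • T a z =
        (-1 : k) ^ (wdeg Ω.x v * wdeg Ω.x z) • Ω.pullback (hf.headL (𝔸.d (Ω.ω v))) z +
        deconc (fun c d => (-1 : k) ^ (wdeg Ω.x (c ++ d) * wdeg Ω.x z) •
          (-1 : k) ^ (wdeg Ω.x c + wdeg Ω.x c * wdeg Ω.x d) •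
            Ω.pullback (hf.headL (Ω.ω c * Ω.ω d)) z) v := by
      intro v z hvz
      have hv : v.length ≤ u.length := by rw [← hvz]; simp
      have hlin : ∀ b : A, Ω.pullback (hf.headL b) z =
        ((LinearMap.proj z ∘ₗ Ω.pullbackL) ∘ₗ hf.headL) b := fun _ => rfl
      have e : deconc (fun c d => (-1 : k) ^ (wdeg Ω.x (c ++ d) * wdeg Ω.x z) •
          (-1 : k) ^ (wdeg Ω.x c + wdeg Ω.x c * wdeg Ω.x d) •
            Ω.pullback (hf.headL (Ω.ω c * Ω.ω d)) z) v =
          (-1 : k) ^ (wdeg Ω.x v * wdeg Ω.x z) • Ω.pullback (hf.headL (deconc (fun c d =>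
            (-1 : k) ^ (wdeg Ω.x c + wdeg Ω.x c * wdeg Ω.x d) • (Ω.ω c * Ω.ω d)) v)) z := by
        rw [deconc_congr (G := fun c d => (-1 : k) ^ (wdeg Ω.x v * wdeg Ω.x z) •
          (-1 : k) ^ (wdeg Ω.x c + wdeg Ω.x c * wdeg Ω.x d) •
            Ω.pullback (hf.headL (Ω.ω c * Ω.ω d)) z) (fun c d hcd => by rw [hcd]), deconc_smul]
        simp only [hlin]
        simp only [deconc, map_sum, map_smul]
      rw [e, ← smul_add, ← Pi.add_apply, ← pullback_add, ← map_add, ← Ω.sum_eth_smul_ω v hv, hlin,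
        map_sum, Finset.smul_sum]
      refine Finset.sum_congr rfl fun a _ => ?_
      rw [map_smul, ← hlin, hT, smul_smul, smul_smul]
      by_cases h : wdeg Ω.x v = wdeg Ω.x a + 1
      · congr 1
        rw [mul_comm ((-1 : k) ^ (wdeg Ω.x v * wdeg Ω.x z)), _root_.mul_assoc, ← sgn_add, h]
        congr 1
        exact sgn_congr k ⟨0, by ring⟩
      · rw [Ω.eth.eth_word_degree _ _ h]; simp
    -- the terms where `ð` hits the other pieces
    have h2 : ∀ v z, v ++ z = u →
        ∑ b ∈ wordsLE n u.length, Ω.eth.eth (word k b) z • (-1 : k) ^ wdeg Ω.x v • T v b =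
        -((-1 : k) ^ (wdeg Ω.x v * wdeg Ω.x z) •
          Ω.pullback (barQ 𝔸 (hf.headL (𝔸.barSign 1 (Ω.ω v)))) z) := by
      intro v z hvz
      by_cases hv : v = []
      · subst hv
        have hq : barQ 𝔸 (0 : List A → M) = 0 := map_zero (barQL 𝔸)
        simp only [hT0, smul_zero, Finset.sum_const_zero, Ω.ω_nil, map_zero, hq, pullback_zero,
          Pi.zero_apply, neg_zero]
      have hz : z.length < u.length := by
        rw [← hvz, List.length_append]
        have := List.length_pos_iff.2 hv
        omega
      have := ih z.length hz (hf.cons (Ω.ω v)) z rfl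
      rw [← hshrink _ z u.length hz.le] at this
      rw [barSign_ω, _root_.one_mul, map_smul, barQ_smul, pullback_smul, Pi.smul_apply, ← smul_neg,
        ← smul_neg]
      change _ = _ • _ • -Ω.pullback (barQ 𝔸 fun w => f (Ω.ω v :: w)) z
      rw [← this, Finset.smul_sum, Finset.smul_sum]
      refine Finset.sum_congr rfl fun b _ => ?_
      rw [hT]
      simp only [smul_smul]
      by_cases h : wdeg Ω.x z = wdeg Ω.x b + 1
      · congr 1
        have : (-1 : k) ^ wdeg Ω.x v *
            (-1 : k) ^ (wdeg Ω.x v + wdeg Ω.x b + wdeg Ω.x v * wdeg Ω.x b) =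
            (-1 : k) ^ (wdeg Ω.x v * wdeg Ω.x z) * (-1 : k) ^ wdeg Ω.x v *
              (-1 : k) ^ wdeg Ω.x b := by
          rw [← sgn_add, ← sgn_add, ← sgn_add, h]
          exact sgn_congr k ⟨0, by ring⟩
        linear_combination (Ω.eth.eth (word k b) z) * this
      · rw [Ω.eth.eth_word_degree _ _ h]; simp
    rw [hL, deconc_congr h1, deconc_congr h2, deconc_add,
      Ω.pullback_of_ne_nil (hf.barQ 𝔸) hu, ← deconc_neg]
    have h3 : ∀ v z, v ++ z = u → -((-1 : k) ^ (wdeg Ω.x v * wdeg Ω.x z) •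
        Ω.pullback (fun y => barQ 𝔸 f (Ω.ω v :: y)) z) =
        (-1 : k) ^ (wdeg Ω.x v * wdeg Ω.x z) • Ω.pullback (hf.headL (𝔸.d (Ω.ω v))) z +
        deconc (fun c d => (-1 : k) ^ (wdeg Ω.x v * wdeg Ω.x (c ++ d)) •
          (-1 : k) ^ (wdeg Ω.x v + wdeg Ω.x c * wdeg Ω.x d) •
            Ω.pullback (hf.headL (Ω.ω v * Ω.ω c)) d) z +
        -((-1 : k) ^ (wdeg Ω.x v * wdeg Ω.x z) •
          Ω.pullback (barQ 𝔸 (hf.headL (𝔸.barSign 1 (Ω.ω v)))) z) := by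
      intro v z _
      have e : deconc (fun c d => (-1 : k) ^ (wdeg Ω.x v * wdeg Ω.x (c ++ d)) •
          (-1 : k) ^ (wdeg Ω.x v + wdeg Ω.x c * wdeg Ω.x d) •
            Ω.pullback (hf.headL (Ω.ω v * Ω.ω c)) d) z =
          (-1 : k) ^ (wdeg Ω.x v * wdeg Ω.x z) •
            Ω.pullback (mergeHead 𝔸 (Ω.ω v) f) z := by
        rw [Ω.pullback_mergeHead hf, ← deconc_smul]
        refine deconc_congr fun c d hcd => ?_
        rw [hcd, barSign_ω, smul_mul_assoc, map_smul, pullback_smul, Pi.smul_apply, _root_.one_mul,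
          sgn_add k (wdeg Ω.x v), mul_smul ((-1 : k) ^ wdeg Ω.x v), smul_comm ((-1 : k) ^ wdeg Ω.x v)]
      rw [e, barQ_cons', pullback_add, pullback_sub, pullback_neg]
      simp only [Pi.add_apply, Pi.sub_apply, Pi.neg_apply, smul_add, smul_sub, smul_neg]
      change -(-_ - _ + _) = _
      simp only [IsMultilin.headL, LinearMap.coe_mk, AddHom.coe_mk]
      abel
    rw [deconc_congr h3, deconc_add, deconc_add]
    congr 2
    have as := deconc_assoc (fun c d z => (-1 : k) ^ (wdeg Ω.x (c ++ d) * wdeg Ω.x z) •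
          (-1 : k) ^ (wdeg Ω.x c + wdeg Ω.x c * wdeg Ω.x d) •
            Ω.pullback (hf.headL (Ω.ω c * Ω.ω d)) z) u
    rw [as]
    refine deconc_congr fun c z _ => deconc_congr fun d z' _ => ?_
    simp only [smul_smul, ← sgn_add, wdeg_append]
    congr 2
    ring

theorem pullback_hochD0 {V : DGModule k M} {p : ℤ} {f : List A → M} (hf : f ∈ hochObj 𝔸 V p) :
    Ω.pullback (hochD0 𝔸 V p f) = serD Ω.eth V (Ω.pullback f) := by
  ext u
  rw [hochD0_eq, pullback_sub, pullback_smul, pullback_comp Ω V.d, Pi.sub_apply, Pi.smul_apply,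
    serD_apply, sub_eq_add_neg, ← smul_neg, ← Ω.sum_eth_smul_pullback hf.1 u le_rfl,
    ethExt_apply _ _ _ u le_rfl, Finset.smul_sum]
  congr 1
  refine Finset.sum_congr rfl fun w _ => ?_
  rw [koszul_ser (Ω.pullback_mem hf), smul_smul, smul_smul]
  congr 1
  ring

section
variable [Module A M] [Module Aᵐᵒᵖ M] [SMulCommClass A Aᵐᵒᵖ M] [IsScalarTower k A M]
  [IsScalarTower k Aᵐᵒᵖ M]

/-- `ω^*` is a morphism of complexes. -/
theorem pullback_hochDiff (𝔐 : DGBimodule 𝔸 M) {p : ℤ} {f : List A → M}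
    (hf : f ∈ hochObj 𝔸 𝔐.toDGModule p) :
    Ω.pullback (hochDiff 𝔸 𝔐.toDGModule p f) = Ω.diff 𝔐 p (Ω.pullback f) := by
  rw [hochDiff_eq, diff_eq, pullback_sub, pullback_add, pullback_smul, pullback_hochD0 Ω hf,
    pullback_conv_twistBar Ω _ (tau_mem 𝔸).1 hf,
    pullback_conv_twistBar Ω _ hf.1 (tau_mem 𝔸), pullback_tau, add_sub_assoc]

end

/-- `ω^*` is multiplicative. -/
theorem pullback_hochMul {p q : ℤ} {f g : List A → A} (hf : f ∈ hochObj 𝔸 𝔸.toDGModule p)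
    (hg : g ∈ hochObj 𝔸 𝔸.toDGModule q) :
    Ω.pullback (hochMul 𝔸 q f g) = Ω.mul (Ω.pullback f) (Ω.pullback g) :=
  Ω.pullback_conv_twistBar _ hf.1 hg

theorem pullback_hochOne : Ω.pullback (hochOne A) = one A n := by
  ext w
  cases w with
  | nil => rw [pullback_nil]; rfl
  | cons a w =>
    have h0 : ∀ b : A, (fun z => hochOne A (b :: z)) = 0 := fun b => rfl
    rw [pullback_cons]
    simp only [h0, pullback_zero, Pi.zero_apply, smul_zero, deconc_zero]
    rfl

end ChenConnection

/-! ### Successive approximation in the length filtration -/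

section Approximation

variable {k L M : Type*} [Field k] [AddCommGroup M] [Module k M]

/-- The functions on words which vanish on the words of length less than `N`. -/
def orderGE (k L M : Type*) [Field k] [AddCommGroup M] [Module k M] (N : ℕ) :
    Submodule k (List L → M) where
  carrier := {f | ∀ w, w.length < N → f w = 0}
  zero_mem' := fun _ _ => rfl
  add_mem' := fun hf hg w hw => by rw [Pi.add_apply, hf w hw, hg w hw, add_zero]
  smul_mem' := fun c _ hf w hw => by rw [Pi.smul_apply, hf w hw, smul_zero]

/-- If `x` can be improved by elements of `T '' Y` to satisfy stronger and stronger conditions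
`U i`, and if the correction at stage `i` has order at least `i`, then the sum of all corrections
exists, and corrects `x` to an element which satisfies all the conditions up to elements of
arbitrarily high order. -/
theorem exists_successive_approximation {X : Type*} [AddCommGroup X] [Module k X]
    (Y : Submodule k (List L → M))
    (hY : ∀ y, (∀ N, ∃ y' ∈ Y, ∀ w, w.length < N → y w = y' w) → y ∈ Y)
    (T : (List L → M) →ₗ[k] X) (F : ℕ → Submodule k X)
    (hT : ∀ N, ∀ y ∈ orderGE k L M N, T y ∈ F N) (U : ℕ → Set X)
    (step : ∀ i, ∀ x ∈ U i, ∃ y ∈ Y, y ∈ orderGE k L M i ∧ x - T y ∈ U (i + 1))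
    {x : X} (hx : x ∈ U 0) :
    ∃ y ∈ Y, ∀ N, ∃ x' ∈ U N, x - T y - x' ∈ F N := by
  choose! c hcY hcO hcU using step
  let z : ℕ → X := fun i => Nat.rec x (fun i x => x - T (c i x)) i
  have hz : ∀ i, z i ∈ U i := by
    intro i
    induction i with
    | zero => exact hx
    | succ i ih => exact hcU i _ ih
  let S : ℕ → List L → M := fun N => ∑ i ∈ Finset.range N, c i (z i)
  have hS : ∀ N, x - T (S N) = z N := by
    intro N
    induction N with
    | zero => simp [S, z]
    | succ N ih =>
      simp only [S, Finset.sum_range_succ, map_add]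
      rw [← sub_sub]
      exact congrArg (fun x => x - T (c N (z N))) ih
  have hSY : ∀ N, S N ∈ Y := fun N => sum_mem fun i _ => hcY i _ (hz i)
  let y : List L → M := fun w => S (w.length + 1) w
  have hy : ∀ N w, w.length < N → y w = S N w := by
    intro N w hw
    simp only [y, S, Finset.sum_apply]
    refine Finset.sum_subset (fun i hi => ?_) (fun i _ hi => ?_)
    · simp only [Finset.mem_range] at hi ⊢; omega
    · exact hcO i _ (hz i) w (by simp only [Finset.mem_range] at hi; omega)
  refine ⟨y, hY y fun N => ⟨S N, hSY N, hy N⟩, fun N => ⟨z N, hz N, ?_⟩⟩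
  have e : x - T y - z N = T (S N - y) := by
    rw [← hS N, map_sub]; abel
  rw [e]
  refine hT N _ fun w hw => ?_
  rw [Pi.sub_apply, hy N w hw, sub_self]

end Approximation

section

variable {k A : Type*} [Field k] [Ring A] [Algebra k A] (𝔸 : DGAlgebra k A)
  {M : Type*} [AddCommGroup M] [Module k M]

/-- The cochains are closed under limits in the length filtration. -/
theorem hochObj_of_locally {V : DGModule k M} {p : ℤ} (y : List A → M)
    (h : ∀ N, ∃ y' ∈ hochObj 𝔸 V p, ∀ w : List A, w.length < N → y w = y' w) :
    y ∈ hochObj 𝔸 V p := by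
  refine ⟨⟨fun u a b v => ?_, fun u c a v => ?_⟩, fun w => ?_⟩
  · obtain ⟨y', hy', e⟩ := h (u.length + v.length + 2)
    have l : ∀ a : A, (u ++ a :: v).length < u.length + v.length + 2 := fun a => by simp; omega
    rw [e _ (l _), e _ (l _), e _ (l _), hy'.1.add]
  · obtain ⟨y', hy', e⟩ := h (u.length + v.length + 2)
    have l : ∀ a : A, (u ++ a :: v).length < u.length + v.length + 2 := fun a => by simp; omega
    rw [e _ (l _), e _ (l _), hy'.1.smul]
  · obtain ⟨y', hy', e⟩ := h (w.length + 1)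
    rw [e _ (by simp)]
    exact hy'.2 w

theorem hochObj_cons {V : DGModule k M} {p i : ℤ} {f : List A → M} (hf : f ∈ hochObj 𝔸 V p)
    {a : A} (ha : a ∈ 𝔸.deg i) : (fun w => f (a :: w)) ∈ hochObj 𝔸 V (p + (i - 1)) := by
  refine ⟨hf.1.cons a, fun w => ?_⟩
  have := hf.2 (⟨i, a, ha⟩ :: w)
  simp only [List.map_cons, List.sum_cons] at this
  convert this using 2
  ring

theorem barQ_mem_orderGE {N : ℕ} {f : List A → M} (hf : f ∈ orderGE k A M N) :
    barQ 𝔸 f ∈ orderGE k A M N := by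
  intro w hw
  induction w generalizing f N with
  | nil => rfl
  | cons a w ih =>
    have h1 : f (𝔸.d a :: w) = 0 := hf _ (by simpa using hw)
    have h2 : mergeHead 𝔸 a f w = 0 := by
      cases w with
      | nil => rfl
      | cons b w => exact hf _ (by simp at hw ⊢; omega)
    have h3 := ih (N := N - 1) (f := fun u => f (𝔸.barSign 1 a :: u))
      (fun z hz => hf _ (by simp; omega)) (by simp at hw; omega)
    rw [barQ_cons, h1, h2, h3]; simp

/-! ### Cup products with `τ` -/

section Bimodule

variable [Module A M] [Module Aᵐᵒᵖ M] [SMulCommClass A Aᵐᵒᵖ M] [IsScalarTower k A M]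
  [IsScalarTower k Aᵐᵒᵖ M]

theorem tauCup_nil (p : ℤ) (f : List A → M) : tauCup 𝔸 M p f [] = 0 := by
  change conv (leftAct k A M) (twistBar 𝔸 p (tau A)) f [] = 0
  simp [twistBar, tau]

theorem tauCup_cons (p : ℤ) (f : List A → M) (a : A) (w : List A) :
    tauCup 𝔸 M p f (a :: w) = 𝔸.barSign p a •> f w := by
  have h : ∀ (g : List A → A) (b : A), (∀ z, g z = if z = [] then b else 0) →
      ∀ w, conv (leftAct k A M) g f w = b •> f w := by
    intro g b hg w
    cases w with
    | nil => rw [conv_nil, hg, if_pos rfl]; rfl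
    | cons c w =>
      have : (fun z => g (c :: z)) = 0 := funext fun z => by rw [hg, if_neg (by simp)]; rfl
      rw [conv_cons, hg, if_pos rfl, this, map_zero]
      simp [leftAct]
  change conv (leftAct k A M) (twistBar 𝔸 p (tau A)) f (a :: w) = _
  rw [conv_cons, h _ (𝔸.barSign p a)]
  · simp [twistBar, tau]
  · intro z
    cases z <;> simp [twistBar, tau]

theorem cupTau_nil (f : List A → M) : cupTau 𝔸 M f [] = 0 := by
  change conv (rightAct k A M) (twistBar 𝔸 1 f) (tau A) [] = 0
  simp [tau]

theorem cupTau_append (f : List A → M) (w : List A) (a : A) :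
    cupTau 𝔸 M f (w ++ [a]) = f (w.map (𝔸.barSign 1)) <• a := by
  have h : ∀ (w : List A) (g : List A → M),
      conv (rightAct k A M) g (tau A) (w ++ [a]) = g w <• a := by
    intro w
    induction w with
    | nil => intro g; simp [conv_cons, tau, rightAct]
    | cons b w ih =>
      intro g
      rw [List.cons_append, conv_cons, ih]
      have : tau A (b :: (w ++ [a])) = 0 := by cases w <;> rfl
      rw [this, map_zero, zero_add]
  exact h w (twistBar 𝔸 1 f)

theorem hochDiff_apply (V : DGModule k M) (p : ℤ) (f : List A → M) (w : List A) :
    hochDiff 𝔸 V p f w = V.d (f w) - (-1 : k) ^ p • barQ 𝔸 f w + tauCup 𝔸 M p f w -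
      (-1 : k) ^ p • cupTau 𝔸 M f w := rfl

theorem tauCup_eq_zero {N : ℕ} {f : List A → M} (hf : f ∈ orderGE k A M N) (p : ℤ) {w : List A}
    (hw : w.length ≤ N) : tauCup 𝔸 M p f w = 0 := by
  cases w with
  | nil => exact tauCup_nil 𝔸 p f
  | cons a w => rw [tauCup_cons, hf w (by simp at hw; omega), smul_zero]

theorem cupTau_eq_zero {N : ℕ} {f : List A → M} (hf : f ∈ orderGE k A M N) {w : List A}
    (hw : w.length ≤ N) : cupTau 𝔸 M f w = 0 := by
  rcases List.eq_nil_or_concat w with rfl | ⟨v, a, rfl⟩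
  · exact cupTau_nil 𝔸 f
  · rw [List.concat_eq_append] at hw ⊢
    rw [cupTau_append, hf _ (by simp at hw ⊢; omega), smul_zero]

theorem hochDiff_mem_orderGE (V : DGModule k M) (p : ℤ) {N : ℕ} {f : List A → M}
    (hf : f ∈ orderGE k A M N) : hochDiff 𝔸 V p f ∈ orderGE k A M N := by
  intro w hw
  rw [hochDiff_apply, tauCup_eq_zero 𝔸 hf p hw.le, cupTau_eq_zero 𝔸 hf hw.le, hf w hw,
    barQ_mem_orderGE 𝔸 hf w hw]
  simp

end Bimodule

/-! ### Normalized cochains -/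

/-- The functions on words which vanish when one of the first `i` letters is `1`. -/
def unitVanish (k A M : Type*) [Field k] [Ring A] [AddCommGroup M] [Module k M] (i : ℕ) :
    Submodule k (List A → M) where
  carrier := {f | ∀ u v, u.length < i → f (u ++ 1 :: v) = 0}
  zero_mem' := fun _ _ _ => rfl
  add_mem' := fun hf hg u v h => by rw [Pi.add_apply, hf u v h, hg u v h, add_zero]
  smul_mem' := fun c _ hf u v h => by rw [Pi.smul_apply, hf u v h, smul_zero]

/-- The normalized functions on words: they vanish when one of the letters is `1`. -/
def normalized (k A M : Type*) [Field k] [Ring A] [AddCommGroup M] [Module k M] :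
    Submodule k (List A → M) := ⨅ i, unitVanish k A M i

theorem normalized_apply {f : List A → M} (hf : f ∈ normalized k A M) (u v : List A) :
    f (u ++ 1 :: v) = 0 :=
  (Submodule.mem_iInf _).1 hf (u.length + 1) u v (by omega)

theorem mem_normalized {f : List A → M} (h : ∀ u v, f (u ++ 1 :: v) = 0) :
    f ∈ normalized k A M :=
  (Submodule.mem_iInf _).2 fun _ u v _ => h u v

theorem normalized_le (i : ℕ) : normalized k A M ≤ unitVanish k A M i := iInf_le _ i

theorem unitVanish.cons {i : ℕ} {f : List A → M} (hf : f ∈ unitVanish k A M (i + 1)) (a : A) :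
    (fun w => f (a :: w)) ∈ unitVanish k A M i :=
  fun u v h => hf (a :: u) v (by simpa using h)

theorem unitVanish.head {i : ℕ} {f : List A → M} (hf : f ∈ unitVanish k A M (i + 1)) :
    (fun w => f (1 :: w)) = 0 :=
  funext fun w => hf [] w (by simp)

theorem barSign_unit (s : ℤ) : 𝔸.barSign s 1 = (-1 : k) ^ s • (1 : A) := by
  rw [𝔸.barSign_of_mem s 𝔸.one_mem, zero_sub, mul_neg, mul_one, sgn_neg]

theorem barSign_one_unit : 𝔸.barSign 1 1 = -1 := by simp [barSign_unit]

theorem apply_append_neg_one {f : List A → M} (hf : IsMultilin k f) (u v : List A) :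
    f (u ++ (-1) :: v) = -f (u ++ 1 :: v) := by
  simpa using hf.smul u (-1) 1 v

theorem barQ_zero : barQ 𝔸 (0 : List A → M) = 0 := map_zero (barQL 𝔸)

/-- Only the two ends of the word contribute to `f ∘ Q` on a word with a letter `1`: otherwise
the products of `1` with its two neighbours cancel. -/
theorem barQ_append_one {i : ℕ} {f : List A → M} (hf : IsMultilin k f)
    (hi : f ∈ unitVanish k A M i) {u : List A} (hu : u.length < i) (v : List A) :
    barQ 𝔸 f (u ++ 1 :: v) =
      (if u = [] then f v else 0) - (if v = [] then f (u.map (𝔸.barSign 1)) else 0) := by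
  induction u generalizing f i with
  | nil =>
    obtain ⟨i, rfl⟩ : ∃ j, i = j + 1 := ⟨i - 1, by simp at hu; omega⟩
    have e : (fun w => f (𝔸.barSign 1 1 :: w)) = 0 := by
      rw [barSign_one_unit]
      funext w
      rw [hf.head_neg, congrFun (unitVanish.head hi) w]; simp
    rw [List.nil_append, barQ_cons, e, barQ_zero, 𝔸.d_one, hf.head_zero]
    cases v with
    | nil => simp [mergeHead]
    | cons b v => simp [mergeHead, barSign_one_unit, hf.head_neg]
  | cons a u ih =>
    obtain ⟨i, rfl⟩ : ∃ j, i = j + 1 := ⟨i - 1, by simp at hu; omega⟩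
    have hu' : u.length < i := by simpa using hu
    have h1 : f (𝔸.d a :: (u ++ 1 :: v)) = 0 := hi (𝔸.d a :: u) v hu
    rw [List.cons_append, barQ_cons, ih (hf.cons _) (unitVanish.cons hi _) hu', h1]
    cases u with
    | nil => by_cases hv : v = [] <;> simp [mergeHead, hv]
    | cons b u =>
      have h2 : f (𝔸.barSign 1 a * b :: (u ++ 1 :: v)) = 0 :=
        hi (_ :: u) v (by simp at hu ⊢; omega)
      simp only [mergeHead, List.cons_append, h2]
      simp

/-- Inserting a letter `1` after the first `i` letters:
`[a₁, …, aₘ] ↦ ± f [a₁, …, aᵢ, 1, aᵢ₊₁, …, aₘ]`, with the Koszul sign for moving `1`, which has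
shifted degree `-1`, past `a₁, …, aᵢ`; it is zero for `m < i`. -/
def insertOne : ℕ → (List A → M) → List A → M
  | 0, f, w => f (1 :: w)
  | _ + 1, _, [] => 0
  | i + 1, f, a :: w => insertOne i (fun z => f (𝔸.barSign 1 a :: z)) w

theorem insertOne_add (i : ℕ) (f g : List A → M) (w : List A) :
    insertOne 𝔸 i (f + g) w = insertOne 𝔸 i f w + insertOne 𝔸 i g w := by
  induction i generalizing f g w with
  | zero => rfl
  | succ i ih =>
    cases w with
    | nil => simp [insertOne]
    | cons a w => exact ih _ _ w

theorem insertOne_smul (i : ℕ) (c : k) (f : List A → M) (w : List A) :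
    insertOne 𝔸 i (c • f) w = c • insertOne 𝔸 i f w := by
  induction i generalizing f w with
  | zero => rfl
  | succ i ih =>
    cases w with
    | nil => simp [insertOne]
    | cons a w => exact ih _ w

theorem insertOne_zero (i : ℕ) (w : List A) : insertOne 𝔸 i (0 : List A → M) w = 0 := by
  simpa using insertOne_smul 𝔸 i 0 (0 : List A → M) w

theorem insertOne_append {i : ℕ} (f : List A → M) {u : List A} (hu : u.length = i)
    (v : List A) : insertOne 𝔸 i f (u ++ v) = f (u.map (𝔸.barSign 1) ++ 1 :: v) := by
  subst hu
  induction u generalizing f with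
  | nil => rfl
  | cons a u ih => exact ih _

theorem insertOne_mem_orderGE (i : ℕ) (f : List A → M) : insertOne 𝔸 i f ∈ orderGE k A M i := by
  intro w hw
  induction i generalizing f w with
  | zero => simp at hw
  | succ i ih =>
    cases w with
    | nil => rfl
    | cons a w => exact ih _ w (by simpa using hw)

theorem IsMultilin.insertOne {f : List A → M} (hf : IsMultilin k f) (i : ℕ) :
    IsMultilin k (insertOne 𝔸 i f) := by
  induction i generalizing f with
  | zero => exact hf.cons 1
  | succ i ih =>
    refine .of_cons (fun a b w => ?_) (fun c a w => ?_) (fun a => ih (hf.cons _))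
    · simp only [ChenHoch.insertOne, map_add]
      rw [cons_add hf, insertOne_add]
    · simp only [ChenHoch.insertOne, map_smul]
      rw [cons_smul hf, insertOne_smul]

theorem insertOne_hoch_mem {V : DGModule k M} {p : ℤ} {f : List A → M}
    (hf : f ∈ hochObj 𝔸 V p) (i : ℕ) : insertOne 𝔸 i f ∈ hochObj 𝔸 V (p - 1) := by
  refine ⟨hf.1.insertOne 𝔸 i, fun w => ?_⟩
  induction i generalizing f p w with
  | zero =>
    have := hf.2 (⟨0, 1, 𝔸.one_mem⟩ :: w)
    simp only [List.map_cons, List.sum_cons] at this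
    change f (1 :: _) ∈ _
    convert this using 2
    ring
  | succ i ih =>
    cases w with
    | nil => exact zero_mem _
    | cons x w =>
      have := ih (hochObj_cons 𝔸 hf (𝔸.barSign_mem 1 x.2.2)) w
      simp only [List.map_cons, List.sum_cons, insertOne]
      convert this using 2
      ring

theorem insertOne_mem_unitVanish {f : List A → M} (hf : IsMultilin k f) {i j : ℕ}
    (hi : f ∈ unitVanish k A M j) (hj : j ≤ i) : insertOne 𝔸 i f ∈ unitVanish k A M j := by
  intro u v hu
  induction u generalizing f i j with
  | nil =>
    obtain ⟨j, rfl⟩ : ∃ l, j = l + 1 := ⟨j - 1, by simp at hu; omega⟩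
    obtain ⟨i, rfl⟩ : ∃ l, i = l + 1 := ⟨i - 1, by omega⟩
    have e : (fun w => f (𝔸.barSign 1 1 :: w)) = 0 := by
      rw [barSign_one_unit]
      funext w
      rw [hf.head_neg, congrFun (unitVanish.head hi) w]; simp
    rw [List.nil_append, insertOne, e, insertOne_zero]
  | cons a u ih =>
    obtain ⟨j, rfl⟩ : ∃ l, j = l + 1 := ⟨j - 1, by simp at hu; omega⟩
    obtain ⟨i, rfl⟩ : ∃ l, i = l + 1 := ⟨i - 1, by omega⟩
    exact ih (hf.cons _) (unitVanish.cons hi _) (by omega) (by simpa using hu)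

/-- The bar differential of the insertion of `1`, on a word with another letter `1` at the place
of insertion. -/
theorem barQ_insertOne {f : List A → M} (hf : IsMultilin k f) {u : List A}
    (hu : f ∈ unitVanish k A M u.length) (v : List A) :
    barQ 𝔸 (insertOne 𝔸 u.length f) (u ++ 1 :: v) +
        barQ 𝔸 f (u.map (𝔸.barSign 1) ++ 1 :: 1 :: v) =
      if u = [] then f (1 :: v) else -f (u ++ 1 :: v) := by
  induction u generalizing f with
  | nil =>
    have e : (fun w => f (𝔸.barSign 1 1 :: w)) = -fun w => f (1 :: w) := by
      rw [barSign_one_unit]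
      exact funext fun w => hf.head_neg _ w
    have e' : insertOne 𝔸 0 f = fun w => f (1 :: w) := rfl
    rw [List.map_nil, List.nil_append, List.nil_append, barQ_cons 𝔸 f, e, barQ_neg, 𝔸.d_one,
      hf.head_zero, List.length_nil, e']
    simp [mergeHead, barSign_one_unit, hf.head_neg]
  | cons a u ih =>
    have hi := ih (hf.cons a) (unitVanish.cons hu a)
    have e1 : (fun w => insertOne 𝔸 (u.length + 1) f (𝔸.barSign 1 a :: w)) =
        insertOne 𝔸 u.length (fun w => f (a :: w)) := by
      funext w
      simp only [insertOne, barSign_barSign_one]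
    have e2 : insertOne 𝔸 (u.length + 1) f (𝔸.d a :: (u ++ 1 :: v)) =
        -f (𝔸.d (𝔸.barSign 1 a) :: (u.map (𝔸.barSign 1) ++ 1 :: 1 :: v)) := by
      simp only [insertOne]
      rw [insertOne_append 𝔸 _ rfl, barSign_d, hf.head_neg]
    simp only [List.length_cons, List.cons_append, List.map_cons]
    rw [barQ_cons, barQ_cons 𝔸 f, e1, e2]
    simp only [barSign_barSign_one]
    rw [if_neg (by simp)]
    cases u with
    | nil =>
      simp only [List.length_nil, List.nil_append, List.map_nil, if_true] at hi ⊢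
      simp only [mergeHead, insertOne, barSign_barSign_one, mul_one]
      have e0 : (fun x => f (a :: 1 :: x)) = insertOne 𝔸 0 (fun w => f (a :: w)) := rfl
      rw [e0, eq_sub_of_add_eq hi]
      abel
    | cons b u =>
      -- the letter `1` stays to the left of the inserted one
      have m1 : mergeHead 𝔸 a (insertOne 𝔸 ((b :: u).length + 1) f) (b :: u ++ 1 :: v) = 0 := by
        simp only [mergeHead, List.cons_append, List.length_cons]
        rw [insertOne]
        have := insertOne_append 𝔸 (fun z => f (𝔸.barSign 1 (𝔸.barSign 1 a * b) :: z))
          (u := u ++ [1]) (i := u.length + 1) (by simp) v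
        rw [List.append_assoc] at this
        have e : u ++ 1 :: v = u ++ ([1] ++ v) := rfl
        rw [e, this, List.map_append, List.map_singleton, barSign_one_unit, List.append_assoc]
        change f (_ :: (u.map _ ++ (-1) :: 1 :: v)) = 0
        rw [← List.cons_append, apply_append_neg_one hf]
        exact neg_eq_zero.2 (hu _ _ (by simp))
      have m2 : mergeHead 𝔸 (𝔸.barSign 1 a) f ((b :: u).map (𝔸.barSign 1) ++ 1 :: 1 :: v) = 0 :=
        hu (_ :: u.map (𝔸.barSign 1)) _ (by simp)
      rw [if_neg (by simp)] at hi
      rw [m1, m2, eq_sub_of_add_eq hi]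
      abel

section Bimodule

variable [Module A M] [Module Aᵐᵒᵖ M] [SMulCommClass A Aᵐᵒᵖ M] [IsScalarTower k A M]
  [IsScalarTower k Aᵐᵒᵖ M]

theorem map_append_one (u v : List A) : (u ++ 1 :: v).map (𝔸.barSign 1) =
    u.map (𝔸.barSign 1) ++ (-1) :: v.map (𝔸.barSign 1) := by
  rw [List.map_append, List.map_cons, barSign_one_unit]

theorem hochDiff_mem_unitVanish (V : DGModule k M) (p : ℤ) {i : ℕ} {f : List A → M}
    (hf : IsMultilin k f) (hi : f ∈ unitVanish k A M i) :
    hochDiff 𝔸 V p f ∈ unitVanish k A M i := by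
  intro u v hu
  have h1 : tauCup 𝔸 M p f (u ++ 1 :: v) = (-1 : k) ^ p • (if u = [] then f v else 0) := by
    cases u with
    | nil => simp [tauCup_cons, barSign_unit]
    | cons a u =>
      rw [List.cons_append, tauCup_cons, hi u v (by simp at hu; omega)]
      simp
  have h2 : cupTau 𝔸 M f (u ++ 1 :: v) = if v = [] then f (u.map (𝔸.barSign 1)) else 0 := by
    rcases List.eq_nil_or_concat v with rfl | ⟨v, a, rfl⟩
    · simp [cupTau_append]
    · have e : u ++ 1 :: v.concat a = (u ++ 1 :: v) ++ [a] := by simp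
      rw [e, cupTau_append, map_append_one, apply_append_neg_one hf, hi _ _ (by simpa using hu)]
      simp
  rw [hochDiff_apply, h1, h2, hi u v hu, barQ_append_one 𝔸 hf hi hu]
  simp only [map_zero, smul_sub]
  abel

theorem hochDiff_mem_normalized (V : DGModule k M) (p : ℤ) {f : List A → M}
    (hf : IsMultilin k f) (h : f ∈ normalized k A M) : hochDiff 𝔸 V p f ∈ normalized k A M :=
  (Submodule.mem_iInf _).2 fun i => hochDiff_mem_unitVanish 𝔸 V p hf (normalized_le i h)

/-- Inserting `1` after `i` letters is, on the words whose next letter is `1`, a contracting homotopy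
for the cochains which already vanish when one of the first `i` letters is `1`. -/
theorem hochDiff_insertOne (V : DGModule k M) (p : ℤ) {f : List A → M} (hf : IsMultilin k f)
    {u : List A} (hu : f ∈ unitVanish k A M u.length) (v : List A) :
    hochDiff 𝔸 V (p - 1) (insertOne 𝔸 u.length f) (u ++ 1 :: v) =
      hochDiff 𝔸 V p f (u.map (𝔸.barSign 1) ++ 1 :: 1 :: v) - (-1 : k) ^ p • f (u ++ 1 :: v) := by
  have hs : (-1 : k) ^ (p - 1) = -(-1 : k) ^ p := by rw [sgn_sub]; simp
  have h0 : insertOne 𝔸 u.length f (u ++ 1 :: v) = f (u.map (𝔸.barSign 1) ++ 1 :: 1 :: v) :=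
    insertOne_append 𝔸 f rfl _
  have h1 : tauCup 𝔸 M (p - 1) (insertOne 𝔸 u.length f) (u ++ 1 :: v) -
      tauCup 𝔸 M p f (u.map (𝔸.barSign 1) ++ 1 :: 1 :: v) =
      -(-1 : k) ^ p • (if u = [] then (2 : ℤ) • f (1 :: v) else 0) := by
    cases u with
    | nil =>
      simp only [List.nil_append, List.map_nil, tauCup_cons, barSign_unit, hs, List.length_nil,
        insertOne, if_true, two_smul]
      simp
      abel
    | cons a u =>
      have e : insertOne 𝔸 (a :: u).length f (u ++ 1 :: v) = 0 := by
        have := insertOne_append 𝔸 f (u := u ++ [1]) (i := (a :: u).length) (by simp) v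
        rw [List.append_assoc, map_append_one, List.append_assoc] at this
        change insertOne 𝔸 _ f (u ++ ([1] ++ v)) = 0
        rw [this]
        change f (u.map _ ++ (-1) :: _) = 0
        rw [apply_append_neg_one hf, hu _ _ (by simp), neg_zero]
      have e' : f (u.map (𝔸.barSign 1) ++ 1 :: 1 :: v) = 0 := hu _ _ (by simp)
      rw [List.cons_append, List.map_cons, List.cons_append, tauCup_cons, tauCup_cons, e, e']
      simp
  have h2 : cupTau 𝔸 M (insertOne 𝔸 u.length f) (u ++ 1 :: v) =
      -cupTau 𝔸 M f (u.map (𝔸.barSign 1) ++ 1 :: 1 :: v) := by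
    have hσ : ∀ u : List A, (u.map (𝔸.barSign 1)).map (𝔸.barSign 1) = u := fun u => by
      rw [List.map_map]
      conv_rhs => rw [← List.map_id u]
      exact List.map_congr_left fun a _ => barSign_barSign_one 𝔸 a
    rcases List.eq_nil_or_concat v with rfl | ⟨v, a, rfl⟩
    · have e : u.map (𝔸.barSign 1) ++ [1, 1] = (u.map (𝔸.barSign 1) ++ [1]) ++ [1] := by simp
      have e' : insertOne 𝔸 u.length f (u.map (𝔸.barSign 1)) = f (u ++ [1]) := by
        have := insertOne_append 𝔸 f (u := u.map (𝔸.barSign 1)) (i := u.length) (by simp) []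
        rw [List.append_nil, hσ] at this
        exact this
      rw [e, cupTau_append, cupTau_append, e', map_append_one, hσ, List.map_nil,
        apply_append_neg_one hf]
      simp
    · have e : u ++ 1 :: v.concat a = (u ++ 1 :: v) ++ [a] := by simp
      have e' : u.map (𝔸.barSign 1) ++ 1 :: 1 :: v.concat a =
        (u.map (𝔸.barSign 1) ++ 1 :: 1 :: v) ++ [a] := by simp
      rw [e, e', cupTau_append, cupTau_append, map_append_one, map_append_one, hσ, List.map_cons,
        barSign_one_unit, insertOne_append 𝔸 f (by simp), hσ, apply_append_neg_one hf]
      have := apply_append_neg_one hf (u ++ [1]) (v.map (𝔸.barSign 1))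
      simp only [List.append_assoc, List.singleton_append] at this
      rw [this, smul_neg, neg_neg]
  have h3 := barQ_insertOne 𝔸 hf hu v
  rw [hochDiff_apply, hochDiff_apply, h0, eq_add_of_sub_eq h1, h2, eq_sub_of_add_eq h3, hs]
  by_cases h : u = []
  · subst h
    simp only [if_true, List.nil_append, List.map_nil, two_smul, smul_add, smul_sub, smul_neg,
      neg_smul]
    abel
  · simp only [if_neg h, smul_zero, smul_sub, smul_neg, neg_smul]
    abel

variable {𝔸} in
/-- A cochain with normalized differential is normalized up to a coboundary. -/
theorem exists_normalized (𝔐 : DGBimodule 𝔸 M) {p : ℤ} {f : List A → M}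
    (hf : f ∈ hochObj 𝔸 𝔐.toDGModule p)
    (hn : hochDiff 𝔸 𝔐.toDGModule p f ∈ normalized k A M) :
    ∃ g ∈ hochObj 𝔸 𝔐.toDGModule (p - 1),
      f - hochDiff 𝔸 𝔐.toDGModule (p - 1) g ∈ normalized k A M := by
  have hmem : ∀ g ∈ hochObj 𝔸 𝔐.toDGModule (p - 1),
      hochDiff 𝔸 𝔐.toDGModule (p - 1) g ∈ hochObj 𝔸 𝔐.toDGModule p := by
    intro g hg
    have := hochDiff_mem 𝔐 hg
    rwa [sub_add_cancel] at this
  have hdd : ∀ g ∈ hochObj 𝔸 𝔐.toDGModule (p - 1),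
      hochDiff 𝔸 𝔐.toDGModule p (hochDiff 𝔸 𝔐.toDGModule (p - 1) g) = 0 := by
    intro g hg
    have := hochDiff_hochDiff 𝔐 hg
    rwa [sub_add_cancel] at this
  obtain ⟨g, hg, h⟩ := exists_successive_approximation (hochObj 𝔸 𝔐.toDGModule (p - 1))
    (hochObj_of_locally 𝔸) (hochDiff 𝔸 𝔐.toDGModule (p - 1)) (orderGE k A M)
    (fun N y hy => hochDiff_mem_orderGE 𝔸 _ _ hy)
    (fun i => {x | x ∈ hochObj 𝔸 𝔐.toDGModule p ∧
      hochDiff 𝔸 𝔐.toDGModule p x ∈ normalized k A M ∧ x ∈ unitVanish k A M i})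
    (fun i x hx => by
      obtain ⟨h1, h2, h3⟩ := hx
      have hy : -(-1 : k) ^ p • insertOne 𝔸 i x ∈ hochObj 𝔸 𝔐.toDGModule (p - 1) :=
        Submodule.smul_mem _ _ (insertOne_hoch_mem 𝔸 h1 i)
      refine ⟨_, hy, Submodule.smul_mem _ _ (insertOne_mem_orderGE 𝔸 i x),
        sub_mem h1 (hmem _ hy), ?_, fun u v hu => ?_⟩
      · rwa [map_sub, hdd _ hy, sub_zero]
      rcases Nat.lt_succ_iff_lt_or_eq.1 hu with hu | rfl
      · refine sub_mem h3 (hochDiff_mem_unitVanish 𝔸 _ _ hy.1 ?_) u v hu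
        exact Submodule.smul_mem _ _ (insertOne_mem_unitVanish 𝔸 h1.1 h3 le_rfl)
      · rw [Pi.sub_apply, map_smul, Pi.smul_apply, hochDiff_insertOne 𝔸 _ p h1.1 h3,
          normalized_apply h2, zero_sub, smul_neg, neg_smul, neg_neg, smul_smul, sgn_mul_self,
          one_smul, sub_self])
    (x := f) ⟨hf, hn, fun u v hu => by simp at hu⟩
  refine ⟨g, hg, mem_normalized fun u v => ?_⟩
  obtain ⟨x, hx, e⟩ := h ((u ++ 1 :: v).length + 1)
  have := e (u ++ 1 :: v) (by omega)
  rw [Pi.sub_apply, sub_eq_zero] at this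
  rw [this]
  exact hx.2.2 u v (by simp)

end Bimodule

end

/-! ### The contraction of `A` onto its cohomology -/

/-- Cycles representing a basis of the homology of a differential `d` yield a homotopy between the
identity and a projection onto their span.  With a linear map `ρ` such that `d ρ d = d`, the map
`1 - ρ d` is a projection onto the cycles, and the homotopy is `ρ (1 - ρ d - P)`. -/
theorem exists_homotopy_of_basis {k A ι : Type*} [Field k] [AddCommGroup A] [Module k A]
    [Fintype ι] [DecidableEq ι] (d : A →ₗ[k] A) (hd : ∀ a, d (d a) = 0) (b : ι → A)
    (hb : ∀ i, d (b i) = 0) (hli : ∀ c : ι → k, ∑ i, c i • b i ∈ LinearMap.range d → c = 0)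
    (hsp : ∀ z, d z = 0 → ∃ c : ι → k, z - ∑ i, c i • b i ∈ LinearMap.range d) :
    ∃ (h : A →ₗ[k] A) (l : A →ₗ[k] (ι → k)),
      (∀ a, d (h a) + h (d a) = a - ∑ i, l a i • b i) ∧ (∀ i, h (b i) = 0) ∧
      (∀ i, l (b i) = Pi.single i 1) ∧ ∀ a, l (d a) = 0 := by
  obtain ⟨s, hs⟩ := LinearMap.exists_rightInverse_of_surjective d.rangeRestrict
    (LinearMap.range_eq_top.2 d.surjective_rangeRestrict)
  obtain ⟨ρ, hρ⟩ := LinearMap.exists_extend s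
  have hρd : ∀ y ∈ LinearMap.range d, d (ρ y) = y := by
    intro y hy
    have h1 := LinearMap.congr_fun hρ ⟨y, hy⟩
    have h2 := LinearMap.congr_fun hs ⟨y, hy⟩
    simp only [LinearMap.comp_apply, Submodule.subtype_apply, LinearMap.id_apply] at h1 h2
    rw [h1]
    exact congrArg Subtype.val h2
  let Q := (LinearMap.range d).mkQ
  let B : (ι → k) →ₗ[k] A := Fintype.linearCombination k b
  have hB : ∀ c, B c = ∑ i, c i • b i := fun c => Fintype.linearCombination_apply k b c
  have hQ : ∀ y, Q y = 0 ↔ y ∈ LinearMap.range d := fun y => Submodule.Quotient.mk_eq_zero _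
  obtain ⟨μ, hμ⟩ := LinearMap.exists_leftInverse_of_injective (Q ∘ₗ B) (by
    rw [LinearMap.ker_eq_bot']
    intro c hc
    rw [LinearMap.comp_apply, hQ, hB] at hc
    exact hli c hc)
  have hμ' : ∀ c, μ (Q (B c)) = c := fun c => LinearMap.congr_fun hμ c
  let z : A →ₗ[k] A := LinearMap.id - ρ ∘ₗ d
  have hz : ∀ a, z a = a - ρ (d a) := fun _ => rfl
  have hzker : ∀ a, d a = 0 → z a = a := fun a ha => by rw [hz, ha, map_zero, sub_zero]
  have hdz : ∀ a, d (z a) = 0 := fun a => by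
    rw [hz, map_sub, hρd _ ⟨a, rfl⟩, sub_self]
  let l : A →ₗ[k] (ι → k) := μ ∘ₗ Q ∘ₗ z
  have hl : ∀ a, l a = μ (Q (z a)) := fun _ => rfl
  have hlb : ∀ i, l (b i) = Pi.single i 1 := fun i => by
    have e : b i = B (Pi.single i 1) := by
      rw [hB, Finset.sum_eq_single i] <;> simp +contextual
    rw [hl, hzker _ (hb i), e, hμ']
  have hld : ∀ a, l (d a) = 0 := fun a => by
    rw [hl, hzker _ (hd a), (hQ _).2 ⟨a, rfl⟩, map_zero]
  have hrange : ∀ a, z a - B (l a) ∈ LinearMap.range d := by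
    intro a
    obtain ⟨c, hc⟩ := hsp (z a) (hdz a)
    rw [← hB, ← hQ, map_sub, sub_eq_zero] at hc
    rw [← hQ, map_sub, sub_eq_zero, hl, hc, hμ']
  refine ⟨ρ ∘ₗ (z - B ∘ₗ l), l, fun a => ?_, fun i => ?_, hlb, hld⟩
  · simp only [LinearMap.comp_apply, LinearMap.sub_apply]
    rw [hρd _ (hrange a), hld, map_zero, sub_zero, hzker _ (hd a), hz, hB]
    abel
  · have e : B (Pi.single i 1) = b i := by
      rw [hB, Finset.sum_eq_single i] <;> simp +contextual
    simp only [LinearMap.comp_apply, LinearMap.sub_apply]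
    rw [hlb, e, hzker _ (hb i), sub_self, map_zero]

theorem directSum_coe_sum_smul {k ι : Type*} [Field k] [Fintype ι] {H : ℤ → Type*}
    [∀ p, AddCommGroup (H p)] [∀ p, Module k (H p)] (c : ι → k) (v : ι → ⨁ p, H p) :
    ((∑ i, c i • v i : ⨁ p, H p) : ∀ p, H p) = ∑ i, c i • (v i : ∀ p, H p) := by
  have := map_sum (DirectSum.coeFnLinearMap k (M := H)) (fun i => c i • v i) Finset.univ
  simp only [map_smul] at this
  exact this

namespace DGModule

variable {k M : Type*} [Field k] [AddCommGroup M] [Module k M] (V : DGModule k M)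

/-- The projection onto the homogeneous component of degree `i`. -/
def proj (i : ℤ) : M →ₗ[k] M :=
  (V.deg i).subtype ∘ₗ DirectSum.component k ℤ (fun i => V.deg i) i ∘ₗ
    (DirectSum.decomposeLinearEquiv V.deg).toLinearMap

theorem proj_apply (i : ℤ) (m : M) : V.proj i m = DirectSum.decompose V.deg m i := rfl

theorem proj_mem (i : ℤ) (m : M) : V.proj i m ∈ V.deg i := Subtype.mem _

theorem proj_of_mem {i : ℤ} {m : M} (h : m ∈ V.deg i) : V.proj i m = m := by
  rw [proj_apply, DirectSum.decompose_of_mem_same _ h]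

theorem proj_of_mem_ne {i j : ℤ} {m : M} (h : m ∈ V.deg i) (hij : i ≠ j) : V.proj j m = 0 := by
  rw [proj_apply, DirectSum.decompose_of_mem_ne _ h hij]

theorem d_proj (i : ℤ) (m : M) : V.d (V.proj i m) = V.proj (i + 1) (V.d m) := by
  induction m using V.hom_induction with
  | h0 => simp
  | hom j m hm =>
    by_cases h : j = i
    · subst h
      rw [V.proj_of_mem hm, V.proj_of_mem (V.d_mem hm)]
    · rw [V.proj_of_mem_ne hm h, V.proj_of_mem_ne (V.d_mem hm) (by omega), map_zero]
  | add a b ha hb => simp only [map_add, ha, hb]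

theorem mem_of_proj_mem {S : Submodule k M} {m : M} (h : ∀ i, V.proj i m ∈ S) : m ∈ S := by
  classical
  rw [← DirectSum.sum_support_decompose V.deg m]
  exact sum_mem fun i _ => h i

/-- The homogeneous part of degree `r` of a linear operator. -/
def homPart (r : ℤ) (φ : M →ₗ[k] M) : M →ₗ[k] M :=
  DirectSum.toModule k ℤ M (fun i => V.proj (i + r) ∘ₗ φ ∘ₗ (V.deg i).subtype) ∘ₗ
    (DirectSum.decomposeLinearEquiv V.deg).toLinearMap

theorem homPart_of_mem (r : ℤ) (φ : M →ₗ[k] M) {i : ℤ} {m : M} (h : m ∈ V.deg i) :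
    V.homPart r φ m = V.proj (i + r) (φ m) := by
  lift m to V.deg i using h
  simp [homPart]

/-- The cocycles `ker d` map to the product of all cohomology groups. -/
def clsPi : LinearMap.ker V.d →ₗ[k] (∀ p, V.toCx.H p) :=
  LinearMap.pi fun p => Submodule.mkQ _ ∘ₗ
    LinearMap.codRestrict (V.toCx.cocycle p) (V.proj p ∘ₗ (LinearMap.ker V.d).subtype)
      fun z => ⟨V.proj_mem p _, by
        have hz : V.d z = 0 := z.2
        change V.d (V.proj p z) = 0
        rw [V.d_proj, hz, map_zero]⟩

theorem clsPi_eq_zero_iff (z : LinearMap.ker V.d) :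
    V.clsPi z = 0 ↔ (z : M) ∈ LinearMap.range V.d := by
  have h1 : V.clsPi z = 0 ↔ ∀ p, V.proj p z ∈ V.toCx.coboundary p := by
    rw [funext_iff]
    exact forall_congr' fun p => Submodule.Quotient.mk_eq_zero _
  rw [h1]
  constructor
  · intro h
    refine V.mem_of_proj_mem fun p => ?_
    obtain ⟨y, _, hy⟩ := h p
    exact ⟨y, hy⟩
  · rintro ⟨y, hy⟩ p
    refine ⟨V.proj (p - 1) y, V.proj_mem _ _, ?_⟩
    change V.d (V.proj (p - 1) y) = _
    rw [V.d_proj, sub_add_cancel, hy]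

theorem clsPi_of_mem {p : ℤ} {z : M} (hz : z ∈ V.toCx.cocycle p) :
    V.clsPi ⟨z, hz.2⟩ = (DirectSum.lof k ℤ V.toCx.H p (V.toCx.cls p z hz) : ∀ q, V.toCx.H q) := by
  funext q
  by_cases h : p = q
  · subst h
    rw [DirectSum.lof_apply]
    change Submodule.Quotient.mk _ = Submodule.Quotient.mk _
    congr 1
    exact Subtype.ext (V.proj_of_mem hz.1)
  · have e : (DirectSum.lof k ℤ V.toCx.H p (V.toCx.cls p z hz) : ∀ q, V.toCx.H q) q = 0 :=
      DirectSum.of_eq_of_ne p q _ (Ne.symm h)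
    rw [e]
    refine (Submodule.Quotient.mk_eq_zero _).2 ?_
    change V.proj q z ∈ V.toCx.coboundary q
    rw [V.proj_of_mem_ne hz.1 h]
    exact zero_mem _

end DGModule

namespace ChenConnection

variable {k A : Type*} [Field k] [Ring A] [Algebra k A] {𝔸 : DGAlgebra k A} {n : ℕ}
  (Ω : ChenConnection 𝔸 n)

/-- The cocycles `1, e₁, …, eₙ`. -/
def basisCocycle : Option (Fin n) → A
  | none => 1
  | some i => Ω.e i

/-- The degrees of `1, e₁, …, eₙ`. -/
def basisDeg : Option (Fin n) → ℤ
  | none => 0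
  | some i => Ω.deg i

theorem basisCocycle_mem (o : Option (Fin n)) :
    Ω.basisCocycle o ∈ 𝔸.toCx.cocycle (Ω.basisDeg o) := by
  cases o with
  | none => exact 𝔸.one_cocycle
  | some i => exact Ω.e_cocycle i

theorem d_basisCocycle (o : Option (Fin n)) : 𝔸.d (Ω.basisCocycle o) = 0 :=
  (Ω.basisCocycle_mem o).2

theorem clsPi_sum (c : Option (Fin n) → k) (h : 𝔸.d (∑ o, c o • Ω.basisCocycle o) = 0) :
    𝔸.clsPi ⟨∑ o, c o • Ω.basisCocycle o, h⟩ =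
      (∑ o, c o • cohomFamily 𝔸 Ω.deg Ω.e Ω.e_cocycle o : ⨁ p, 𝔸.toCx.H p) := by
  have e : (⟨∑ o, c o • Ω.basisCocycle o, h⟩ : LinearMap.ker 𝔸.d) =
      ∑ o, c o • ⟨Ω.basisCocycle o, Ω.d_basisCocycle o⟩ := by
    apply Subtype.ext
    simp
  have e1 : ∀ o, 𝔸.clsPi ⟨Ω.basisCocycle o, Ω.d_basisCocycle o⟩ =
      (cohomFamily 𝔸 Ω.deg Ω.e Ω.e_cocycle o : ∀ p, 𝔸.toCx.H p) := by
    intro o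
    rw [𝔸.clsPi_of_mem (Ω.basisCocycle_mem o)]
    cases o <;> rfl
  rw [e, map_sum]
  simp only [map_smul, e1]
  exact (directSum_coe_sum_smul c _).symm

theorem eq_zero_of_sum_mem_range (c : Option (Fin n) → k)
    (h : ∑ o, c o • Ω.basisCocycle o ∈ LinearMap.range 𝔸.d) : c = 0 := by
  have h0 : 𝔸.d (∑ o, c o • Ω.basisCocycle o) = 0 := by
    simp [map_sum, d_basisCocycle]
  have h1 := (𝔸.clsPi_eq_zero_iff ⟨_, h0⟩).2 h
  rw [clsPi_sum] at h1
  have h2 : (∑ o, c o • cohomFamily 𝔸 Ω.deg Ω.e Ω.e_cocycle o : ⨁ p, 𝔸.toCx.H p) = 0 :=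
    DFinsupp.ext fun p => congrFun h1 p
  refine funext (Fintype.linearIndependent_iffₛ.1 Ω.linearIndependent c 0 ?_)
  rw [h2]
  simp

theorem exists_sub_sum_mem_range (z : A) (hz : 𝔸.d z = 0) :
    ∃ c : Option (Fin n) → k, z - ∑ o, c o • Ω.basisCocycle o ∈ LinearMap.range 𝔸.d := by
  have h : z ∈ Submodule.span k (Set.range Ω.basisCocycle) ⊔ LinearMap.range 𝔸.d := by
    refine 𝔸.mem_of_proj_mem fun p => ?_
    have hp : 𝔸.proj p z ∈ 𝔸.toCx.cocycle p := by
      refine ⟨𝔸.proj_mem p z, ?_⟩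
      change 𝔸.d (𝔸.proj p z) = 0
      rw [𝔸.d_proj, hz, map_zero]
    have h1 : DirectSum.lof k ℤ 𝔸.toCx.H p (𝔸.toCx.cls p _ hp) ∈
        Submodule.span k (Set.range (cohomFamily 𝔸 Ω.deg Ω.e Ω.e_cocycle)) := by
      rw [Ω.span_eq_top]; trivial
    obtain ⟨c, hc⟩ := (Submodule.mem_span_range_iff_exists_fun k).1 h1
    have h0 : 𝔸.d (∑ o, c o • Ω.basisCocycle o) = 0 := by
      simp [map_sum, d_basisCocycle]
    have h2 : 𝔸.clsPi ((⟨𝔸.proj p z, hp.2⟩ : LinearMap.ker 𝔸.d) -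
        (⟨∑ o, c o • Ω.basisCocycle o, h0⟩ : LinearMap.ker 𝔸.d)) = 0 := by
      rw [map_sub, clsPi_sum, hc, 𝔸.clsPi_of_mem hp, sub_self]
    rw [𝔸.clsPi_eq_zero_iff] at h2
    refine Submodule.mem_sup.2 ⟨∑ o, c o • Ω.basisCocycle o, ?_, _, h2,
      add_sub_cancel _ _⟩
    exact sum_mem fun o _ => Submodule.smul_mem _ _ (Submodule.subset_span ⟨o, rfl⟩)
  obtain ⟨y, hy, x, hx, rfl⟩ := Submodule.mem_sup.1 h
  obtain ⟨c, rfl⟩ := (Submodule.mem_span_range_iff_exists_fun k).1 hy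
  exact ⟨c, by simpa using hx⟩

/-- A contraction of `A` onto the span of `1, e₁, …, eₙ`: the projection is
`P a = ε a • 1 + ∑ lᵢ a • eᵢ`, and `h` is a homotopy between `P` and the identity. -/
structure Contraction where
  h : A →ₗ[k] A
  ε : A →ₗ[k] k
  l : Fin n → A →ₗ[k] k
  h_mem : ∀ {i a}, a ∈ 𝔸.deg i → h a ∈ 𝔸.deg (i - 1)
  homotopy : ∀ a, 𝔸.d (h a) + h (𝔸.d a) = a - (ε a • 1 + ∑ i, l i a • Ω.e i)
  h_one : h 1 = 0
  h_e : ∀ i, h (Ω.e i) = 0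
  ε_d : ∀ a, ε (𝔸.d a) = 0
  l_d : ∀ i a, l i (𝔸.d a) = 0
  l_one : ∀ i, l i 1 = 0
  l_e : ∀ i j, l i (Ω.e j) = if i = j then 1 else 0
  l_of_ne : ∀ {i j a}, a ∈ 𝔸.deg j → Ω.deg i ≠ j → l i a = 0

/-- The maps of `exists_homotopy_of_basis` need not be homogeneous.  Their homogeneous parts of the
right degrees satisfy the same identities, as `d` and the `eᵢ` are homogeneous. -/
theorem nonempty_contraction : Nonempty Ω.Contraction := by
  obtain ⟨h₀, l, hom, hb, lb, ld⟩ := exists_homotopy_of_basis 𝔸.d 𝔸.d_d Ω.basisCocycle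
    Ω.d_basisCocycle Ω.eq_zero_of_sum_mem_range Ω.exists_sub_sum_mem_range
  let L : Option (Fin n) → A →ₗ[k] k := fun o =>
    LinearMap.proj o ∘ₗ l ∘ₗ 𝔸.proj (Ω.basisDeg o)
  have hL : ∀ o {a}, a ∈ 𝔸.deg (Ω.basisDeg o) → L o a = l a o := fun o a ha => by
    change l (𝔸.proj _ a) o = _
    rw [𝔸.proj_of_mem ha]
  have hL0 : ∀ o {i a}, a ∈ 𝔸.deg i → Ω.basisDeg o ≠ i → L o a = 0 := fun o i a ha hi => by
    change l (𝔸.proj _ a) o = _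
    rw [𝔸.proj_of_mem_ne ha hi.symm, map_zero]; rfl
  have hLd : ∀ o a, L o (𝔸.d a) = 0 := fun o a => by
    change l (𝔸.proj _ (𝔸.d a)) o = 0
    have := 𝔸.d_proj (Ω.basisDeg o - 1) a
    rw [sub_add_cancel] at this
    rw [← this, ld]; rfl
  have hLb : ∀ o o', L o (Ω.basisCocycle o') = if o = o' then 1 else 0 := by
    intro o o'
    have hm : Ω.basisCocycle o' ∈ 𝔸.deg (Ω.basisDeg o') := (Ω.basisCocycle_mem o').1
    by_cases h : Ω.basisDeg o = Ω.basisDeg o'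
    · rw [hL o (by rw [h]; exact hm), lb, Pi.single_apply]
    · rw [hL0 o hm h, if_neg]
      rintro rfl
      exact h rfl
  have hhb : ∀ o, 𝔸.homPart (-1) h₀ (Ω.basisCocycle o) = 0 := fun o => by
    rw [𝔸.homPart_of_mem _ _ (Ω.basisCocycle_mem o).1, hb, map_zero]
  have hhom : ∀ a, 𝔸.d (𝔸.homPart (-1) h₀ a) + 𝔸.homPart (-1) h₀ (𝔸.d a) =
      a - ∑ o, L o a • Ω.basisCocycle o := by
    intro a
    induction a using 𝔸.hom_induction with
    | h0 => simp
    | hom j a ha =>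
      rw [𝔸.homPart_of_mem _ _ ha, 𝔸.homPart_of_mem _ _ (𝔸.d_mem ha), 𝔸.d_proj]
      have e1 : j + -1 + 1 = j := by ring
      have e2 : j + 1 + -1 = j := by ring
      rw [e1, e2, ← map_add, hom, map_sub, 𝔸.proj_of_mem ha, map_sum]
      congr 1
      refine Finset.sum_congr rfl fun o _ => ?_
      have hm : Ω.basisCocycle o ∈ 𝔸.deg (Ω.basisDeg o) := (Ω.basisCocycle_mem o).1
      rw [map_smul]
      by_cases h : Ω.basisDeg o = j
      · subst h
        rw [𝔸.proj_of_mem hm, hL o ha]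
      · rw [𝔸.proj_of_mem_ne hm h, hL0 o ha h, smul_zero, zero_smul]
    | add a b ha hb =>
      simp only [map_add, add_smul, Finset.sum_add_distrib]
      calc _ = (𝔸.d (𝔸.homPart (-1) h₀ a) + 𝔸.homPart (-1) h₀ (𝔸.d a)) +
            (𝔸.d (𝔸.homPart (-1) h₀ b) + 𝔸.homPart (-1) h₀ (𝔸.d b)) := by abel
        _ = _ := by rw [ha, hb]; abel
  exact ⟨{
    h := 𝔸.homPart (-1) h₀
    ε := L none
    l := fun i => L (some i)
    h_mem := fun {i a} ha => by
      rw [𝔸.homPart_of_mem _ _ ha]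
      exact 𝔸.proj_mem _ _
    homotopy := fun a => by
      rw [hhom a, Fintype.sum_option]; rfl
    h_one := hhb none
    h_e := fun i => hhb (some i)
    ε_d := hLd none
    l_d := fun i => hLd (some i)
    l_one := fun i => by
      have := hLb (some i) none
      rwa [if_neg (by simp)] at this
    l_e := fun i j => by
      have := hLb (some i) (some j)
      simp only [Option.some.injEq] at this
      exact this
    l_of_ne := fun {i j a} ha h => hL0 (some i) ha h }⟩

end ChenConnection

/-! ### Leading terms -/

section Leading

theorem deconc_eq_first {L M : Type*} [AddCommGroup M] {F : List L → List L → M} {w : List L}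
    (h : ∀ u v, u ++ v = w → u ≠ [] → F u v = 0) : deconc F w = F [] w := by
  cases w with
  | nil => exact deconc_nil F
  | cons a w =>
    rw [deconc_cons, deconc_congr (G := fun _ _ => 0) (fun u v huv => ?_), deconc_zero, add_zero]
    exact h _ _ (by rw [List.cons_append, huv]) (by simp)

variable {k A : Type*} [Field k] [Ring A] [Algebra k A] (𝔸 : DGAlgebra k A)
  {M : Type*} [AddCommGroup M] [Module k M]

theorem orderGE_cons {L : Type*} {r : ℕ} {f : List L → M} (hf : f ∈ orderGE k L M (r + 1))
    (a : L) : (fun w => f (a :: w)) ∈ orderGE k L M r :=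
  fun w hw => hf _ (by simpa using hw)

theorem normalized_cons {f : List A → M} (hf : f ∈ normalized k A M) (a : A) :
    (fun w => f (a :: w)) ∈ normalized k A M :=
  mem_normalized fun u v => normalized_apply hf (a :: u) v

/-- The part of `f ∘ Q` which involves the differential of `A` but not its product. -/
def barD (f : List A → M) : List A → M
  | [] => 0
  | a :: w => -f (𝔸.d a :: w) + barD (fun u => f (𝔸.barSign 1 a :: u)) w

theorem barD_add (f g : List A → M) (w : List A) :
    barD 𝔸 (f + g) w = barD 𝔸 f w + barD 𝔸 g w := by
  induction w generalizing f g with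
  | nil => simp [barD]
  | cons a w ih =>
    have := ih (fun u => f (𝔸.barSign 1 a :: u)) (fun u => g (𝔸.barSign 1 a :: u))
    simp only [barD, Pi.add_apply]
    change _ + barD 𝔸 ((fun u => f (𝔸.barSign 1 a :: u)) + fun u => g (𝔸.barSign 1 a :: u)) w = _
    rw [this]
    abel

theorem barD_smul (c : k) (f : List A → M) (w : List A) :
    barD 𝔸 (c • f) w = c • barD 𝔸 f w := by
  induction w generalizing f with
  | nil => simp [barD]
  | cons a w ih =>
    have := ih (fun u => f (𝔸.barSign 1 a :: u))
    simp only [barD, Pi.smul_apply]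
    change _ + barD 𝔸 (c • fun u => f (𝔸.barSign 1 a :: u)) w = _
    rw [this, smul_add, smul_neg]

theorem barD_neg (f : List A → M) (w : List A) : barD 𝔸 (-f) w = -barD 𝔸 f w := by
  simpa using barD_smul 𝔸 (-1 : k) f w

theorem barQ_eq_barD {r : ℕ} {f : List A → M} (hf : f ∈ orderGE k A M r) {w : List A}
    (hw : w.length ≤ r) : barQ 𝔸 f w = barD 𝔸 f w := by
  induction w generalizing f r with
  | nil => rfl
  | cons a w ih =>
    obtain ⟨r, rfl⟩ : ∃ l, r = l + 1 := ⟨r - 1, by simp at hw; omega⟩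
    have h2 : mergeHead 𝔸 a f w = 0 := by
      cases w with
      | nil => rfl
      | cons b w => exact hf _ (by simp at hw ⊢; omega)
    rw [barQ_cons, h2, ih (orderGE_cons hf _) (by simpa using hw), sub_zero, barD]

theorem hochDiff_leading [Module A M] [Module Aᵐᵒᵖ M] [SMulCommClass A Aᵐᵒᵖ M]
    [IsScalarTower k A M] [IsScalarTower k Aᵐᵒᵖ M] (V : DGModule k M) (p : ℤ) {r : ℕ}
    {f : List A → M} (hf : f ∈ orderGE k A M r) {w : List A} (hw : w.length ≤ r) :
    hochDiff 𝔸 V p f w = V.d (f w) - (-1 : k) ^ p • barD 𝔸 f w := by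
  rw [hochDiff_apply, tauCup_eq_zero 𝔸 hf p hw, cupTau_eq_zero 𝔸 hf hw, barQ_eq_barD 𝔸 hf hw,
    smul_zero, sub_zero, add_zero]

theorem NCDifferential.eth_word_eq_zero_of_le {n : ℕ} {x : Fin n → ℤ} (E : NCDifferential k x)
    (w u : List (Fin n)) (h : u.length ≤ w.length) : E.eth (word k w) u = 0 := by
  cases w with
  | nil => rw [E.eth_one]; rfl
  | cons a w =>
    refine E.eth_order w.length _ (fun v hv => ?_) u (by simpa using h)
    rw [word_apply, if_neg]
    rintro rfl
    simp at hv

end Leading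

namespace ChenConnection

variable {k A : Type*} [Field k] [Ring A] [Algebra k A] {𝔸 : DGAlgebra k A} {n : ℕ}
  (Ω : ChenConnection 𝔸 n) {M : Type*} [AddCommGroup M] [Module k M]

theorem pullback_mem_orderGE {r : ℕ} {f : List A → M} (hf : f ∈ orderGE k A M r) :
    Ω.pullback f ∈ orderGE k (Fin n) M r := by
  intro w hw
  rw [Ω.pullback_congr (g := 0) fun z hz => hf z (by omega), pullback_zero]
  rfl

/-- In leading order, `ω` may be replaced by `∑ᵢ eᵢ ⊗ xᵢ`. -/
theorem pullback_leading {r : ℕ} {f : List A → M} (hf : f ∈ orderGE k A M r)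
    {w : List (Fin n)} (hw : w.length ≤ r) :
    Ω.pullback f w = (-1 : k) ^ pairSum (w.map Ω.x) • f (w.map Ω.e) := by
  induction w generalizing f r with
  | nil => simp [pullback_nil, pairSum]
  | cons i w ih =>
    obtain ⟨r, rfl⟩ : ∃ l, r = l + 1 := ⟨r - 1, by simp at hw; omega⟩
    have hw' : w.length ≤ r := by simpa using hw
    rw [pullback_cons, deconc_eq_first, ih (orderGE_cons hf _) hw', smul_smul, ← sgn_add,
      Ω.ω_single]
    · simp [pairSum, wdeg]
    · intro u v huv hu
      have hl : v.length < r := by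
        have := List.length_pos_iff.2 hu
        rw [← huv, List.length_append] at hw'
        omega
      rw [Ω.pullback_mem_orderGE (orderGE_cons hf _) v hl, smul_zero]

theorem diff_leading [Module A M] [Module Aᵐᵒᵖ M] [SMulCommClass A Aᵐᵒᵖ M]
    [IsScalarTower k A M] [IsScalarTower k Aᵐᵒᵖ M] (𝔐 : DGBimodule 𝔸 M) (p : ℤ) {r : ℕ}
    {s : List (Fin n) → M} (hs : s ∈ orderGE k (Fin n) M r) {w : List (Fin n)}
    (hw : w.length ≤ r) : Ω.diff 𝔐 p s w = 𝔐.d (s w) := by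
  have h1 : ethExt Ω.eth 𝔐.toDGModule s w = 0 := by
    rw [ethExt_apply _ _ _ w le_rfl]
    refine Finset.sum_eq_zero fun u hu => ?_
    rcases lt_or_ge u.length w.length with h | h
    · rw [hs u (by omega), map_zero, smul_zero]
    · rw [Ω.eth.eth_word_eq_zero_of_le _ _ h, zero_smul]
  have hl : ∀ u v : List (Fin n), u ++ v = w → v.length + u.length ≤ r := by
    rintro u v rfl
    rw [List.length_append] at hw
    omega
  have h2 : serMul Ω.x 𝔐.toDGModule (leftAct k A M) Ω.ω s w = 0 := by
    rw [serMul_apply, deconc_congr (G := fun _ _ => 0) (fun u v huv => ?_), deconc_zero]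
    cases u with
    | nil => simp [Ω.ω_nil]
    | cons i u =>
      have := hl _ _ huv
      rw [hs v (by simp at this; omega)]; simp
  have h3 : serMul Ω.x 𝔸.toDGModule (rightAct k A M) s Ω.ω w = 0 := by
    rw [serMul_apply, deconc_congr (G := fun _ _ => 0) (fun u v huv => ?_), deconc_zero]
    cases v with
    | nil => simp [Ω.ω_nil]
    | cons i v =>
      have := hl _ _ huv
      rw [hs u (by simp at this; omega)]; simp
  rw [diff_eq, Pi.add_apply, Pi.sub_apply, Pi.smul_apply, h2, h3, serD_apply, h1]
  simp

end ChenConnection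

/-! ### The contraction of the tensor powers -/

namespace ChenConnection.Contraction

variable {k A : Type*} [Field k] [Ring A] [Algebra k A] {𝔸 : DGAlgebra k A} {n : ℕ}
  {Ω : ChenConnection 𝔸 n} (c : Ω.Contraction) {M : Type*} [AddCommGroup M] [Module k M]

/-- The projection onto the span of `1, e₁, …, eₙ`. -/
def P : A →ₗ[k] A := c.ε.smulRight 1 + ∑ i, (c.l i).smulRight (Ω.e i)

theorem P_apply (a : A) : c.P a = c.ε a • 1 + ∑ i, c.l i a • Ω.e i := by
  simp [P]

theorem homotopy' (a : A) : 𝔸.d (c.h a) + c.h (𝔸.d a) = a - c.P a := by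
  rw [P_apply, c.homotopy]

theorem P_eq (a : A) : c.P a = a - (𝔸.d (c.h a) + c.h (𝔸.d a)) := by
  rw [homotopy', sub_sub_cancel]

theorem P_mem {i : ℤ} {a : A} (ha : a ∈ 𝔸.deg i) : c.P a ∈ 𝔸.deg i := by
  have h1 := 𝔸.d_mem (c.h_mem ha)
  have h2 := c.h_mem (𝔸.d_mem ha)
  rw [sub_add_cancel] at h1
  rw [add_sub_cancel_right] at h2
  rw [P_eq]
  exact sub_mem ha (add_mem h1 h2)

theorem P_d (a : A) : c.P (𝔸.d a) = 0 := by
  simp [P_apply, c.ε_d, c.l_d]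

theorem d_P (a : A) : 𝔸.d (c.P a) = 0 := by
  have : ∀ i, 𝔸.d (Ω.e i) = 0 := fun i => (Ω.e_cocycle i).2
  simp [P_apply, 𝔸.d_one, this]

theorem P_one : c.P 1 = 1 := by
  rw [P_eq, c.h_one, 𝔸.d_one, map_zero, map_zero, add_zero, sub_zero]

theorem barSign_P (a : A) : 𝔸.barSign 1 (c.P a) = c.P (𝔸.barSign 1 a) := by
  induction a using 𝔸.hom_induction with
  | h0 => simp
  | hom i a ha => rw [𝔸.barSign_of_mem 1 ha, 𝔸.barSign_of_mem 1 (c.P_mem ha), map_smul]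
  | add a b ha hb => simp only [map_add, ha, hb]

theorem barSign_h (a : A) : 𝔸.barSign 1 (c.h a) = -c.h (𝔸.barSign 1 a) := by
  induction a using 𝔸.hom_induction with
  | h0 => simp
  | hom i a ha =>
    rw [𝔸.barSign_of_mem 1 ha, 𝔸.barSign_of_mem 1 (c.h_mem ha), map_smul, ← neg_smul, ← sgn_succ]
    congr 1
    exact sgn_congr k ⟨-1, by ring⟩
  | add a b ha hb => simp only [map_add, ha, hb, neg_add]

/-- The homotopy on the tensor powers of `A`, in the tensor trick form
`∑ P ⊗ ⋯ ⊗ P ⊗ h ⊗ 1 ⊗ ⋯ ⊗ 1` with Koszul signs, composed with `f`. -/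
def tensorHomotopy (f : List A → M) : List A → M
  | [] => 0
  | a :: w => -f (c.h a :: w) + tensorHomotopy (fun u => f (𝔸.barSign 1 (c.P a) :: u)) w

theorem tensorHomotopy_add (f g : List A → M) (w : List A) :
    c.tensorHomotopy (f + g) w = c.tensorHomotopy f w + c.tensorHomotopy g w := by
  induction w generalizing f g with
  | nil => simp [tensorHomotopy]
  | cons a w ih =>
    have := ih (fun u => f (𝔸.barSign 1 (c.P a) :: u)) (fun u => g (𝔸.barSign 1 (c.P a) :: u))
    simp only [tensorHomotopy, Pi.add_apply]
    change _ + c.tensorHomotopy ((fun u => f (𝔸.barSign 1 (c.P a) :: u)) +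
      fun u => g (𝔸.barSign 1 (c.P a) :: u)) w = _
    rw [this]
    abel

theorem tensorHomotopy_comp {N : Type*} [AddCommGroup N] [Module k N] (φ : M →ₗ[k] N)
    (f : List A → M) (w : List A) :
    c.tensorHomotopy (fun z => φ (f z)) w = φ (c.tensorHomotopy f w) := by
  induction w generalizing f with
  | nil => simp [tensorHomotopy]
  | cons a w ih =>
    simp only [tensorHomotopy]
    rw [ih (fun u => f (𝔸.barSign 1 (c.P a) :: u)), map_add, map_neg]

theorem tensorHomotopy_smul (b : k) (f : List A → M) (w : List A) :
    c.tensorHomotopy (b • f) w = b • c.tensorHomotopy f w :=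
  c.tensorHomotopy_comp (LinearMap.lsmul k M b) f w

theorem tensorHomotopy_zero (w : List A) : c.tensorHomotopy (0 : List A → M) w = 0 := by
  simpa using c.tensorHomotopy_smul 0 (0 : List A → M) w

theorem tensorHomotopy_sub (f g : List A → M) (w : List A) :
    c.tensorHomotopy (f - g) w = c.tensorHomotopy f w - c.tensorHomotopy g w := by
  have := c.tensorHomotopy_smul (-1) g w
  rw [neg_one_smul, neg_one_smul] at this
  rw [sub_eq_add_neg, tensorHomotopy_add, this, sub_eq_add_neg]

theorem tensorHomotopy_mem_orderGE {r : ℕ} {f : List A → M} (hf : f ∈ orderGE k A M r) :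
    c.tensorHomotopy f ∈ orderGE k A M r := by
  intro w hw
  induction w generalizing f r with
  | nil => rfl
  | cons a w ih =>
    obtain ⟨r, rfl⟩ : ∃ l, r = l + 1 := ⟨r - 1, by simp at hw; omega⟩
    rw [tensorHomotopy, hf _ (by simpa using hw), neg_zero, zero_add]
    exact ih (orderGE_cons hf _) (by simpa using hw)

theorem tensorHomotopy_isMultilin {f : List A → M} (hf : IsMultilin k f) :
    IsMultilin k (c.tensorHomotopy f) := by
  have key : ∀ (u : List A) (f : List A → M), IsMultilin k f →
      (∀ a b v, c.tensorHomotopy f (u ++ (a + b) :: v) =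
        c.tensorHomotopy f (u ++ a :: v) + c.tensorHomotopy f (u ++ b :: v)) ∧
      (∀ (r : k) a v, c.tensorHomotopy f (u ++ (r • a) :: v) =
        r • c.tensorHomotopy f (u ++ a :: v)) := by
    intro u
    induction u with
    | nil =>
      intro f hf
      refine ⟨fun a b v => ?_, fun r a v => ?_⟩
      · simp only [List.nil_append, tensorHomotopy, map_add]
        rw [cons_add hf, tensorHomotopy_add, hf.head_add]
        abel
      · simp only [List.nil_append, tensorHomotopy, map_smul]
        rw [cons_smul hf, tensorHomotopy_smul, hf.head_smul, smul_add, smul_neg]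
    | cons x u ih =>
      intro f hf
      obtain ⟨i1, i2⟩ := ih _ (hf.cons (𝔸.barSign 1 (c.P x)))
      refine ⟨fun a b v => ?_, fun r a v => ?_⟩
      · simp only [List.cons_append, tensorHomotopy, i1, (hf.cons (c.h x)).add]
        abel
      · simp only [List.cons_append, tensorHomotopy, i2, (hf.cons (c.h x)).smul, smul_add,
          smul_neg]
  exact ⟨fun u => (key u f hf).1, fun u => (key u f hf).2⟩

theorem tensorHomotopy_hoch_mem {V : DGModule k M} {p : ℤ} {f : List A → M}
    (hf : f ∈ hochObj 𝔸 V p) : c.tensorHomotopy f ∈ hochObj 𝔸 V (p - 1) := by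
  refine ⟨c.tensorHomotopy_isMultilin hf.1, fun w => ?_⟩
  induction w generalizing f p with
  | nil => exact zero_mem _
  | cons x w ih =>
    simp only [List.map_cons, List.sum_cons, tensorHomotopy]
    refine add_mem (neg_mem ?_) ?_
    · have := hf.2 (⟨x.1 - 1, _, c.h_mem x.2.2⟩ :: w)
      simp only [List.map_cons, List.sum_cons] at this
      convert this using 2
      ring
    · have := ih (hochObj_cons 𝔸 hf (𝔸.barSign_mem 1 (c.P_mem x.2.2)))
      convert this using 2
      ring

theorem tensorHomotopy_mem_normalized {f : List A → M} (hf : IsMultilin k f)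
    (hn : f ∈ normalized k A M) : c.tensorHomotopy f ∈ normalized k A M := by
  refine mem_normalized fun u v => ?_
  induction u generalizing f with
  | nil =>
    have e : (fun u => f (𝔸.barSign 1 (c.P 1) :: u)) = 0 := by
      funext w
      have := normalized_apply hn [] w
      rw [P_one, barSign_one_unit, hf.head_neg]
      exact neg_eq_zero.2 this
    rw [List.nil_append, tensorHomotopy, e, tensorHomotopy_zero, c.h_one, hf.head_zero]
    simp
  | cons a u ih =>
    rw [List.cons_append, tensorHomotopy, ih (hf.cons _) (normalized_cons hn _), add_zero,
      neg_eq_zero]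
    exact normalized_apply hn (c.h a :: u) v

theorem tensorHomotopy_map_e {f : List A → M} (hf : IsMultilin k f) (w : List (Fin n)) :
    c.tensorHomotopy f (w.map Ω.e) = 0 := by
  induction w generalizing f with
  | nil => rfl
  | cons i w ih =>
    rw [List.map_cons, tensorHomotopy, c.h_e, hf.head_zero, ih (hf.cons _)]
    simp

theorem barD_tensorHomotopy {f : List A → M} (hf : IsMultilin k f) (w : List A) :
    barD 𝔸 (c.tensorHomotopy f) w + c.tensorHomotopy (barD 𝔸 f) w = f w - f (w.map c.P) := by
  induction w generalizing f with
  | nil => simp [barD, tensorHomotopy]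
  | cons a w ih =>
    have hi := ih (hf.cons (c.P a))
    have hz : ∀ g : List A → M, IsMultilin k g → (fun u => g (0 :: u)) = 0 := fun g hg =>
      funext fun u => hg.head_zero u
    have e1 : (fun u => c.tensorHomotopy f (𝔸.barSign 1 a :: u)) =
        (-fun u => f (c.h (𝔸.barSign 1 a) :: u)) +
          c.tensorHomotopy (fun u => f (c.P a :: u)) := by
      funext u
      simp only [tensorHomotopy, ← c.barSign_P, barSign_barSign_one]
      rfl
    have e2 : (fun u => barD 𝔸 f (𝔸.barSign 1 (c.P a) :: u)) =
        barD 𝔸 (fun u => f (c.P a :: u)) := by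
      funext u
      simp only [barD, c.barSign_P, c.d_P, hf.head_zero, neg_zero, zero_add]
      rw [barSign_barSign_one]
    have e3 : (fun u => f (𝔸.barSign 1 (c.h a) :: u)) =
        -fun u => f (c.h (𝔸.barSign 1 a) :: u) := by
      funext u
      rw [c.barSign_h, hf.head_neg]; rfl
    have e4 : f (𝔸.d (c.h a) :: w) + f (c.h (𝔸.d a) :: w) = f (a :: w) - f (c.P a :: w) := by
      rw [← hf.head_add, homotopy', sub_eq_add_neg, hf.head_add, hf.head_neg, sub_eq_add_neg]
    rw [barD, tensorHomotopy, e1, tensorHomotopy, e2, barD, e3, c.P_d, map_zero, hz f hf,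
      tensorHomotopy_zero, barD_add (k := k), barD_neg (k := k), List.map_cons,
      eq_sub_of_add_eq hi, eq_sub_of_add_eq e4]
    abel

/-- The extension of a function on the words in `e₁, …, eₙ` to the multilinear family which
factors through the projections `a ↦ ∑ lᵢ a • eᵢ`:
`[a₁, …, aₘ] ↦ ∑ l_{i₁} a₁ ⋯ l_{iₘ} aₘ • s (i₁ ⋯ iₘ)`. -/
def spread (s : List (Fin n) → M) : List A → M
  | [] => s []
  | a :: w => spread (fun u => ∑ i, c.l i a • s (i :: u)) w

theorem spread_comp {N : Type*} [AddCommGroup N] [Module k N] (φ : M →ₗ[k] N)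
    (s : List (Fin n) → M) (w : List A) :
    c.spread (fun u => φ (s u)) w = φ (c.spread s w) := by
  induction w generalizing s with
  | nil => rfl
  | cons a w ih =>
    simp only [spread]
    rw [← ih]
    simp only [map_sum, map_smul]

theorem spread_add (s t : List (Fin n) → M) (w : List A) :
    c.spread (s + t) w = c.spread s w + c.spread t w := by
  induction w generalizing s t with
  | nil => rfl
  | cons a w ih =>
    simp only [spread]
    rw [← ih]
    simp only [Pi.add_apply, smul_add, Finset.sum_add_distrib]
    rfl

theorem spread_smul (b : k) (s : List (Fin n) → M) (w : List A) :
    c.spread (b • s) w = b • c.spread s w :=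
  c.spread_comp (LinearMap.lsmul k M b) s w

theorem spread_zero (w : List A) : c.spread (0 : List (Fin n) → M) w = 0 := by
  simpa using c.spread_smul 0 (0 : List (Fin n) → M) w

/-- The value of `spread s` at `w` only involves the values of `s` on words as long as `w`. -/
theorem spread_congr {s t : List (Fin n) → M} {w : List A}
    (h : ∀ u, u.length = w.length → s u = t u) : c.spread s w = c.spread t w := by
  induction w generalizing s t with
  | nil => exact h [] rfl
  | cons a w ih =>
    refine ih fun u hu => Finset.sum_congr rfl fun i _ => ?_
    rw [h (i :: u) (by simp [hu])]

theorem spread_mem_orderGE {r : ℕ} {s : List (Fin n) → M} (hs : s ∈ orderGE k (Fin n) M r) :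
    c.spread s ∈ orderGE k A M r := fun w hw => by
  rw [c.spread_congr (t := 0) fun u hu => hs u (by omega), spread_zero]

theorem spread_isMultilin (s : List (Fin n) → M) : IsMultilin k (c.spread s) := by
  have key : ∀ (u : List A) (s : List (Fin n) → M),
      (∀ a b v, c.spread s (u ++ (a + b) :: v) =
        c.spread s (u ++ a :: v) + c.spread s (u ++ b :: v)) ∧
      (∀ (r : k) a v, c.spread s (u ++ (r • a) :: v) = r • c.spread s (u ++ a :: v)) := by
    intro u
    induction u with
    | nil =>
      intro s
      refine ⟨fun a b v => ?_, fun r a v => ?_⟩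
      · simp only [List.nil_append, spread]
        rw [← spread_add]
        simp only [map_add, add_smul, Finset.sum_add_distrib]
        rfl
      · simp only [List.nil_append, spread]
        rw [← spread_smul]
        simp only [map_smul, smul_eq_mul, mul_smul, ← Finset.smul_sum]
        rfl
    | cons x u ih => exact fun s => ih _
  exact ⟨fun u => (key u s).1, fun u => (key u s).2⟩

theorem spread_hoch_mem {V : DGModule k M} {p : ℤ} {s : List (Fin n) → M}
    (hs : s ∈ serObj Ω.x V p) : c.spread s ∈ hochObj 𝔸 V p := by
  refine ⟨c.spread_isMultilin s, fun w => ?_⟩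
  induction w generalizing s p with
  | nil => simpa [spread] using hs []
  | cons y w ih =>
    have h1 : (fun u => ∑ i, c.l i y.2 • s (i :: u)) ∈ serObj Ω.x V (p + (y.1 - 1)) := by
      intro u
      refine sum_mem fun i _ => ?_
      by_cases h : Ω.deg i = y.1
      · refine Submodule.smul_mem _ _ ?_
        have := hs (i :: u)
        rw [wdeg_cons] at this
        convert this using 2
        rw [← h]; ring
      · rw [c.l_of_ne y.2.2 h, zero_smul]
        exact zero_mem _
    have := ih h1
    simp only [List.map_cons, List.sum_cons, spread]
    convert this using 2
    ring

theorem spread_mem_normalized (s : List (Fin n) → M) : c.spread s ∈ normalized k A M := by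
  refine mem_normalized fun u v => ?_
  induction u generalizing s with
  | nil =>
    simp only [List.nil_append, spread, c.l_one, zero_smul, Finset.sum_const_zero]
    exact c.spread_zero v
  | cons a u ih => exact ih _

theorem spread_map_e (s : List (Fin n) → M) (w : List (Fin n)) :
    c.spread s (w.map Ω.e) = s w := by
  induction w generalizing s with
  | nil => rfl
  | cons i w ih =>
    rw [List.map_cons, spread, ih]
    simp [c.l_e]

theorem barD_spread (s : List (Fin n) → M) (w : List A) : barD 𝔸 (c.spread s) w = 0 := by
  induction w generalizing s with
  | nil => rfl
  | cons a w ih =>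
    have h : c.spread s (𝔸.d a :: w) = 0 := by
      simp only [spread, c.l_d, zero_smul, Finset.sum_const_zero]
      exact c.spread_zero w
    rw [barD, h, neg_zero, zero_add]
    exact ih _

/-- Normalized families do not see the component of the projection `P` along `1`. -/
theorem apply_map_P {f : List A → M} (hf : IsMultilin k f) (hn : f ∈ normalized k A M)
    (w : List A) : f (w.map c.P) = c.spread (fun u => f (u.map Ω.e)) w := by
  induction w generalizing f with
  | nil => rfl
  | cons a w ih =>
    have := ih (hf.cons (c.P a)) (normalized_cons hn _)
    rw [List.map_cons, this, spread]
    refine c.spread_congr fun u _ => ?_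
    have h1 : f (1 :: u.map Ω.e) = 0 := normalized_apply hn [] _
    have h2 : ∀ b, f (b :: u.map Ω.e) = (LinearMap.proj (u.map Ω.e) ∘ₗ hf.headL) b := fun _ => rfl
    rw [P_apply, h2, map_add, map_smul, ← h2, h1, smul_zero, zero_add, map_sum]
    refine Finset.sum_congr rfl fun i _ => ?_
    rw [map_smul, ← h2]
    rfl

end ChenConnection.Contraction

/-! ### The cone of `ω^*` is acyclic -/

namespace ChenConnection

variable {k A : Type*} [Field k] [Ring A] [Algebra k A] {𝔸 : DGAlgebra k A} {n : ℕ}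
  (Ω : ChenConnection 𝔸 n) {M : Type*} [AddCommGroup M] [Module k M] [Module A M]
  [Module Aᵐᵒᵖ M] [SMulCommClass A Aᵐᵒᵖ M] [IsScalarTower k A M] [IsScalarTower k Aᵐᵒᵖ M]

/-- A normalized cocycle `f` whose image under `ω^*` is the coboundary of `s` is, in leading order,
the coboundary of a normalized cochain with image `s`: its two summands come from the homotopy on
the tensor powers of `A`, and from the extension of `s` to a multilinear family. -/
theorem exists_leading_primitive (c : Ω.Contraction) (𝔐 : DGBimodule 𝔸 M) {p : ℤ} {r : ℕ}
    {f : List A → M} {s : List (Fin n) → M} (hf : f ∈ hochObj 𝔸 𝔐.toDGModule (p + 1))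
    (hfn : f ∈ normalized k A M) (hfd : hochDiff 𝔸 𝔐.toDGModule (p + 1) f = 0)
    (hs : s ∈ serObj Ω.x 𝔐.toDGModule p) (hfs : Ω.pullback f = Ω.diff 𝔐 p s)
    (hfr : f ∈ orderGE k A M r) (hsr : s ∈ orderGE k (Fin n) M r) :
    ∃ y ∈ hochObj 𝔸 𝔐.toDGModule p, y ∈ normalized k A M ∧ y ∈ orderGE k A M r ∧
      f - hochDiff 𝔸 𝔐.toDGModule p y ∈ orderGE k A M (r + 1) ∧
      s - Ω.pullback y ∈ orderGE k (Fin n) M (r + 1) := by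
  -- the signs of `ω^*` on words of letters are put into `s`
  let t : List (Fin n) → M := fun w => (-1 : k) ^ pairSum (w.map Ω.x) • s w
  have ht : t ∈ serObj Ω.x 𝔐.toDGModule p := fun w => Submodule.smul_mem _ _ (hs w)
  have htr : t ∈ orderGE k (Fin n) M r := fun w hw => by
    simp only [t, hsr w hw, smul_zero]
  let y : List A → M := -(-1 : k) ^ p • c.tensorHomotopy f + c.spread t
  have hy1 : c.tensorHomotopy f ∈ hochObj 𝔸 𝔐.toDGModule p := by
    have := c.tensorHomotopy_hoch_mem hf
    rwa [add_sub_cancel_right] at this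
  have hyr : y ∈ orderGE k A M r :=
    add_mem (Submodule.smul_mem _ _ (c.tensorHomotopy_mem_orderGE hfr)) (c.spread_mem_orderGE htr)
  have hy : y ∈ hochObj 𝔸 𝔐.toDGModule p :=
    add_mem (Submodule.smul_mem _ _ hy1) (c.spread_hoch_mem ht)
  refine ⟨y, hy, add_mem (Submodule.smul_mem _ _ (c.tensorHomotopy_mem_normalized hf.1 hfn))
    (c.spread_mem_normalized t), hyr, fun w hw => ?_, fun w hw => ?_⟩
  · have hw : w.length ≤ r := by omega
    -- `f` is a cocycle in leading order
    have h1 : (fun z => 𝔐.d (f z)) - (-1 : k) ^ (p + 1) • barD 𝔸 f ∈ orderGE k A M (r + 1) := by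
      intro z hz
      have := hochDiff_leading 𝔸 𝔐.toDGModule (p + 1) hfr (w := z) (by omega)
      rw [hfd] at this
      exact this.symm
    have h2 : 𝔐.d (c.tensorHomotopy f w) = (-1 : k) ^ (p + 1) • c.tensorHomotopy (barD 𝔸 f) w := by
      have := c.tensorHomotopy_mem_orderGE h1 w (by omega)
      rwa [c.tensorHomotopy_sub, c.tensorHomotopy_smul, c.tensorHomotopy_comp 𝔐.d,
        sub_eq_zero] at this
    have h3 : 𝔐.d (c.spread t w) = f (w.map c.P) := by
      rw [c.apply_map_P hf.1 hfn, ← c.spread_comp 𝔐.d]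
      refine c.spread_congr fun u hu => ?_
      have h4 := congrFun hfs u
      rw [Ω.pullback_leading hfr (by omega), Ω.diff_leading 𝔐 p hsr (by omega)] at h4
      rw [map_smul, ← h4, smul_smul, sgn_mul_self, one_smul]
    have h5 : barD 𝔸 y w = -(-1 : k) ^ p • barD 𝔸 (c.tensorHomotopy f) w := by
      rw [barD_add (k := k), barD_smul, c.barD_spread, add_zero]
    rw [Pi.sub_apply, hochDiff_leading 𝔸 𝔐.toDGModule p hyr hw, h5]
    simp only [y, Pi.add_apply, Pi.smul_apply, map_add, map_smul, h2, h3]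
    rw [eq_sub_of_add_eq (c.barD_tensorHomotopy hf.1 w)]
    simp only [smul_sub, smul_neg, neg_smul, neg_mul, sgn_succ, smul_smul, sgn_mul_self, one_smul]
    abel
  · have hw : w.length ≤ r := by omega
    rw [Pi.sub_apply, Ω.pullback_leading hyr hw]
    simp only [y, Pi.add_apply, Pi.smul_apply, c.tensorHomotopy_map_e hf.1, c.spread_map_e, t,
      smul_zero, zero_add, smul_smul, sgn_mul_self, one_smul, sub_self]

/-- The cone of `ω^*` is acyclic. -/
theorem exists_primitive (𝔐 : DGBimodule 𝔸 M) {p : ℤ}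
    {f : List A → M} {s : List (Fin n) → M} (hf : f ∈ hochObj 𝔸 𝔐.toDGModule (p + 1))
    (hfd : hochDiff 𝔸 𝔐.toDGModule (p + 1) f = 0)
    (hs : s ∈ serObj Ω.x 𝔐.toDGModule p) (hfs : Ω.pullback f = Ω.diff 𝔐 p s) :
    ∃ g ∈ hochObj 𝔸 𝔐.toDGModule p, hochDiff 𝔸 𝔐.toDGModule p g = f ∧ Ω.pullback g = s := by
  obtain ⟨c⟩ := Ω.nonempty_contraction
  -- subtracting the boundary of a cochain from `(f, s)` preserves the hypotheses
  have hsub : ∀ (f : List A → M) (s : List (Fin n) → M), f ∈ hochObj 𝔸 𝔐.toDGModule (p + 1) →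
      hochDiff 𝔸 𝔐.toDGModule (p + 1) f = 0 → s ∈ serObj Ω.x 𝔐.toDGModule p →
      Ω.pullback f = Ω.diff 𝔐 p s → ∀ y ∈ hochObj 𝔸 𝔐.toDGModule p,
      f - hochDiff 𝔸 𝔐.toDGModule p y ∈ hochObj 𝔸 𝔐.toDGModule (p + 1) ∧
      hochDiff 𝔸 𝔐.toDGModule (p + 1) (f - hochDiff 𝔸 𝔐.toDGModule p y) = 0 ∧
      s - Ω.pullback y ∈ serObj Ω.x 𝔐.toDGModule p ∧
      Ω.pullback (f - hochDiff 𝔸 𝔐.toDGModule p y) = Ω.diff 𝔐 p (s - Ω.pullback y) := by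
    intro f s hf hfd hs hfs y hy
    refine ⟨sub_mem hf (hochDiff_mem 𝔐 hy), ?_, sub_mem hs (Ω.pullback_mem hy), ?_⟩
    · rw [map_sub, hfd, hochDiff_hochDiff 𝔐 hy, sub_zero]
    · rw [pullback_sub, hfs, Ω.pullback_hochDiff 𝔐 hy, map_sub]
  obtain ⟨g₀, hg₀, hn⟩ := exists_normalized 𝔐 hf (by rw [hfd]; exact zero_mem _)
  rw [add_sub_cancel_right] at hg₀ hn
  obtain ⟨hf', hfd', hs', hfs'⟩ := hsub f s hf hfd hs hfs g₀ hg₀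
  obtain ⟨g, hg, h⟩ := exists_successive_approximation (hochObj 𝔸 𝔐.toDGModule p)
    (hochObj_of_locally 𝔸) ((hochDiff 𝔸 𝔐.toDGModule p).prod Ω.pullbackL)
    (fun N => (orderGE k A M N).prod (orderGE k (Fin n) M N))
    (fun N y hy => ⟨hochDiff_mem_orderGE 𝔸 _ _ hy, Ω.pullback_mem_orderGE hy⟩)
    (fun r => {x | x.1 ∈ hochObj 𝔸 𝔐.toDGModule (p + 1) ∧
      hochDiff 𝔸 𝔐.toDGModule (p + 1) x.1 = 0 ∧ x.2 ∈ serObj Ω.x 𝔐.toDGModule p ∧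
      Ω.pullback x.1 = Ω.diff 𝔐 p x.2 ∧ x.1 ∈ normalized k A M ∧ x.1 ∈ orderGE k A M r ∧
      x.2 ∈ orderGE k (Fin n) M r})
    (fun r x hx => by
      obtain ⟨h1, h2, h3, h4, h5, h6, h7⟩ := hx
      obtain ⟨y, hy, hyn, hyr, hy1, hy2⟩ := Ω.exists_leading_primitive c 𝔐 h1 h5 h2 h3 h4 h6 h7
      obtain ⟨h1', h2', h3', h4'⟩ := hsub x.1 x.2 h1 h2 h3 h4 y hy
      exact ⟨y, hy, hyr, h1', h2', h3', h4',
        sub_mem h5 (hochDiff_mem_normalized 𝔸 _ _ hy.1 hyn), hy1, hy2⟩)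
    (x := (f - hochDiff 𝔸 𝔐.toDGModule p g₀, s - Ω.pullback g₀))
    ⟨hf', hfd', hs', hfs', hn, fun w hw => by simp at hw, fun w hw => by simp at hw⟩
  have h' : ∀ N, f - hochDiff 𝔸 𝔐.toDGModule p g₀ - hochDiff 𝔸 𝔐.toDGModule p g ∈
      orderGE k A M N ∧ s - Ω.pullback g₀ - Ω.pullback g ∈ orderGE k (Fin n) M N := by
    intro N
    obtain ⟨x, hx, e⟩ := h N
    have e1 := add_mem e.1 hx.2.2.2.2.2.1
    have e2 := add_mem e.2 hx.2.2.2.2.2.2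
    simp only [Prod.fst_sub, Prod.snd_sub, sub_add_cancel] at e1 e2
    exact ⟨e1, e2⟩
  refine ⟨g₀ + g, add_mem hg₀ hg, ?_, ?_⟩
  · ext w
    have := (h' (w.length + 1)).1 w (by omega)
    rw [map_add, ← sub_eq_zero, ← neg_eq_zero, ← this]
    simp only [Pi.sub_apply, Pi.add_apply]
    abel
  · ext w
    have := (h' (w.length + 1)).2 w (by omega)
    rw [pullback_add, ← sub_eq_zero, ← neg_eq_zero, ← this]
    simp only [Pi.sub_apply, Pi.add_apply]
    abel

/-! ### The isomorphism in cohomology -/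

theorem pullback_mem_cocycle (𝔐 : DGBimodule 𝔸 M) {p : ℤ} {f : List A → M}
    (hf : f ∈ (hochCx 𝔐).cocycle p) : Ω.pullback f ∈ (Ω.twistedCx 𝔐).cocycle p := by
  refine ⟨Ω.pullback_mem hf.1, ?_⟩
  have h1 : hochDiff 𝔸 𝔐.toDGModule p f = 0 := hf.2
  change Ω.diff 𝔐 p (Ω.pullback f) = 0
  rw [← Ω.pullback_hochDiff 𝔐 hf.1, h1, pullback_zero]

theorem pullback_mem_coboundary_iff (𝔐 : DGBimodule 𝔸 M) {p : ℤ} {f : List A → M}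
    (hf : f ∈ (hochCx 𝔐).cocycle p) :
    Ω.pullback f ∈ (Ω.twistedCx 𝔐).coboundary p ↔ f ∈ (hochCx 𝔐).coboundary p := by
  obtain ⟨p, rfl⟩ : ∃ q, p = q + 1 := ⟨p - 1, by ring⟩
  have e : p + 1 - 1 = p := by ring
  constructor
  · rintro ⟨s, hs, h⟩
    change s ∈ serObj Ω.x 𝔐.toDGModule (p + 1 - 1) at hs
    change Ω.diff 𝔐 (p + 1 - 1) s = _ at h
    rw [e] at hs h
    obtain ⟨g, hg, hgf, -⟩ := Ω.exists_primitive 𝔐 hf.1 hf.2 hs h.symm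
    refine ⟨g, ?_, ?_⟩
    · change g ∈ hochObj 𝔸 𝔐.toDGModule (p + 1 - 1)
      rwa [e]
    · change hochDiff 𝔸 𝔐.toDGModule (p + 1 - 1) g = f
      rwa [e]
  · rintro ⟨g, hg, rfl⟩
    exact ⟨Ω.pullback g, Ω.pullback_mem hg, (Ω.pullback_hochDiff 𝔐 hg).symm⟩

/-- `ω^*` is surjective on cocycles, not only on cohomology. -/
theorem exists_cocycle_pullback_eq (𝔐 : DGBimodule 𝔸 M) {p : ℤ} {s : List (Fin n) → M}
    (hs : s ∈ (Ω.twistedCx 𝔐).cocycle p) : ∃ f ∈ (hochCx 𝔐).cocycle p, Ω.pullback f = s := by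
  have h : Ω.diff 𝔐 p s = 0 := hs.2
  obtain ⟨g, hg, hgd, hgs⟩ := Ω.exists_primitive 𝔐 (f := 0) (zero_mem _) (map_zero _) hs.1
    (by rw [pullback_zero, h])
  exact ⟨g, ⟨hg, hgd⟩, hgs⟩

/-- `ω^*` on cocycles. -/
noncomputable def pullbackCocycle (𝔐 : DGBimodule 𝔸 M) (p : ℤ) :
    (hochCx 𝔐).cocycle p →ₗ[k] (Ω.twistedCx 𝔐).cocycle p :=
  Ω.pullbackL.restrict fun _ hf => Ω.pullback_mem_cocycle 𝔐 hf

/-- The map induced by `ω^*` on cohomology. -/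
noncomputable def pullbackH (𝔐 : DGBimodule 𝔸 M) (p : ℤ) : (hochCx 𝔐).H p →ₗ[k] (Ω.twistedCx 𝔐).H p :=
  Submodule.mapQ _ _ (Ω.pullbackCocycle 𝔐 p) fun f hf =>
    (Ω.pullback_mem_coboundary_iff 𝔐 f.2).2 hf

theorem pullbackH_cls (𝔐 : DGBimodule 𝔸 M) (p : ℤ) {f : List A → M}
    (hf : f ∈ (hochCx 𝔐).cocycle p) :
    Ω.pullbackH 𝔐 p ((hochCx 𝔐).cls p f hf) =
      (Ω.twistedCx 𝔐).cls p (Ω.pullback f) (Ω.pullback_mem_cocycle 𝔐 hf) := rfl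

theorem pullbackH_bijective (𝔐 : DGBimodule 𝔸 M) (p : ℤ) :
    Function.Bijective (Ω.pullbackH 𝔐 p) := by
  constructor
  · rw [← LinearMap.ker_eq_bot, LinearMap.ker_eq_bot']
    intro a ha
    obtain ⟨f, hf, rfl⟩ := (hochCx 𝔐).cls_surj a
    rw [pullbackH_cls] at ha
    refine (Submodule.Quotient.mk_eq_zero _).2 ?_
    exact (Ω.pullback_mem_coboundary_iff 𝔐 hf).1 ((Submodule.Quotient.mk_eq_zero
      (((Ω.twistedCx 𝔐).coboundary p).submoduleOf ((Ω.twistedCx 𝔐).cocycle p))).1 ha)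
  · intro b
    obtain ⟨s, hs, rfl⟩ := (Ω.twistedCx 𝔐).cls_surj b
    obtain ⟨f, hf, rfl⟩ := Ω.exists_cocycle_pullback_eq 𝔐 hs
    exact ⟨(hochCx 𝔐).cls p f hf, rfl⟩

/-- The isomorphism induced by `ω^*` on cohomology. -/
noncomputable def pullbackEquiv (𝔐 : DGBimodule 𝔸 M) (p : ℤ) : (hochCx 𝔐).H p ≃ₗ[k] (Ω.twistedCx 𝔐).H p :=
  LinearEquiv.ofBijective (Ω.pullbackH 𝔐 p) (Ω.pullbackH_bijective 𝔐 p)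

/-- The algebra homomorphism induced by `ω^*` on cohomology. -/
noncomputable def pullbackAlgHom : (hochAlg 𝔸).HAlg →ₐ[k] Ω.twistedAlg.HAlg :=
  DirectSum.toAlgebra k (hochAlg 𝔸).H
    (fun p => DirectSum.lof k ℤ Ω.twistedAlg.H p ∘ₗ Ω.pullbackH 𝔸.self p)
    (by
      refine congrArg (DirectSum.of Ω.twistedAlg.H 0) ?_
      change Submodule.Quotient.mk _ = Submodule.Quotient.mk _
      congr 1
      exact Subtype.ext Ω.pullback_hochOne)
    (fun {p q} a b => by
      obtain ⟨f, hf, rfl⟩ := (hochAlg 𝔸).cls_surj a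
      obtain ⟨g, hg, rfl⟩ := (hochAlg 𝔸).cls_surj b
      refine Eq.trans ?_ (DirectSum.of_mul_of (A := Ω.twistedAlg.H) _ _).symm
      refine congrArg (DirectSum.of Ω.twistedAlg.H (p + q)) ?_
      change Submodule.Quotient.mk _ = Submodule.Quotient.mk _
      congr 1
      exact Subtype.ext (Ω.pullback_hochMul hf.1 hg.1))

theorem pullbackAlgHom_of (p : ℤ) (a : (hochAlg 𝔸).H p) :
    Ω.pullbackAlgHom (DirectSum.of (hochAlg 𝔸).H p a) =
      DirectSum.of Ω.twistedAlg.H p (Ω.pullbackH 𝔸.self p a) :=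
  DirectSum.toAddMonoid_of _ _ _

theorem pullbackAlgHom_bijective : Function.Bijective Ω.pullbackAlgHom := by
  have e : ∀ a, Ω.pullbackAlgHom a = DirectSum.lmap (M := (hochAlg 𝔸).H) (N := Ω.twistedAlg.H)
      (Ω.pullbackH 𝔸.self) a := by
    intro a
    induction a using DirectSum.induction_on with
    | zero => rw [map_zero, map_zero]
    | of p a => exact (Ω.pullbackAlgHom_of p a).trans (DirectSum.lmap_of _ p a).symm
    | add a b ha hb => rw [map_add, map_add, ha, hb]
  rw [funext e]
  exact ⟨(DirectSum.lmap_injective _).2 fun p => (Ω.pullbackH_bijective 𝔸.self p).1,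
    (DirectSum.lmap_surjective _).2 fun p => (Ω.pullbackH_bijective 𝔸.self p).2⟩

end ChenConnection

end ChenHoch

theorem theorem3p1 {k A : Type*} [Field k] [Ring A] [Algebra k A] (𝔸 : DGAlgebra k A) {n : ℕ}
    (Ω : ChenConnection 𝔸 n) :
    (∃ Φ : (hochAlg 𝔸).HAlg ≃ₐ[k] Ω.twistedAlg.HAlg,
      ∀ (p : ℤ) (f : List A → A) (hf : f ∈ (hochAlg 𝔸).cocycle p),
        ∃ h : Ω.pullback f ∈ Ω.twistedAlg.cocycle p,
          Φ (DirectSum.of (hochAlg 𝔸).H p ((hochAlg 𝔸).cls p f hf)) =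
            DirectSum.of Ω.twistedAlg.H p (Ω.twistedAlg.cls p (Ω.pullback f) h)) ∧
    (∀ (M : Type*) [AddCommGroup M] [Module k M] [Module A M] [Module Aᵐᵒᵖ M]
      [SMulCommClass A Aᵐᵒᵖ M] [IsScalarTower k A M] [IsScalarTower k Aᵐᵒᵖ M]
      (𝔐 : DGBimodule 𝔸 M) (p : ℤ),
      ∃ Ψ : (hochCx 𝔐).H p ≃ₗ[k] (Ω.twistedCx 𝔐).H p,
        ∀ (f : List A → M) (hf : f ∈ (hochCx 𝔐).cocycle p),
          ∃ h : Ω.pullback f ∈ (Ω.twistedCx 𝔐).cocycle p,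
            Ψ ((hochCx 𝔐).cls p f hf) = (Ω.twistedCx 𝔐).cls p (Ω.pullback f) h) := by
  refine ⟨⟨AlgEquiv.ofBijective Ω.pullbackAlgHom Ω.pullbackAlgHom_bijective, fun p f hf => ?_⟩,
    fun M _ _ _ _ _ _ _ 𝔐 p => ⟨Ω.pullbackEquiv 𝔐 p, fun f hf => ?_⟩⟩
  · exact ⟨Ω.pullback_mem_cocycle 𝔸.self hf, Ω.pullbackAlgHom_of p _⟩
  · exact ⟨Ω.pullback_mem_cocycle 𝔐 hf, rfl⟩
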